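/- Let $R$ be a commutative artinian ring and $A$ an artin $R$-algebra (finitely generated as an $R$-module) that is a connected Nakayama algebra (its indecomposable projective left modules and right modules are uniserial) of infinite global dimension. Modules are left modules, $A\text{-mod}$ is the category of finitely generated $A$-modules, $\tau = D\,\mathrm{Tr}$ is the Auslander–Reiten translation, and $P(S)$ is the projective cover of $S$. The resolution quiver of $A$ has as vertices the isomorphism classes of simple $A$-modules, with an arrow from $S$ to $\tau\operatorname{soc}P(S)$ for each simple $S$; a simple module is called cyclic if it lies on an oriented cycle of this quiver. Let $\mathcal X_c$ be the class of finitely generated indecomposable $A$-modules $X$ such that $\operatorname{top}X$ and $\tau\operatorname{soc}X$ are cyclic simple modules. A module $E\in\mathcal X_c$ is called elementary if it has the least composition length among the modules in $\mathcal X_c$ with the same top as $E$. Let $\mathcal F(\mathcal E_c)$ be the full subcategory of $A\text{-mod}$ formed by the modules $M$ having a finite filtration $0=M_0\subseteq M_1\subseteq\dots\subseteq M_m=M$ with every factor $M_i/M_{i-1}$ elementary. Then there are only finitely many cyclic simple $A$-modules up to isomorphism. Let $S_1,\dots,S_n$ be a complete list of pairwise non-isomorphic ones, and put $$A' = \operatorname{End}_A\bigl(P(S_1)\oplus\dots\oplus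 P(S_n)\bigr)^{\mathrm{op}}.$$ Then $A'$ is an artin $R$-algebra, it is a connected selfinjective Nakayama algebra, and there is an $R$-linear equivalence of categories $\mathcal F(\mathcal E_c)\simeq A'\text{-mod}$. -/

import Mathlib

open CategoryTheory

universe u

namespace NakayamaAlgebra

/-! ### General module theory -/

section Modules

variable (A : Type u) [Ring A]

/-- A module is uniserial if its submodules form a chain. -/
def IsUniserial (M : Type u) [AddCommGroup M] [Module A M] : Prop :=
  ∀ N₁ N₂ : Submodule A M, N₁ ≤ N₂ ∨ N₂ ≤ N₁

/-- A module is indecomposable if it is nonzero and is not the direct sum of two nonzero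
submodules. -/
def IsIndecomposable (M : Type u) [AddCommGroup M] [Module A M] : Prop :=
  Nontrivial M ∧ ∀ N₁ N₂ : Submodule A M, IsCompl N₁ N₂ → N₁ = ⊥ ∨ N₂ = ⊥

/-- The socle of a module: the sum of its simple submodules. -/
def socle (M : Type u) [AddCommGroup M] [Module A M] : Submodule A M :=
  sSup {N : Submodule A M | IsSimpleModule A N}

/-- The top of a module: the quotient by its radical. -/
abbrev top (M : Type u) [AddCommGroup M] [Module A M] : Type u :=
  M ⧸ Module.jacobson A M

variable {A} in
/-- `π : P → M` is a projective cover: `P` is projective, `π` is surjective, and the kernel of `π`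
is superfluous. -/
def IsProjectiveCover {P M : Type u} [AddCommGroup P] [Module A P] [AddCommGroup M] [Module A M]
    (π : P →ₗ[A] M) : Prop :=
  Module.Projective A P ∧ Function.Surjective π ∧
    ∀ N : Submodule A P, N ⊔ LinearMap.ker π = ⊤ → N = ⊤

variable {A} in
/-- `i : M → I` is an injective envelope: `I` is injective, `i` is injective, and the image of `i`
is an essential submodule. -/
def IsInjectiveEnvelope {M I : Type u} [AddCommGroup M] [Module A M] [AddCommGroup I] [Module A I]
    (i : M →ₗ[A] I) : Prop :=
  Module.Injective A I ∧ Function.Injective i ∧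
    ∀ N : Submodule A I, N ⊓ LinearMap.range i = ⊥ → N = ⊥

/-! ### Classes of rings -/

/-- Every finitely generated indecomposable projective left `A`-module is uniserial. -/
def IsLeftSerial : Prop :=
  ∀ (P : Type u) [AddCommGroup P] [Module A P], Module.Finite A P → Module.Projective A P →
    IsIndecomposable A P → IsUniserial A P

/-- The condition for an artin algebra to be a Nakayama algebra: the indecomposable projective
left modules and the indecomposable projective right modules are uniserial. -/
def IsNakayama : Prop :=
  IsLeftSerial A ∧ IsLeftSerial Aᵐᵒᵖ

/-- A ring is connected (indecomposable as a ring) if it is nonzero and its only central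
idempotents are `0` and `1`. -/
def IsConnected : Prop :=
  Nontrivial A ∧ ∀ e : A, e ∈ Set.center A → IsIdempotentElem e → e = 0 ∨ e = 1

/-- `A` is selfinjective if the regular left module is injective. -/
def IsSelfinjective : Prop :=
  Module.Injective A A

/-- The (left) global dimension: the supremum of the projective dimensions of all modules. -/
noncomputable def globalDimension : WithBot ℕ∞ :=
  ⨆ M : ModuleCat.{u} A, projectiveDimension M

end Modules

/-! ### The Auslander-Reiten translation `τ = D Tr` -/

section Translate

variable (R : Type u) [CommRing R] (A : Type u) [Ring A] [Algebra R A]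

/-- `D X = Hom_R(X, I)`. -/
def Dual (I X : Type u) [AddCommGroup I] [Module R I] [AddCommGroup X] [Module R X] : Type u :=
  X →ₗ[R] I

namespace Dual

variable (I X : Type u) [AddCommGroup I] [Module R I] [AddCommGroup X] [Module R X]

instance : AddCommGroup (Dual R I X) :=
  inferInstanceAs (AddCommGroup (X →ₗ[R] I))

/-- If `X` is a right `A`-module then `D X` is a left `A`-module by `(a • φ) x = φ (x a)`. -/
instance [Module Aᵐᵒᵖ X] [SMulCommClass Aᵐᵒᵖ R X] : Module A (Dual R I X) where
  smul a φ :=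
    { toFun := fun x => (show X →ₗ[R] I from φ) (MulOpposite.op a • x)
      map_add' := fun x y => by rw [smul_add, map_add]
      map_smul' := fun r x => by rw [smul_comm, map_smul, RingHom.id_apply] }
  one_smul φ := LinearMap.ext fun x =>
    congrArg (show X →ₗ[R] I from φ) (one_smul Aᵐᵒᵖ x)
  mul_smul a b φ := LinearMap.ext fun x =>
    congrArg (show X →ₗ[R] I from φ) (mul_smul (MulOpposite.op b) (MulOpposite.op a) x)
  smul_zero _ := rfl
  smul_add _ _ _ := rfl
  add_smul a b φ := LinearMap.ext fun x =>
    (congrArg (show X →ₗ[R] I from φ) (add_smul (MulOpposite.op a) (MulOpposite.op b) x)).trans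
      (map_add (show X →ₗ[R] I from φ) _ _)
  zero_smul φ := LinearMap.ext fun x =>
    (congrArg (show X →ₗ[R] I from φ) (zero_smul Aᵐᵒᵖ x)).trans
      (map_zero (show X →ₗ[R] I from φ))

end Dual

variable {A} in
/-- The map `Hom_A(P₀, A) → Hom_A(P₁, A)` of right `A`-modules given by precomposition with
`f : P₁ → P₀`. -/
def precomp {P₁ P₀ : Type u} [AddCommGroup P₁] [Module A P₁] [AddCommGroup P₀] [Module A P₀]
    (f : P₁ →ₗ[A] P₀) : (P₀ →ₗ[A] A) →ₗ[Aᵐᵒᵖ] (P₁ →ₗ[A] A) where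
  toFun g := g.comp f
  map_add' _ _ := rfl
  map_smul' _ _ := rfl

variable {A} in
/-- The right `A`-module `Coker(Hom_A(P₀, A) → Hom_A(P₁, A))`. If `P₁ → P₀ → M → 0` is a minimal
projective presentation this is the transpose `Tr M`. -/
abbrev Transpose {P₁ P₀ : Type u} [AddCommGroup P₁] [Module A P₁] [AddCommGroup P₀] [Module A P₀]
    (f : P₁ →ₗ[A] P₀) : Type u :=
  (P₁ →ₗ[A] A) ⧸ LinearMap.range (precomp f)

/-- `N ≅ τ M = D Tr M`, where `Tr M` is computed from a minimal projective presentation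
`P₁ → P₀ → M → 0`, and `D = Hom_R(-, I)` with `I` an injective envelope of the `R`-module
`R / rad R`. -/
def IsTranslate (M N : Type u) [AddCommGroup M] [Module A M] [AddCommGroup N] [Module A N] :
    Prop :=
  ∃ (P₀ P₁ : ModuleCat.{u} A) (π : P₀ →ₗ[A] M) (f : P₁ →ₗ[A] P₀) (I : Type u)
    (_ : AddCommGroup I) (_ : Module R I) (i : (R ⧸ Ring.jacobson R) →ₗ[R] I),
    IsProjectiveCover π ∧ LinearMap.range f = LinearMap.ker π ∧
    IsProjectiveCover f.rangeRestrict ∧ IsInjectiveEnvelope i ∧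
    Nonempty (N ≃ₗ[A] Dual R I (Transpose f))

end Translate

/-! ### The resolution quiver, elementary modules and the subcategory they filter -/

section Elementary

variable (R : Type u) [CommRing R] (A : Type u) [Ring A] [Algebra R A]

/-- There is an arrow `S → T` in the resolution quiver: `S` and `T` are simple and
`T ≅ τ soc P(S)`, where `P(S)` is the projective cover of `S`. -/
def ResolutionArrow (S T : ModuleCat.{u} A) : Prop :=
  IsSimpleModule A S ∧ IsSimpleModule A T ∧
    ∃ (P : ModuleCat.{u} A) (π : P →ₗ[A] S), IsProjectiveCover π ∧ IsTranslate R A (socle A P) T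

/-- `S` is a cyclic simple module: it lies on an oriented cycle of the resolution quiver (the
relation `ResolutionArrow` is invariant under isomorphism of the target, so a closed path of
isomorphism classes is a path from `S` to itself). -/
def IsCyclicSimple (S : ModuleCat.{u} A) : Prop :=
  Relation.TransGen (ResolutionArrow R A) S S

/-- The class `𝒳_c` of finitely generated indecomposable modules `X` such that `top X` and
`τ soc X` are cyclic simple modules. -/
def InXc (X : ModuleCat.{u} A) : Prop :=
  Module.Finite A X ∧ IsIndecomposable A X ∧ IsCyclicSimple R A (ModuleCat.of A (top A X)) ∧
    ∃ T : ModuleCat.{u} A, IsTranslate R A (socle A X) T ∧ IsCyclicSimple R A T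

/-- `E` is an elementary module: it belongs to `𝒳_c` and has the least composition length among the
modules in `𝒳_c` with the same top. -/
def IsElementary (E : ModuleCat.{u} A) : Prop :=
  InXc R A E ∧ ∀ X : ModuleCat.{u} A, InXc R A X → Nonempty (top A X ≃ₗ[A] top A E) →
    Module.length A E ≤ Module.length A X

/-- The objects of the full subcategory `ℱ(ℰ_c)`: finitely generated modules `M` with a finite
filtration `0 = C 0 ⊆ C 1 ⊆ ⋯ ⊆ C m = M` all of whose factors are elementary modules. -/
def filteredByElementary : ObjectProperty (ModuleCat.{u} A) := fun M =>
  Module.Finite A M ∧ ∃ (m : ℕ) (C : ℕ → Submodule A M), C 0 = ⊥ ∧ C m = ⊤ ∧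
    ∀ i < m, C i ≤ C (i + 1) ∧
      IsElementary R A (ModuleCat.of A (C (i + 1) ⧸ (C i).submoduleOf (C (i + 1))))

/-- A complete finite list `S 0, …, S (n - 1)` of pairwise non-isomorphic cyclic simple modules,
together with their projective covers `P 0, …, P (n - 1)`. -/
structure CyclicCovers where
  n : ℕ
  S : Fin n → ModuleCat.{u} A
  P : Fin n → ModuleCat.{u} A
  cyclic : ∀ i, IsCyclicSimple R A (S i)
  nonIso : ∀ i j, Nonempty (S i ≃ₗ[A] S j) → i = j
  complete : ∀ T : ModuleCat.{u} A, IsCyclicSimple R A T → ∃ i, Nonempty (T ≃ₗ[A] S i)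
  cover : ∀ i, ∃ π : P i →ₗ[A] S i, IsProjectiveCover π

variable {R A} in
/-- The algebra `End_A(P 0 ⊕ ⋯ ⊕ P (n - 1))ᵒᵖ`. -/
abbrev CyclicCovers.endOp (𝒞 : CyclicCovers R A) : Type u :=
  (Module.End A (∀ i, 𝒞.P i))ᵐᵒᵖ

end Elementary

end NakayamaAlgebra

open scoped ModuleCat.Algebra

/-!
# Elementary modules over a connected Nakayama algebra

Everything is expressed by a finite list of the simple modules `S i` and their projective covers
`P i` (`SimpleList`). Two relations on the indices carry the argument: `Next i j` says that `S j`
is the top of `rad (P i)`, and `Ends X j` says that `Next` leads from the socle of the uniserial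
module `X` to `j`. Since the indecomposable projective right modules are uniserial, any two maps out
of an indecomposable projective left module are comparable for divisibility
(`exists_factorization`). This makes `Next` injective and the transpose of a simple module simple,
so that `τ (S i)` is `S j` exactly when `Next i j` (`SimpleList.next_of_isTranslate`,
`SimpleList.isTranslate_of_next`). The resolution quiver thus has an arrow from `i` to `j` if and
only if `Ends (P i) j`; and if `0 ≠ K ⊂ P i` is a proper submodule, the simple module that follows
the socle of `P i ⧸ K` is the top of `K`.

Let `Q j` be the projective covers of the cyclic simple modules (`CyclicFamily`), and `P` their
direct sum. Let `trace i` be the largest proper submodule of `Q i` generated by `P`. A quotient of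
`Q i` by a proper nonzero submodule belongs to `𝒳_c` when the top of that submodule is cyclic, that
is, when the submodule is generated by `P`. Hence the elementary modules are the modules
`Elem i = Q i ⧸ trace i` (`CyclicFamily.isElementary_iff`). The arrows of the resolution quiver
preserve cyclic vertices, so `trace i` not only is generated by `P` but has a presentation by copies
of `P` (`CyclicFamily.presents_trace`). Modules presented by `P` are closed under extensions
(`Presents.extension`) and under the kernels of surjections onto elementary modules
(`Presents.ker`), and each nonzero one maps onto some `Elem i`. By induction on the length, the
modules filtered by elementary modules are the finitely generated modules presented by `P`
(`CyclicFamily.filteredByElementary_iff`). On the latter, `Hom(P, -)` is an equivalence with the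
finitely generated modules over `(End P)ᵒᵖ`, for every finitely generated projective module `P`
(`exists_equivalence`).

The properties of `(End P)ᵒᵖ` come from maps between the `Q j`. Ranges in `Q i` are comparable, and
so are maps out of `Q i`; this makes the projective modules given by the idempotents of the summands
uniserial on both sides (`isNakayama_endOp`). On oriented cycles the resolution quiver is injective,
which implies that a map `Q j → Q i` killing no nonzero map from any `Q l` is an isomorphism
(`CyclicFamily.bijective_of_ker`). The resulting double annihilator property
(`CyclicFamily.exists_comp_eq`) gives selfinjectivity by Baer's criterion.

Connectedness needs the global dimension to be infinite. The second syzygy of a uniserial module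
moves both the top and the simple module that follows the socle along arrows of the resolution
quiver. A minimal projective resolution that does not stop therefore contains a proper nonzero
submodule with cyclic top of some `Q i`
(`SimpleList.exists_submodule_of_globalDimension_eq_top`), that is, `trace i ≠ 0` for this `i`. As
`A` is connected, `Next` passes from any cyclic vertex to every other vertex
(`SimpleList.reflTransGen_next`). It follows that `trace i ≠ 0` for all `i`
(`CyclicFamily.trace_ne_bot`), and that nonzero maps connect all the `Q j`
(`CyclicFamily.forall_of_closed`), so `(End P)ᵒᵖ` has no central idempotents but `0` and `1`
(`CyclicFamily.isConnected_endOp`).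
-/

namespace NakayamaAlgebra

/-! ### Uniserial modules: tops, socles and lifting -/

section Uniserial

variable {A : Type u} [Ring A]
variable {X Y Z P S T : Type u} [AddCommGroup X] [Module A X] [AddCommGroup Y] [Module A Y]
  [AddCommGroup Z] [Module A Z] [AddCommGroup P] [Module A P] [AddCommGroup S] [Module A S]
  [AddCommGroup T] [Module A T]

variable (A) in
/-- There is a nonzero linear map `X → Y`. For `X` uniserial and `Y` simple this says that `Y` is
the top of `X`; for `X` simple and `Y` uniserial it says that `X` is the socle of `Y`. -/
def HasMap (X Y : Type u) [AddCommGroup X] [Module A X] [AddCommGroup Y] [Module A Y] : Prop :=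
  ∃ f : X →ₗ[A] Y, f ≠ 0

theorem HasMap.comp_surjective {f : X →ₗ[A] Y} (hf : Function.Surjective f) (h : HasMap A Y Z) :
    HasMap A X Z := by
  obtain ⟨g, hg⟩ := h
  refine ⟨g ∘ₗ f, fun h => hg (LinearMap.ext fun y => ?_)⟩
  obtain ⟨x, rfl⟩ := hf y
  exact LinearMap.congr_fun h x

theorem HasMap.comp_injective {f : Y →ₗ[A] Z} (hf : Function.Injective f) (h : HasMap A X Y) :
    HasMap A X Z := by
  obtain ⟨g, hg⟩ := h
  refine ⟨f ∘ₗ g, fun h => hg (LinearMap.ext fun x => hf ?_)⟩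
  simpa using LinearMap.congr_fun h x

theorem HasMap.congr_left (e : X ≃ₗ[A] Y) : HasMap A X Z ↔ HasMap A Y Z :=
  ⟨.comp_surjective e.symm.surjective, .comp_surjective e.surjective⟩

theorem HasMap.congr_right (e : Y ≃ₗ[A] Z) : HasMap A X Y ↔ HasMap A X Z :=
  ⟨.comp_injective e.injective, .comp_injective e.symm.injective⟩

theorem HasMap.nontrivial_left (h : HasMap A X Y) : Nontrivial X := by
  obtain ⟨f, hf⟩ := h
  by_contra hX
  rw [not_nontrivial_iff_subsingleton] at hX
  exact hf (Subsingleton.elim _ _)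

theorem HasMap.nontrivial_right (h : HasMap A X Y) : Nontrivial Y := by
  obtain ⟨f, hf⟩ := h
  by_contra hX
  rw [not_nontrivial_iff_subsingleton] at hX
  exact hf (Subsingleton.elim _ _)

theorem hasMap_self [Nontrivial X] : HasMap A X X := by
  obtain ⟨x, hx⟩ := exists_ne (0 : X)
  exact ⟨LinearMap.id, fun h => hx (LinearMap.congr_fun h x)⟩

/-- Nonzero maps between simple modules are isomorphisms. -/
theorem HasMap.linearEquiv [IsSimpleModule A S] [IsSimpleModule A T] (h : HasMap A S T) :
    Nonempty (S ≃ₗ[A] T) := by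
  obtain ⟨f, hf⟩ := h
  exact ⟨LinearEquiv.ofBijective f (LinearMap.bijective_of_ne_zero hf)⟩

theorem _root_.LinearEquiv.hasMap [Nontrivial X] (e : X ≃ₗ[A] Y) : HasMap A X Y :=
  (HasMap.congr_right e).1 hasMap_self

theorem IsUniserial.of_injective (h : IsUniserial A Y) {f : X →ₗ[A] Y}
    (hf : Function.Injective f) : IsUniserial A X := fun N₁ N₂ => by
  rw [← Submodule.map_le_map_iff_of_injective hf, ← Submodule.map_le_map_iff_of_injective hf]
  exact h _ _

theorem IsUniserial.of_surjective (h : IsUniserial A X) {f : X →ₗ[A] Y}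
    (hf : Function.Surjective f) : IsUniserial A Y := fun N₁ N₂ => by
  rw [← Submodule.comap_le_comap_iff_of_surjective hf,
    ← Submodule.comap_le_comap_iff_of_surjective hf]
  exact h _ _

theorem IsUniserial.submodule (h : IsUniserial A X) (N : Submodule A X) : IsUniserial A N :=
  h.of_injective N.injective_subtype

theorem IsUniserial.quotient (h : IsUniserial A X) (N : Submodule A X) : IsUniserial A (X ⧸ N) :=
  h.of_surjective N.mkQ_surjective

theorem IsUniserial.isIndecomposable (h : IsUniserial A X) [Nontrivial X] :
    IsIndecomposable A X := by
  refine ⟨inferInstance, fun N₁ N₂ hN => ?_⟩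
  rcases h N₁ N₂ with h | h
  · exact .inl (by simpa [inf_eq_left.2 h] using hN.inf_eq_bot)
  · exact .inr (by simpa [inf_eq_right.2 h] using hN.inf_eq_bot)

theorem isCoatom_ker [IsSimpleModule A S] {f : X →ₗ[A] S} (hf : f ≠ 0) :
    IsCoatom (LinearMap.ker f) :=
  LinearMap.isCoatom_ker_of_surjective (LinearMap.surjective_of_ne_zero hf)

theorem isAtom_range [IsSimpleModule A S] {f : S →ₗ[A] X} (hf : f ≠ 0) :
    IsAtom (LinearMap.range f) := by
  have := IsSimpleModule.congr
    (LinearEquiv.ofInjective f (LinearMap.injective_of_ne_zero hf)).symm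
  rwa [← isSimpleModule_iff_isAtom]

/-- The kernel of a nonzero map from a uniserial module to a simple one is the largest proper
submodule. -/
theorem IsUniserial.le_ker (h : IsUniserial A X) [IsSimpleModule A S] {f : X →ₗ[A] S}
    (hf : f ≠ 0) {N : Submodule A X} (hN : N ≠ ⊤) : N ≤ LinearMap.ker f := by
  rcases h N (LinearMap.ker f) with h | h
  · exact h
  · exact (((isCoatom_ker hf).le_iff.1 h).resolve_left hN).le

theorem IsUniserial.jacobson_eq_ker (h : IsUniserial A X) [IsSimpleModule A S] {f : X →ₗ[A] S}
    (hf : f ≠ 0) : Module.jacobson A X = LinearMap.ker f :=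
  le_antisymm (sInf_le (isCoatom_ker hf)) (le_sInf fun _ hN =>
    (hN.le_iff.1 (h.le_ker hf hN.1)).elim (fun h => ((isCoatom_ker hf).1 h).elim) (·.le))

theorem IsUniserial.le_jacobson (h : IsUniserial A X) [IsSimpleModule A S]
    (hf : HasMap A X S) {N : Submodule A X} (hN : N ≠ ⊤) : N ≤ Module.jacobson A X := by
  obtain ⟨f, hf⟩ := hf
  rw [h.jacobson_eq_ker hf]
  exact h.le_ker hf hN

theorem IsUniserial.jacobson_ne_top (h : IsUniserial A X) [IsSimpleModule A S]
    (hf : HasMap A X S) : Module.jacobson A X ≠ ⊤ := by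
  obtain ⟨f, hf⟩ := hf
  rw [h.jacobson_eq_ker hf]
  exact (isCoatom_ker hf).1

/-- The range of a nonzero map from a simple module to a uniserial one is the smallest nonzero
submodule. -/
theorem IsUniserial.range_le (h : IsUniserial A X) [IsSimpleModule A S] {f : S →ₗ[A] X}
    (hf : f ≠ 0) {N : Submodule A X} (hN : N ≠ ⊥) : LinearMap.range f ≤ N := by
  rcases h N (LinearMap.range f) with h | h
  · exact (((isAtom_range hf).le_iff.1 h).resolve_left hN).ge
  · exact h

theorem IsUniserial.surjective_of_comp_ne_zero (h : IsUniserial A X) [IsSimpleModule A S]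
    {f : X →ₗ[A] S} {g : Y →ₗ[A] X} (hfg : f ∘ₗ g ≠ 0) : Function.Surjective g := by
  rw [← LinearMap.range_eq_top]
  by_contra hg
  refine hfg (LinearMap.ext fun y => ?_)
  exact h.le_ker (fun hf => hfg (by simp [hf])) hg ⟨y, rfl⟩

/-- A projective module that maps onto the top of a uniserial module maps onto that module. -/
theorem IsUniserial.exists_surjective (h : IsUniserial A X) [IsSimpleModule A S]
    [Module.Projective A P] (hX : HasMap A X S) {g : P →ₗ[A] S} (hg : g ≠ 0) :
    ∃ (f : X →ₗ[A] S) (k : P →ₗ[A] X), f ∘ₗ k = g ∧ f ≠ 0 ∧ Function.Surjective k := by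
  obtain ⟨f, hf⟩ := hX
  obtain ⟨k, hk⟩ := Module.projective_lifting_property f g (LinearMap.surjective_of_ne_zero hf)
  exact ⟨f, k, hk, hf, h.surjective_of_comp_ne_zero (f := f) (by rwa [hk])⟩

theorem IsUniserial.top_unique (h : IsUniserial A X) [IsSimpleModule A S] [IsSimpleModule A T]
    (hS : HasMap A X S) (hT : HasMap A X T) : Nonempty (S ≃ₗ[A] T) := by
  obtain ⟨f, hf⟩ := hS
  obtain ⟨g, hg⟩ := hT
  have hk : LinearMap.ker f = LinearMap.ker g := by
    rw [← h.jacobson_eq_ker hf, h.jacobson_eq_ker hg]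
  exact ⟨(f.quotKerEquivOfSurjective (LinearMap.surjective_of_ne_zero hf)).symm ≪≫ₗ
    Submodule.quotEquivOfEq _ _ hk ≪≫ₗ
    g.quotKerEquivOfSurjective (LinearMap.surjective_of_ne_zero hg)⟩

theorem IsUniserial.socle_unique (h : IsUniserial A X) [IsSimpleModule A S] [IsSimpleModule A T]
    (hS : HasMap A S X) (hT : HasMap A T X) : Nonempty (S ≃ₗ[A] T) := by
  obtain ⟨f, hf⟩ := hS
  obtain ⟨g, hg⟩ := hT
  have hk : LinearMap.range f = LinearMap.range g :=
    le_antisymm (h.range_le hf (isAtom_range hg).1) (h.range_le hg (isAtom_range hf).1)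
  exact ⟨LinearEquiv.ofInjective f (LinearMap.injective_of_ne_zero hf) ≪≫ₗ
    LinearEquiv.ofEq _ _ hk ≪≫ₗ
    (LinearEquiv.ofInjective g (LinearMap.injective_of_ne_zero hg)).symm⟩

theorem IsUniserial.socle_eq_range (h : IsUniserial A X) [IsSimpleModule A S] {f : S →ₗ[A] X}
    (hf : f ≠ 0) : socle A X = LinearMap.range f := by
  refine le_antisymm (sSup_le fun N hN => ?_) (le_sSup ?_)
  · have : IsAtom N := isSimpleModule_iff_isAtom.1 hN
    exact ((this.le_iff.1 (h.range_le hf this.1)).resolve_left (isAtom_range hf).1).ge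
  · exact isSimpleModule_iff_isAtom.2 (isAtom_range hf)

variable (A X) in
theorem exists_simple_quotient [Nontrivial X] [Module.Finite A X] :
    ∃ N : Submodule A X, IsSimpleModule A (X ⧸ N) := by
  obtain ⟨N, hN, -⟩ := (eq_top_or_exists_le_coatom (⊥ : Submodule A X)).resolve_left bot_ne_top
  exact ⟨N, isSimpleModule_iff_isCoatom.2 hN⟩

theorem hasMap_mkQ {N : Submodule A X} (hN : N ≠ ⊤) : HasMap A X (X ⧸ N) :=
  ⟨N.mkQ, fun h => hN (by rw [← N.ker_mkQ, h, LinearMap.ker_zero])⟩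

theorem hasMap_subtype {N : Submodule A X} (hN : N ≠ ⊥) : HasMap A N X :=
  ⟨N.subtype, fun h => hN (by rw [← N.range_subtype, h, LinearMap.range_zero])⟩

theorem IsUniserial.isSimpleModule_top (h : IsUniserial A X) [Nontrivial X] [Module.Finite A X] :
    IsSimpleModule A (top A X) := by
  obtain ⟨N, hN⟩ := exists_simple_quotient A X
  have hm : N.mkQ ≠ 0 := fun h => (isSimpleModule_iff_isCoatom.1 hN).1
    (by rw [← N.ker_mkQ, h, LinearMap.ker_zero])
  change IsSimpleModule A (X ⧸ Module.jacobson A X)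
  rw [h.jacobson_eq_ker hm, N.ker_mkQ]
  exact hN

theorem IsUniserial.isSimpleModule_socle (h : IsUniserial A X) [Nontrivial X] [IsArtinian A X] :
    IsSimpleModule A (socle A X) := by
  obtain ⟨N, hN, -⟩ := (eq_bot_or_exists_atom_le (⊤ : Submodule A X)).resolve_left top_ne_bot
  have hs := isSimpleModule_iff_isAtom.2 hN
  have hm : N.subtype ≠ 0 := fun h => hN.1 (by rw [← N.range_subtype, h, LinearMap.range_zero])
  rw [h.socle_eq_range hm, N.range_subtype]
  exact hs

end Uniserial

/-! ### Projective covers of simple modules -/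

section Covers

variable {A : Type u} [Ring A]

theorem IsProjectiveCover.finite_of_simple {P S : Type u} [AddCommGroup P] [Module A P]
    [AddCommGroup S] [Module A S] [IsSimpleModule A S] {π : P →ₗ[A] S} (h : IsProjectiveCover π) :
    Module.Finite A P := by
  have := IsSimpleModule.nontrivial A S
  obtain ⟨s, hs⟩ := exists_ne (0 : S)
  obtain ⟨x, rfl⟩ := h.2.1 s
  have hx : Submodule.span A {x} = ⊤ := h.2.2 _ <| by
    have hc : IsCoatom (LinearMap.ker π) := LinearMap.isCoatom_ker_of_surjective h.2.1
    refine hc.2 _ (lt_of_le_of_ne le_sup_right fun he => hs ?_)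
    rw [← LinearMap.mem_ker, he]
    exact Submodule.mem_sup_left (Submodule.mem_span_singleton_self x)
  exact ⟨⟨{x}, by simpa using hx⟩⟩

theorem IsProjectiveCover.isIndecomposable_of_simple {P S : Type u} [AddCommGroup P] [Module A P]
    [AddCommGroup S] [Module A S] [IsSimpleModule A S] {π : P →ₗ[A] S} (h : IsProjectiveCover π) :
    IsIndecomposable A P := by
  have := IsSimpleModule.nontrivial A S
  refine ⟨h.2.1.nontrivial, fun N₁ N₂ hN => ?_⟩
  have hc : IsCoatom (LinearMap.ker π) := LinearMap.isCoatom_ker_of_surjective h.2.1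
  have key : ∀ N : Submodule A P, ¬ N ≤ LinearMap.ker π → N = ⊤ := fun N hN =>
    h.2.2 _ (hc.2 _ (right_lt_sup.2 hN))
  by_cases h₁ : N₁ ≤ LinearMap.ker π
  · by_cases h₂ : N₂ ≤ LinearMap.ker π
    · exact (hc.1 (top_le_iff.1 (hN.sup_eq_top ▸ sup_le h₁ h₂))).elim
    · exact .inl (by simpa [key N₂ h₂] using hN.inf_eq_bot)
  · exact .inr (by simpa [key N₁ h₁] using hN.inf_eq_bot)

theorem IsProjectiveCover.isUniserial (hA : IsLeftSerial A) {P S : Type u} [AddCommGroup P]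
    [Module A P] [AddCommGroup S] [Module A S] [IsSimpleModule A S] {π : P →ₗ[A] S}
    (h : IsProjectiveCover π) : IsUniserial A P :=
  hA P h.finite_of_simple h.1 h.isIndecomposable_of_simple

/-- A nonzero map from a uniserial projective module to a simple module is a projective cover. -/
theorem IsUniserial.isProjectiveCover {P S : Type u} [AddCommGroup P] [Module A P]
    [AddCommGroup S] [Module A S] [Module.Projective A P] (h : IsUniserial A P)
    {π : P →ₗ[A] S} (hπ : Function.Surjective π) [Nontrivial S] : IsProjectiveCover π := by
  refine ⟨inferInstance, hπ, fun N hN => ?_⟩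
  rcases h N (LinearMap.ker π) with h | h
  · rw [sup_eq_right.2 h, LinearMap.ker_eq_top] at hN
    obtain ⟨s, hs⟩ := exists_ne (0 : S)
    obtain ⟨x, rfl⟩ := hπ s
    exact (hs (by simp [hN])).elim
  · rwa [sup_eq_left.2 h] at hN

/-- Over a left artinian ring a simple module has an indecomposable projective cover, a projective
module of least length among those that map onto it. -/
theorem exists_indecomposable_projective [IsArtinianRing A] (S : Type u) [AddCommGroup S]
    [Module A S] [IsSimpleModule A S] :
    ∃ P : ModuleCat.{u} A, Module.Finite A P ∧ Module.Projective A P ∧ IsIndecomposable A P ∧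
      HasMap A P S := by
  have := IsSimpleModule.nontrivial A S
  let C : Set ℕ∞ := {l | ∃ P : ModuleCat.{u} A, Module.Finite A P ∧ Module.Projective A P ∧
    HasMap A P S ∧ Module.length A P = l}
  have hC : C.Nonempty := by
    obtain ⟨s, hs⟩ := exists_ne (0 : S)
    refine ⟨_, ModuleCat.of A A, inferInstanceAs (Module.Finite A A),
      inferInstanceAs (Module.Projective A A), ⟨LinearMap.toSpanSingleton A S s, fun h => hs ?_⟩,
      rfl⟩
    simpa using LinearMap.congr_fun h 1
  obtain ⟨P, hfin, hproj, hmap, hl⟩ := wellFounded_lt.min_mem C hC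
  have hmin : ∀ l ∈ C, ¬ l < Module.length A P := fun l hl' => by
    rw [hl]; exact wellFounded_lt.not_lt_min C hl'
  refine ⟨P, hfin, hproj, ⟨hmap.nontrivial_left, fun N₁ N₂ hN => ?_⟩, hmap⟩
  obtain ⟨f, hf⟩ := hmap
  have key : ∀ N N' : Submodule A P, IsCompl N N' → f ∘ₗ N.subtype ≠ 0 → N' = ⊥ := by
    intro N N' hN hf
    have hp : Module.Projective A N :=
      .of_split N.subtype (N.projectionOnto N' hN)
        (LinearMap.ext fun x => Submodule.projectionOnto_apply_left hN x)
    by_contra hb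
    refine hmin _ ⟨ModuleCat.of A N, inferInstanceAs (Module.Finite A N), hp, ⟨_, hf⟩, rfl⟩ ?_
    refine Submodule.length_lt fun ht => hb ?_
    simpa [ht] using hN.inf_eq_bot
  by_cases h₁ : f ∘ₗ N₁.subtype = 0
  · by_cases h₂ : f ∘ₗ N₂.subtype = 0
    · refine (hf (LinearMap.ker_eq_top.1 (top_le_iff.1 (hN.sup_eq_top ▸ sup_le ?_ ?_)))).elim
      · exact fun x hx => LinearMap.congr_fun h₁ ⟨x, hx⟩
      · exact fun x hx => LinearMap.congr_fun h₂ ⟨x, hx⟩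
    · exact .inl (key _ _ hN.symm h₂)
  · exact .inr (key _ _ hN h₁)

end Covers

/-! ### The finite list of simple modules -/

section SimpleList

/-- A complete finite list of pairwise non-isomorphic simple modules `S i`, with their projective
covers `P i`, which are assumed uniserial. -/
structure SimpleList (A : Type u) [Ring A] where
  n : ℕ
  S : Fin n → ModuleCat.{u} A
  P : Fin n → ModuleCat.{u} A
  simple : ∀ i, IsSimpleModule A (S i)
  nonIso : ∀ i j, Nonempty (S i ≃ₗ[A] S j) → i = j
  complete : ∀ (T : Type u) [AddCommGroup T] [Module A T], IsSimpleModule A T →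
    ∃ i, Nonempty (T ≃ₗ[A] S i)
  finite : ∀ i, Module.Finite A (P i)
  projective : ∀ i, Module.Projective A (P i)
  uniserial : ∀ i, IsUniserial A (P i)
  cover : ∀ i, HasMap A (P i) (S i)

attribute [instance] SimpleList.simple SimpleList.finite SimpleList.projective

/-- A left artinian ring has finitely many simple modules up to isomorphism: each is isomorphic to
a submodule of the semisimple module `A / rad A`, and is determined by its isotypic component. -/
theorem exists_simpleList (A : Type u) [Ring A] [IsArtinianRing A] (hA : IsLeftSerial A) :
    Nonempty (SimpleList A) := by
  classical
  let B := A ⧸ Ring.jacobson A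
  have hBm : IsSemisimpleModule A B :=
    (LinearMap.isSemisimpleModule_iff_of_bijective
      (⟨⟨id, fun _ _ => rfl⟩, fun _ _ => rfl⟩ : B →ₛₗ[Ideal.Quotient.mk (Ring.jacobson A)] B)
      Function.bijective_id).2 inferInstance
  obtain ⟨n, ⟨c⟩⟩ := Finite.exists_equiv_fin (isotypicComponents A B)
  choose N hN hc using fun k => (c.symm k).2
  choose P hP using fun k => exists_indecomposable_projective (A := A) (N k)
  refine ⟨⟨n, fun k => ModuleCat.of A (N k), P, hN, fun i j ⟨e⟩ => ?_, fun T _ _ hT => ?_,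
    fun i => (hP i).1, fun i => (hP i).2.1, fun i => hA _ (hP i).1 (hP i).2.1 (hP i).2.2.1,
    fun i => (hP i).2.2.2⟩⟩
  · refine c.symm.injective (Subtype.ext ?_)
    rw [hc i, hc j]
    exact LinearEquiv.isotypicComponent_eq e
  · have := IsSimpleModule.nontrivial A T
    obtain ⟨t, ht⟩ := exists_ne (0 : T)
    have hle : Ring.jacobson A ≤ LinearMap.ker (LinearMap.toSpanSingleton A T t) :=
      sInf_le (LinearMap.isCoatom_ker_of_surjective
        (IsSimpleModule.toSpanSingleton_surjective A ht))
    let q : B →ₗ[A] T := (Ring.jacobson A).liftQ _ hle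
    have hq : Function.Surjective q := fun x => by
      obtain ⟨a, rfl⟩ := IsSimpleModule.toSpanSingleton_surjective A ht x
      exact ⟨Submodule.Quotient.mk a, rfl⟩
    obtain ⟨L, ⟨e⟩⟩ := IsSemisimpleModule.exists_submodule_linearEquiv_quotient (LinearMap.ker q)
    let e' : T ≃ₗ[A] L := (q.quotKerEquivOfSurjective hq).symm ≪≫ₗ e.symm
    have hL : IsSimpleModule A L := IsSimpleModule.congr e'.symm
    let k := c ⟨isotypicComponent A B L, L, hL, rfl⟩
    have hk : isotypicComponent A B (N k) = isotypicComponent A B L := by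
      rw [← hc k]; simp [k]
    have := hN k
    obtain ⟨e₂⟩ := isIsotypicOfType_submodule_iff.1
      (IsIsotypicOfType.isotypicComponent A B (N k)) L (hk ▸ L.le_isotypicComponent)
    exact ⟨k, ⟨e' ≪≫ₗ e₂⟩⟩

end SimpleList

/-! ### Composition series of uniserial modules -/

namespace SimpleList

variable {A : Type u} [Ring A] (L : SimpleList A)
variable {X Y : Type u} [AddCommGroup X] [Module A X] [AddCommGroup Y] [Module A Y]

/-- `L.Next i j` says that `S j` is the top of `rad (P i)`. It will turn out that this means
`τ (S i) ≅ S j`. -/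
def Next (i j : Fin L.n) : Prop :=
  HasMap A (Module.jacobson A (L.P i)) (L.S j)

/-- For a uniserial module `X`, `L.Ends X j` says that `S j` follows the socle of `X` in the sense
of `SimpleList.Next`, so that `τ (soc X) ≅ S j`. -/
def Ends (X : Type u) [AddCommGroup X] [Module A X] (j : Fin L.n) : Prop :=
  ∃ k, HasMap A (L.S k) X ∧ L.Next k j

/-- The arrows of the resolution quiver, in terms of the list of simple modules. -/
def Arrow (i j : Fin L.n) : Prop :=
  L.Ends (L.P i) j

/-- The vertices on an oriented cycle of the resolution quiver. -/
def Cyclic (i : Fin L.n) : Prop :=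
  Relation.TransGen L.Arrow i i

theorem exists_top (X : Type u) [AddCommGroup X] [Module A X] [Nontrivial X] [Module.Finite A X] :
    ∃ i, HasMap A X (L.S i) := by
  obtain ⟨N, hN⟩ := exists_simple_quotient A X
  obtain ⟨i, ⟨e⟩⟩ := L.complete _ hN
  exact ⟨i, (HasMap.congr_right e).1 (hasMap_mkQ (isSimpleModule_iff_isCoatom.1 hN).1)⟩

theorem exists_socle (X : Type u) [AddCommGroup X] [Module A X] [Nontrivial X] [IsArtinian A X] :
    ∃ i, HasMap A (L.S i) X := by
  obtain ⟨N, hN, -⟩ := (eq_bot_or_exists_atom_le (⊤ : Submodule A X)).resolve_left top_ne_bot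
  obtain ⟨i, ⟨e⟩⟩ := L.complete N (isSimpleModule_iff_isAtom.2 hN)
  exact ⟨i, (HasMap.congr_left e).1 (hasMap_subtype hN.1)⟩

variable {L}

theorem top_unique (h : IsUniserial A X) {i j : Fin L.n} (hi : HasMap A X (L.S i))
    (hj : HasMap A X (L.S j)) : i = j :=
  L.nonIso i j (h.top_unique hi hj)

theorem socle_unique (h : IsUniserial A X) {i j : Fin L.n} (hi : HasMap A (L.S i) X)
    (hj : HasMap A (L.S j) X) : i = j :=
  L.nonIso i j (h.socle_unique hi hj)

theorem eq_of_hasMap {i j : Fin L.n} (h : HasMap A (L.S i) (L.S j)) : i = j :=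
  L.nonIso i j h.linearEquiv

theorem exists_surjective_of_top (h : IsUniserial A X) {i : Fin L.n} (hi : HasMap A X (L.S i)) :
    ∃ f : L.P i →ₗ[A] X, Function.Surjective f := by
  obtain ⟨g, hg⟩ := L.cover i
  obtain ⟨-, k, -, -, hk⟩ := h.exists_surjective hi hg
  exact ⟨k, hk⟩

theorem Next.functional {i j k : Fin L.n} (hj : L.Next i j) (hk : L.Next i k) : j = k :=
  top_unique ((L.uniserial i).submodule _) hj hk

theorem Ends.functional (h : IsUniserial A X) {j k : Fin L.n} (hj : L.Ends X j)
    (hk : L.Ends X k) : j = k := by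
  obtain ⟨a, ha, ha'⟩ := hj
  obtain ⟨b, hb, hb'⟩ := hk
  obtain rfl := socle_unique h ha hb
  exact ha'.functional hb'

theorem Arrow.functional {i j k : Fin L.n} (hj : L.Arrow i j) (hk : L.Arrow i k) : j = k :=
  Ends.functional (L.uniserial i) hj hk

theorem Ends.congr (e : X ≃ₗ[A] Y) {j : Fin L.n} : L.Ends X j ↔ L.Ends Y j :=
  exists_congr fun _ => and_congr_left fun _ => HasMap.congr_right e

/-- A nonzero submodule of a uniserial module has the same socle. -/
theorem ends_submodule_iff (h : IsUniserial A X) {N : Submodule A X} (hN : N ≠ ⊥) {j : Fin L.n} :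
    L.Ends N j ↔ L.Ends X j := by
  refine exists_congr fun k => and_congr_left fun _ =>
    ⟨.comp_injective N.injective_subtype, fun ⟨f, hf⟩ => ?_⟩
  have hr : ∀ x, f x ∈ N := fun x => h.range_le hf hN ⟨x, rfl⟩
  exact ⟨f.codRestrict N hr, fun h0 => hf (LinearMap.ext fun x => congrArg Subtype.val
    (LinearMap.congr_fun h0 x))⟩

/-- The simple module that follows the socle of `X / K` is the top of `K`. -/
theorem next_of_quotient (h : IsUniserial A X) {K : Submodule A X} {j k : Fin L.n}
    (hj : HasMap A K (L.S j)) (hk : HasMap A (L.S k) (X ⧸ K)) : L.Next k j := by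
  obtain ⟨s, hs⟩ := hk
  let N := (LinearMap.range s).comap K.mkQ
  have hsi := LinearMap.injective_of_ne_zero hs
  let e := LinearEquiv.ofInjective s hsi
  let φ : N →ₗ[A] L.S k := e.symm.toLinearMap ∘ₗ (K.mkQ.restrict (p := N) fun x hx => hx)
  have hker : ∀ x : N, φ x = 0 ↔ (x : X) ∈ K := fun x => by
    simp only [φ, LinearMap.comp_apply, LinearEquiv.coe_coe, LinearEquiv.map_eq_zero_iff]
    rw [← Submodule.Quotient.mk_eq_zero K, Subtype.ext_iff]
    rfl
  have hφs : Function.Surjective φ := fun y => by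
    obtain ⟨x, hx⟩ := K.mkQ_surjective (s y)
    refine ⟨⟨x, y, hx.symm⟩, ?_⟩
    simp only [φ, LinearMap.comp_apply, LinearEquiv.coe_coe]
    rw [LinearEquiv.symm_apply_eq]
    exact Subtype.ext hx
  have hφ : φ ≠ 0 := fun h0 => by
    have := (L.simple k).nontrivial
    obtain ⟨y, hy⟩ := exists_ne (0 : L.S k)
    obtain ⟨x, rfl⟩ := hφs y
    exact hy (by simp [h0])
  have hN := h.submodule N
  obtain ⟨g, hg⟩ := L.cover k
  obtain ⟨f, q, hfq, hf, hq⟩ := hN.exists_surjective ⟨φ, hφ⟩ hg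
  have hfφ : LinearMap.ker f = LinearMap.ker φ := by
    rw [← hN.jacobson_eq_ker hf, ← hN.jacobson_eq_ker hφ]
  have hmem : ∀ x : L.P k, x ∈ Module.jacobson A (L.P k) ↔ (q x : X) ∈ K := fun x => by
    rw [(L.uniserial k).jacobson_eq_ker hg, ← hker, ← LinearMap.mem_ker (f := φ), ← hfφ,
      LinearMap.mem_ker, LinearMap.mem_ker, ← hfq, LinearMap.comp_apply]
  refine HasMap.comp_surjective
    (f := (N.subtype ∘ₗ q).restrict (p := Module.jacobson A (L.P k)) (q := K)
      fun x hx => (hmem x).1 hx) (fun y => ?_) hj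
  have hyN : (y : X) ∈ N := ⟨0, by simp [(Submodule.Quotient.mk_eq_zero K).2 y.2]⟩
  obtain ⟨x, hx⟩ := hq ⟨y, hyN⟩
  exact ⟨⟨x, (hmem x).2 (by rw [hx]; exact y.2)⟩, Subtype.ext (congrArg (fun z : N => (z : X)) hx)⟩

theorem ends_quotient_iff [IsArtinianRing A] [Module.Finite A X] (h : IsUniserial A X)
    {K : Submodule A X} (hK : K ≠ ⊥) (hK' : K ≠ ⊤) {j : Fin L.n} :
    L.Ends (X ⧸ K) j ↔ HasMap A K (L.S j) := by
  have := Submodule.nontrivial_iff_ne_bot.2 hK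
  have := Submodule.Quotient.nontrivial_iff.2 hK'
  constructor
  · rintro ⟨k, hk, hkj⟩
    obtain ⟨i, hi⟩ := L.exists_top K
    exact (next_of_quotient h hi hk).functional hkj ▸ hi
  · intro hj
    obtain ⟨k, hk⟩ := L.exists_socle (X ⧸ K)
    exact ⟨k, hk, next_of_quotient h hj hk⟩

/-- Going down the composition series of a uniserial module. -/
theorem transGen_next [IsArtinianRing A] [Module.Finite A X] (h : IsUniserial A X)
    {i j : Fin L.n} (hi : HasMap A X (L.S i)) (hj : L.Ends X j) :
    Relation.TransGen L.Next i j := by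
  induction hl : Module.length A X using WellFoundedLT.induction generalizing X i with
  | ind l ih =>
  subst hl
  obtain ⟨f, hf⟩ := hi
  by_cases hN : Module.jacobson A X = ⊥
  · obtain ⟨k, ⟨g, hg⟩, hkj⟩ := hj
    rw [h.jacobson_eq_ker hf, LinearMap.ker_eq_bot] at hN
    obtain rfl := eq_of_hasMap (HasMap.comp_injective hN ⟨g, hg⟩)
    exact .single hkj
  · have hN' := h.jacobson_ne_top ⟨f, hf⟩
    have := Submodule.nontrivial_iff_ne_bot.2 hN
    obtain ⟨k, hk⟩ := L.exists_top (Module.jacobson A X)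
    obtain ⟨l, hl, hlk⟩ := (ends_quotient_iff h hN hN').2 hk
    have e : (X ⧸ Module.jacobson A X) ≃ₗ[A] L.S i :=
      Submodule.quotEquivOfEq _ _ (h.jacobson_eq_ker hf) ≪≫ₗ
        f.quotKerEquivOfSurjective (LinearMap.surjective_of_ne_zero hf)
    obtain rfl := eq_of_hasMap ((HasMap.congr_right e).1 hl)
    exact .head hlk (ih _ (Submodule.length_lt hN') (h.submodule _) hk
      ((ends_submodule_iff h hN).2 hj) rfl)

theorem transGen_next_of_arrow [IsArtinianRing A] {i j : Fin L.n}
    (h : Relation.TransGen L.Arrow i j) : Relation.TransGen L.Next i j := by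
  induction h with
  | single h => exact transGen_next (L.uniserial _) (L.cover _) h
  | tail _ h ih => exact ih.trans (transGen_next (L.uniserial _) (L.cover _) h)

/-- The composition factors of `P i` are reached from `i` by going along `SimpleList.Next`. -/
theorem reflTransGen_next_of_hasMap [IsArtinianRing A] {i j : Fin L.n}
    (h : HasMap A (L.P i) (L.P j)) : Relation.ReflTransGen L.Next j i := by
  obtain ⟨f, hf⟩ := h
  have hb : LinearMap.range f ≠ ⊥ := by rwa [Ne, LinearMap.range_eq_bot]
  have hu := (L.uniserial j).submodule (LinearMap.range f)
  have hi : HasMap A (LinearMap.range f) (L.S i) := by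
    have := Submodule.nontrivial_iff_ne_bot.2 hb
    obtain ⟨k, hk⟩ := L.exists_top (LinearMap.range f)
    exact top_unique (L.uniserial i) (L.cover i)
      (HasMap.comp_surjective f.surjective_rangeRestrict hk) ▸ hk
  by_cases ht : LinearMap.range f = ⊤
  · rw [LinearMap.range_eq_top] at ht
    obtain rfl := top_unique (L.uniserial i) (L.cover i) (HasMap.comp_surjective ht (L.cover j))
    exact .refl
  · refine (transGen_next ((L.uniserial j).quotient (LinearMap.range f)) ?_
      ((ends_quotient_iff (L.uniserial j) hb ht).2 hi)).to_reflTransGen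
    have := Submodule.Quotient.nontrivial_iff.2 ht
    obtain ⟨k, hk⟩ := L.exists_top (L.P j ⧸ LinearMap.range f)
    exact top_unique (L.uniserial j) (L.cover j)
      (HasMap.comp_surjective (Submodule.mkQ_surjective _) hk) ▸ hk

end SimpleList

/-! ### Factorization of maps between indecomposable projective modules -/

section Factorization

variable {A : Type u} [Ring A]
variable {P Q Q' : Type u} [AddCommGroup P] [Module A P] [AddCommGroup Q] [Module A Q]
  [AddCommGroup Q'] [Module A Q']

/-- The elements of the dual module `Hom_A(P, A)` are right multiples of a dual generator. -/
theorem op_smul_dual {x : P} {ψ : P →ₗ[A] A} (hx : ∀ p, ψ p • x = p) (ξ : P →ₗ[A] A) :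
    MulOpposite.op (ξ x) • ψ = ξ :=
  LinearMap.ext fun p => by
    rw [LinearMap.smul_apply, MulOpposite.smul_eq_mul_unop, MulOpposite.unop_op, ← smul_eq_mul,
      ← map_smul, hx]

variable [Module.Finite A P] [Module.Finite A Q] [Module.Finite A Q']
  [Module.Projective A P] [Module.Projective A Q] [Module.Projective A Q']

/-- A uniserial finitely generated projective module is a direct summand of the regular module. -/
theorem IsUniserial.exists_dual (h : IsUniserial A P) :
    ∃ (x : P) (ψ : P →ₗ[A] A), ∀ p, ψ p • x = p := by
  rcases subsingleton_or_nontrivial P with _ | _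
  · exact ⟨0, 0, fun p => Subsingleton.elim _ _⟩
  · obtain ⟨N, hN⟩ := exists_simple_quotient A P
    have hN' := (isSimpleModule_iff_isCoatom.1 hN).1
    obtain ⟨x, hx⟩ := SetLike.exists_not_mem_of_ne_top N hN' rfl
    have hs : Function.Surjective (LinearMap.toSpanSingleton A P x) := by
      rw [← LinearMap.range_eq_top, LinearMap.range_toSpanSingleton]
      rcases h N (Submodule.span A {x}) with h | h
      · exact ((isSimpleModule_iff_isCoatom.1 hN).le_iff.1 h).resolve_right
          fun h => hx (h ▸ Submodule.mem_span_singleton_self x)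
      · by_contra ht
        exact hx (h (Submodule.mem_span_singleton_self x))
    obtain ⟨ψ, hψ⟩ := Module.projective_lifting_property _ LinearMap.id hs
    exact ⟨x, ψ, fun p => LinearMap.congr_fun hψ p⟩

/-- If the indecomposable projective right modules are uniserial, then the dual `Hom_A(P, A)` of a
uniserial projective left module `P` is uniserial. -/
theorem IsUniserial.dual (hA : IsLeftSerial Aᵐᵒᵖ) (h : IsUniserial A P) :
    IsUniserial Aᵐᵒᵖ (P →ₗ[A] A) := by
  obtain ⟨x, ψ, hx⟩ := h.exists_dual
  rcases subsingleton_or_nontrivial (P →ₗ[A] A) with _ | _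
  · exact fun N₁ N₂ => .inl (Subsingleton.elim N₁ N₂).le
  let σ : Aᵐᵒᵖ →ₗ[Aᵐᵒᵖ] (P →ₗ[A] A) := LinearMap.toSpanSingleton _ _ ψ
  let ρ : (P →ₗ[A] A) →ₗ[Aᵐᵒᵖ] Aᵐᵒᵖ :=
    { toFun := fun ξ => MulOpposite.op (ξ x)
      map_add' := fun _ _ => rfl
      map_smul' := fun _ _ => rfl }
  have hσρ : σ ∘ₗ ρ = LinearMap.id := LinearMap.ext fun ξ => op_smul_dual hx ξ
  have hf : Module.Finite Aᵐᵒᵖ (P →ₗ[A] A) :=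
    .of_surjective σ fun ξ => ⟨ρ ξ, LinearMap.congr_fun hσρ ξ⟩
  refine hA _ hf (.of_split ρ σ hσρ) ⟨inferInstance, fun N₁ N₂ hN => ?_⟩
  have hψ : ψ ∈ N₁ ⊔ N₂ := hN.sup_eq_top ▸ Submodule.mem_top
  obtain ⟨χ₁, h₁, χ₂, h₂, hχ⟩ := Submodule.mem_sup.1 hψ
  -- The dual is indecomposable: let `ψ = χ + χ'` along a decomposition, `p ↦ χ p • x` being onto `P`.
  -- Every `ξ ∈ N'` is `ψ` times `ξ x`, so `χ` times `ξ x` lies in both summands and is zero; hence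
  -- `ξ (χ p • x) = χ p * ξ x = 0` for all `p`, and `ξ = 0`.
  have key : ∀ N N' : Submodule Aᵐᵒᵖ (P →ₗ[A] A), N ⊓ N' = ⊥ → ∀ χ ∈ N, ∀ χ' ∈ N', χ + χ' = ψ →
      Function.Surjective (LinearMap.toSpanSingleton A P x ∘ₗ χ) → N' = ⊥ := by
    intro N N' hN χ hχ χ' hχ' hψ hs
    refine (Submodule.eq_bot_iff _).2 fun ξ hξ => ?_
    have hξψ := op_smul_dual hx ξ
    have h0 : MulOpposite.op (ξ x) • χ = 0 := by
      rw [← Submodule.mem_bot Aᵐᵒᵖ, ← hN]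
      refine ⟨N.smul_mem _ hχ, ?_⟩
      rw [← hψ, smul_add] at hξψ
      rw [eq_sub_of_add_eq hξψ]
      exact N'.sub_mem hξ (N'.smul_mem _ hχ')
    refine LinearMap.ext fun p => ?_
    obtain ⟨q, rfl⟩ := hs p
    simpa [map_smul] using LinearMap.congr_fun h0 q
  have hsum : ∀ p, χ₁ p • x + χ₂ p • x = p := fun p => by
    rw [← add_smul, ← LinearMap.add_apply, hχ, hx]
  rcases h (LinearMap.range (LinearMap.toSpanSingleton A P x ∘ₗ χ₁))
    (LinearMap.range (LinearMap.toSpanSingleton A P x ∘ₗ χ₂)) with hle | hle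
  · refine .inl (key N₂ N₁ (inf_comm N₁ N₂ ▸ hN.inf_eq_bot) χ₂ h₂ χ₁ h₁ (by rw [add_comm, hχ]) ?_)
    rw [← LinearMap.range_eq_top, eq_top_iff]
    exact fun p _ => hsum p ▸ Submodule.add_mem _ (hle ⟨p, rfl⟩) ⟨p, rfl⟩
  · refine .inr (key N₁ N₂ hN.inf_eq_bot χ₁ h₁ χ₂ h₂ hχ ?_)
    rw [← LinearMap.range_eq_top, eq_top_iff]
    exact fun p _ => hsum p ▸ Submodule.add_mem _ ⟨p, rfl⟩ (hle ⟨p, rfl⟩)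

/-- Of two maps out of an indecomposable projective module over a Nakayama algebra into
indecomposable projective modules, one factors through the other. -/
theorem exists_factorization (hA : IsLeftSerial Aᵐᵒᵖ) (hP : IsUniserial A P)
    (hQ : IsUniserial A Q) (hQ' : IsUniserial A Q') (g : P →ₗ[A] Q) (g' : P →ₗ[A] Q') :
    (∃ t : Q' →ₗ[A] Q, g = t ∘ₗ g') ∨ ∃ t : Q →ₗ[A] Q', g' = t ∘ₗ g := by
  obtain ⟨x, ψ, hx⟩ := hQ.exists_dual
  obtain ⟨x', ψ', hx'⟩ := hQ'.exists_dual
  rcases hP.dual hA (Submodule.span _ {ψ ∘ₗ g}) (Submodule.span _ {ψ' ∘ₗ g'}) with h | h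
  · left
    obtain ⟨a, ha⟩ := Submodule.mem_span_singleton.1 (h (Submodule.mem_span_singleton_self _))
    refine ⟨LinearMap.toSpanSingleton A Q (a.unop • x) ∘ₗ ψ', LinearMap.ext fun p => ?_⟩
    have := LinearMap.congr_fun ha p
    rw [← hx (g p)]
    simp only [LinearMap.smul_apply, LinearMap.comp_apply, MulOpposite.smul_eq_mul_unop] at this
    simp [← this, mul_smul]
  · right
    obtain ⟨a, ha⟩ := Submodule.mem_span_singleton.1 (h (Submodule.mem_span_singleton_self _))
    refine ⟨LinearMap.toSpanSingleton A Q' (a.unop • x') ∘ₗ ψ, LinearMap.ext fun p => ?_⟩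
    have := LinearMap.congr_fun ha p
    rw [← hx' (g' p)]
    simp only [LinearMap.smul_apply, LinearMap.comp_apply, MulOpposite.smul_eq_mul_unop] at this
    simp [← this, mul_smul]

/-- A simple module follows at most one simple module. -/
theorem SimpleList.Next.injective [IsArtinianRing A] (hA : IsLeftSerial Aᵐᵒᵖ) {L : SimpleList A}
    {i j k : Fin L.n} (hi : L.Next i k) (hj : L.Next j k) : i = j := by
  -- A cover `P k → rad (P j)` does not factor through a map `P i → P j` that is not onto, since
  -- the latter carries `rad (P i)` into a submodule of `rad (rad (P j))`.
  have key : ∀ i j : Fin L.n, L.Next j k → ∀ (f : L.P k →ₗ[A] L.P i) (g : L.P k →ₗ[A] L.P j),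
      LinearMap.range f = Module.jacobson A (L.P i) →
      LinearMap.range g = Module.jacobson A (L.P j) →
      (∃ t, g = t ∘ₗ f) → i = j := by
    rintro i j hj f g hf hg ⟨t, rfl⟩
    by_cases ht : Function.Surjective t
    · exact SimpleList.top_unique (L.uniserial i) (L.cover i) (.comp_surjective ht (L.cover j))
    · rw [← LinearMap.range_eq_top] at ht
      have hu := (L.uniserial j).submodule (Module.jacobson A (L.P j))
      have hr : ∀ x, t x ∈ Module.jacobson A (L.P j) := fun x =>
        (L.uniserial j).le_jacobson (L.cover j) ht ⟨x, rfl⟩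
      let t' : L.P i →ₗ[A] Module.jacobson A (L.P j) := t.codRestrict _ hr
      obtain ⟨s, hs⟩ := hj
      have hst : ∀ y ∈ Module.jacobson A (L.P i), s (t' y) = 0 := fun y hy => by
        by_cases h0 : s ∘ₗ t' = 0
        · exact LinearMap.congr_fun h0 y
        · rwa [(L.uniserial i).jacobson_eq_ker h0] at hy
      refine (hs (LinearMap.ext fun y => ?_)).elim
      obtain ⟨y, hy⟩ := y
      have hy' := hy
      rw [← hg] at hy'
      obtain ⟨z, rfl⟩ := hy'
      exact hst (f z) (hf ▸ ⟨z, rfl⟩)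
  have hcov : ∀ i, L.Next i k → ∃ f : L.P k →ₗ[A] L.P i,
      LinearMap.range f = Module.jacobson A (L.P i) := fun i hi => by
    obtain ⟨f, hf⟩ := SimpleList.exists_surjective_of_top ((L.uniserial i).submodule _) hi
    refine ⟨Submodule.subtype _ ∘ₗ f, ?_⟩
    rw [LinearMap.range_comp, LinearMap.range_eq_top.2 hf, Submodule.map_top,
      Submodule.range_subtype]
  obtain ⟨f, hf⟩ := hcov i hi
  obtain ⟨g, hg⟩ := hcov j hj
  rcases exists_factorization hA (L.uniserial k) (L.uniserial i) (L.uniserial j) f g with h | h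
  · exact (key j i hi g f hg hf h).symm
  · exact key i j hj f g hf hg h

end Factorization

/-! ### Injective envelopes -/

section Envelope

variable {R : Type u} [Ring R] {J : Type u} [AddCommGroup J] [Module R J]

/-- `E` is an essential extension of `M` inside the module `J`, expressed with elements. -/
def IsEssentialOver (M E : Submodule R J) : Prop :=
  ∀ x ∈ E, x ≠ 0 → ∃ r : R, r • x ≠ 0 ∧ r • x ∈ M

theorem IsEssentialOver.exists_maximal (M : Submodule R J) :
    ∃ E, M ≤ E ∧ Maximal (fun E => M ≤ E ∧ IsEssentialOver M E) E := by
  refine zorn_le_nonempty₀ {E | M ≤ E ∧ IsEssentialOver M E} (fun c hc hchain y hy => ?_) M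
    ⟨le_rfl, fun x hx h0 => ⟨1, by simpa using h0, by simpa using hx⟩⟩
  refine ⟨sSup c, ⟨(hc hy).1.trans (le_sSup hy), fun x hx h0 => ?_⟩, fun z hz => le_sSup hz⟩
  obtain ⟨z, hz, hxz⟩ := (Submodule.mem_sSup_of_directed ⟨y, hy⟩ hchain.directedOn).1 hx
  exact (hc hz).2 x hxz h0

/-- By Zorn's lemma, a submodule has a complement in the sense of a submodule maximal among those
that meet it trivially. -/
theorem exists_maximal_disjoint (E : Submodule R J) :
    ∃ C : Submodule R J, Maximal (fun C => C ⊓ E = ⊥) C := by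
  refine (zorn_le_nonempty₀ {C : Submodule R J | C ⊓ E = ⊥}
    (fun c hc hchain y hy => ?_) ⊥ (by simp)).imp fun _ h => h.2
  refine ⟨sSup c, ?_, fun z hz => le_sSup hz⟩
  refine (Submodule.eq_bot_iff _).2 fun x hx => ?_
  obtain ⟨z, hz, hxz⟩ := (Submodule.mem_sSup_of_directed ⟨y, hy⟩ hchain.directedOn).1 hx.1
  exact (Submodule.mem_bot R).1 (hc hz ▸ ⟨hxz, hx.2⟩)

/-- A maximal essential extension inside an injective module is a direct summand. -/
theorem exists_injectiveEnvelope (R : Type u) [Ring R] (M : Type u) [AddCommGroup M]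
    [Module R M] : ∃ (I : Type u) (_ : AddCommGroup I) (_ : Module R I) (i : M →ₗ[R] I),
      IsInjectiveEnvelope i := by
  obtain ⟨⟨J, hJ, j, hj⟩⟩ := EnoughInjectives.presentation (ModuleCat.of R M)
  have hJ' : Module.Injective R J := (Module.injective_iff_injective_object R J).2 hJ
  replace hj : Function.Injective j.hom := (ModuleCat.mono_iff_injective j).1 hj
  obtain ⟨E, hME, hE⟩ := IsEssentialOver.exists_maximal (LinearMap.range j.hom)
  obtain ⟨C, hC⟩ := exists_maximal_disjoint E
  let e : E →ₗ[R] J ⧸ C := C.mkQ ∘ₗ E.subtype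
  have he : Function.Injective e := (injective_iff_map_eq_zero e).2 fun x hx => by
    have : (x : J) ∈ C := (Submodule.Quotient.mk_eq_zero C).1 hx
    exact Subtype.ext ((Submodule.mem_bot R).1 (hC.prop ▸ ⟨this, x.2⟩))
  obtain ⟨θ, hθ⟩ := Module.Injective.extension_property R J _ _ e he E.subtype
  have hθ' : ∀ x : E, θ (e x) = x := LinearMap.congr_fun hθ
  -- `E` is essential in `J / C`.
  have hess : ∀ x : J ⧸ C, x ≠ 0 → ∃ (r : R) (y : E), y ≠ 0 ∧ r • x = e y := by
    intro x hx
    obtain ⟨x, rfl⟩ := C.mkQ_surjective x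
    have hxC : x ∉ C := fun h => hx ((Submodule.Quotient.mk_eq_zero C).2 h)
    have hne : (C ⊔ Submodule.span R {x}) ⊓ E ≠ ⊥ := fun h =>
      hxC (hC.le_of_ge h le_sup_left (Submodule.mem_sup_right
        (Submodule.mem_span_singleton_self x)))
    obtain ⟨y, ⟨hy, hyE⟩, hy0⟩ := Submodule.exists_mem_ne_zero_of_ne_bot hne
    obtain ⟨c, hc, z, hz, rfl⟩ := Submodule.mem_sup.1 hy
    obtain ⟨r, rfl⟩ := Submodule.mem_span_singleton.1 hz
    refine ⟨r, ⟨_, hyE⟩, fun h => hy0 (congrArg Subtype.val h), ?_⟩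
    simp only [e, LinearMap.comp_apply, Submodule.subtype_apply, map_add, map_smul]
    rw [Submodule.mkQ_apply C c, (Submodule.Quotient.mk_eq_zero C).2 hc, zero_add]
  have hrange : LinearMap.range θ ≤ E := by
    refine hE.le_of_ge ⟨fun x hx => ⟨e ⟨x, hME hx⟩, hθ' _⟩, ?_⟩ fun x hx => ⟨e ⟨x, hx⟩, hθ' _⟩
    rintro _ ⟨x, rfl⟩ hx
    obtain ⟨r, y, hy, hry⟩ := hess x (fun h => hx (by simp [h]))
    have hy' : r • θ x = y := by rw [← map_smul, hry, hθ']
    obtain ⟨s, hs, hs'⟩ := hE.prop.2 y y.2 (fun h => hy (Subtype.ext h))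
    exact ⟨s * r, by rwa [mul_smul, hy'], by rwa [mul_smul, hy']⟩
  let ρ : J →ₗ[R] E := (θ ∘ₗ C.mkQ).codRestrict E fun x => hrange ⟨_, rfl⟩
  have hρ : ∀ x : E, ρ x = x := fun x => Subtype.ext (hθ' x)
  refine ⟨E, inferInstance, inferInstance, j.hom.codRestrict E fun x => hME ⟨x, rfl⟩, ⟨?_⟩,
    fun x y h => hj (congrArg Subtype.val h), fun N hN => ?_⟩
  · intro X Y _ _ _ _ f hf g
    obtain ⟨h, hh⟩ := hJ'.out f hf (E.subtype ∘ₗ g)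
    exact ⟨ρ ∘ₗ h, fun x => by rw [LinearMap.comp_apply, hh]; exact hρ _⟩
  · by_contra hN0
    obtain ⟨x, hx, hx0⟩ := Submodule.exists_mem_ne_zero_of_ne_bot hN0
    obtain ⟨r, hr, m, hm⟩ := hE.prop.2 x x.2 (fun h => hx0 (Subtype.ext h))
    have : r • x ∈ N ⊓ LinearMap.range (j.hom.codRestrict E fun x => hME ⟨x, rfl⟩) :=
      ⟨N.smul_mem r hx, m, Subtype.ext hm⟩
    rw [hN, Submodule.mem_bot] at this
    exact hr (congrArg Subtype.val this)

end Envelope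

/-! ### The duality `D` on simple modules -/

section DualSimple

variable {R : Type u} [CommRing R]

theorem Dual.smul_apply' {A : Type u} [Ring A] {I X : Type u} [AddCommGroup I] [Module R I]
    [AddCommGroup X] [Module R X] [Module Aᵐᵒᵖ X] [SMulCommClass Aᵐᵒᵖ R X]
    (a : A) (φ : Dual R I X) (x : X) :
    (show X →ₗ[R] I from a • φ) x = (show X →ₗ[R] I from φ) (MulOpposite.op a • x) :=
  rfl

variable [IsArtinianRing R]

/-- Over a commutative artinian ring the elements of `R / rad R` that are annihilated by a maximal
ideal `m` are the multiples of a single one, so the same holds in the injective envelope. -/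
theorem IsInjectiveEnvelope.exists_generator {I : Type u} [AddCommGroup I] [Module R I]
    {i : (R ⧸ Ring.jacobson R) →ₗ[R] I} (hi : IsInjectiveEnvelope i) (m : Ideal R)
    [hm : m.IsMaximal] :
    ∃ y : I, y ≠ 0 ∧ (∀ r ∈ m, r • y = 0) ∧
      ∀ z : I, (∀ r ∈ m, r • z = 0) → ∃ r : R, z = r • y := by
  have hJ : ∀ x : R, x ∈ Ring.jacobson R ↔ ∀ M : Ideal R, M.IsMaximal → x ∈ M := fun x => by
    rw [Ring.jacobson_eq_sInf_isMaximal, Submodule.mem_sInf]; rfl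
  -- an element lying in all maximal ideals except `m`
  obtain ⟨y, hym, hy⟩ : ∃ y : R, y ∉ m ∧ ∀ M : Ideal R, M.IsMaximal → M ≠ m → y ∈ M := by
    classical
    let s : Finset (Ideal R) := (IsArtinianRing.setOfPred_isMaximal_finite R).toFinset.erase m
    have : ¬ s.inf id ≤ m := by
      rw [hm.isPrime.inf_le']
      rintro ⟨M, hM, hle⟩
      simp only [s, Finset.mem_erase, Set.Finite.mem_toFinset] at hM
      exact hM.1 (Ideal.IsMaximal.eq_of_le hM.2 hm.ne_top hle)
    obtain ⟨y, hy, hym⟩ := SetLike.not_le_iff_exists.1 this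
    refine ⟨y, hym, fun M hM hne => (Finset.inf_le (f := id) ?_ : s.inf id ≤ M) hy⟩
    simp only [s, Finset.mem_erase, Set.Finite.mem_toFinset]
    exact ⟨hne, hM⟩
  let q : R → R ⧸ Ring.jacobson R := Submodule.Quotient.mk
  have hq : ∀ x, q x = 0 ↔ x ∈ Ring.jacobson R := fun x => Submodule.Quotient.mk_eq_zero _
  have hmy : ∀ r ∈ m, r * y ∈ Ring.jacobson R := fun r hr => (hJ _).2 fun M hM => by
    by_cases h : M = m
    · exact h ▸ m.mul_mem_right _ hr
    · exact M.mul_mem_left _ (hy M hM h)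
  obtain ⟨w, hw⟩ : ∃ w, 1 - w * y ∈ m := by
    obtain ⟨a, μ, hμ, h⟩ := hm.exists_inv hym
    exact ⟨a, by rwa [← h, add_sub_cancel_left]⟩
  -- uniqueness inside `R / rad R`
  have huniq : ∀ z : R, (∀ r ∈ m, r * z ∈ Ring.jacobson R) → q z = (z * w) • q y := fun z hz => by
    change q z = q ((z * w) * y)
    rw [← sub_eq_zero]
    change q (z - z * w * y) = 0
    rw [hq]
    convert hz _ hw using 1
    ring
  have hinj := hi.2.1
  refine ⟨i (q y), fun h => ?_, fun r hr => ?_, fun z hz => ?_⟩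
  · rw [map_eq_zero_iff i hinj, hq, hJ] at h
    exact hym (h m hm)
  · rw [← map_smul]
    change i (q (r * y)) = 0
    rw [(hq _).2 (hmy r hr), map_zero]
  · by_cases hz0 : z = 0
    · exact ⟨0, by simp [hz0]⟩
    have hne : Submodule.span R {z} ⊓ LinearMap.range i ≠ ⊥ := fun h => hz0 (by
      simpa using hi.2.2 _ h)
    obtain ⟨x, ⟨hx, x', hx'⟩, hx0⟩ := Submodule.exists_mem_ne_zero_of_ne_bot hne
    obtain ⟨r, rfl⟩ := Submodule.mem_span_singleton.1 hx
    have hrm : r ∉ m := fun h => hx0 (hz r h)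
    obtain ⟨a, μ, hμ, h⟩ := hm.exists_inv hrm
    obtain ⟨x', rfl⟩ := Submodule.Quotient.mk_surjective _ x'
    have hz' : z = i (q (a * x')) := by
      change z = i (a • q x')
      rw [map_smul, hx', smul_smul]
      nth_rw 1 [← one_smul R z, ← h, add_smul, hz μ hμ, add_zero]
    have := huniq (a * x') fun r hr => by
      rw [← hq]
      apply hinj
      change i (r • q (a * x')) = _
      rw [map_smul, ← hz', hz r hr, map_zero]
    exact ⟨_, by rw [hz', this, map_smul]⟩

/-- `D` carries simple right modules to simple left modules. -/
theorem Dual.isSimpleModule {A : Type u} [Ring A] [Algebra R A] {I X : Type u} [AddCommGroup I]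
    [Module R I] {i : (R ⧸ Ring.jacobson R) →ₗ[R] I} (hi : IsInjectiveEnvelope i)
    [AddCommGroup X] [Module R X] [Module Aᵐᵒᵖ X] [SMulCommClass Aᵐᵒᵖ R X]
    [IsScalarTower R Aᵐᵒᵖ X] [Module.Finite R X] [IsSimpleModule Aᵐᵒᵖ X] :
    IsSimpleModule A (Dual R I X) := by
  have hX := IsSimpleModule.nontrivial Aᵐᵒᵖ X
  have hI := hi.1
  obtain ⟨Y, hY, -⟩ := (eq_bot_or_exists_atom_le (⊤ : Submodule R X)).resolve_left top_ne_bot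
  have hYs : IsSimpleModule R Y := isSimpleModule_iff_isAtom.2 hY
  have hm := IsSimpleModule.annihilator_isMaximal (R := R) (M := Y)
  set m := Module.annihilator R Y with hmdef
  obtain ⟨x₀, hx₀Y, hx₀⟩ := Submodule.exists_mem_ne_zero_of_ne_bot hY.1
  have hmx₀ : ∀ r ∈ m, r • x₀ = 0 := fun r hr =>
    congrArg Subtype.val (Module.mem_annihilator.1 hr ⟨x₀, hx₀Y⟩)
  have hgen : ∀ x : X, x ≠ 0 → ∀ z : X, ∃ a : Aᵐᵒᵖ, a • x = z := fun x hx z =>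
    Submodule.mem_span_singleton.1 (IsSimpleModule.span_singleton_eq_top Aᵐᵒᵖ hx ▸
      Submodule.mem_top)
  -- the ring `R` acts on `X` through the field `R ⧸ m`, because `X` is simple over `Aᵐᵒᵖ`
  have hmX : ∀ r ∈ m, ∀ x : X, r • x = 0 := fun r hr x => by
    obtain ⟨a, rfl⟩ := hgen x₀ hx₀ x
    rw [← smul_comm, hmx₀ r hr, smul_zero]
  obtain ⟨y, hy0, hmy, hy⟩ := hi.exists_generator m
  rw [isSimpleModule_iff_toSpanSingleton_surjective]
  constructor
  · -- a nonzero map `X → I`: extend the map `R x₀ → I` that carries `x₀` to `y`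
    have hann : LinearMap.ker (LinearMap.toSpanSingleton R X x₀) ≤
        LinearMap.ker (LinearMap.toSpanSingleton R I y) := fun r hr => by
      by_contra hr'
      have hrm : r ∉ m := fun h => hr' (hmy r h)
      obtain ⟨a, μ, hμ, h⟩ := hm.exists_inv hrm
      refine hx₀ ?_
      rw [← one_smul R x₀, ← h, add_smul, hmx₀ μ hμ, mul_smul,
        show r • x₀ = 0 from hr, smul_zero, add_zero]
    obtain ⟨φ, hφ⟩ := Module.Injective.extension_property R I _ _
      ((LinearMap.ker (LinearMap.toSpanSingleton R X x₀)).liftQ _ le_rfl)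
      (LinearMap.ker_eq_bot.1 (Submodule.ker_liftQ_eq_bot _ _ _ le_rfl))
      ((LinearMap.ker (LinearMap.toSpanSingleton R X x₀)).liftQ
        (LinearMap.toSpanSingleton R I y) hann)
    refine ⟨(show Dual R I X from φ), 0, fun h => hy0 ?_⟩
    have := LinearMap.congr_fun hφ (Submodule.Quotient.mk 1)
    simp only [LinearMap.comp_apply, Submodule.liftQ_apply, LinearMap.toSpanSingleton_apply,
      one_smul] at this
    rw [← this]
    exact LinearMap.congr_fun h x₀
  · intro φ hφ χ
    let φ' : X →ₗ[R] I := φ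
    let χ' : X →ₗ[R] I := χ
    -- finitely many translates of `φ` separate the points of `X`
    let act : A → X →ₗ[R] X := fun a => DistribSMul.toLinearMap R X (MulOpposite.op a)
    let K : Finset A → Submodule R X := fun F => F.inf fun a => LinearMap.ker (φ' ∘ₗ act a)
    obtain ⟨_, ⟨F, rfl⟩, hF⟩ := IsArtinian.set_has_minimal (Set.range K) (Set.range_nonempty K)
    have hF0 : K F = ⊥ := by
      classical
      refine (Submodule.eq_bot_iff _).2 fun x hx => ?_
      by_contra hx0
      refine hφ (LinearMap.ext fun z => ?_ : φ' = 0)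
      obtain ⟨a, rfl⟩ := hgen x hx0 z
      by_contra ha
      refine hF _ ⟨insert a.unop F, rfl⟩ (lt_of_le_of_ne ?_ fun h => ha ?_)
      · exact Finset.inf_mono (Finset.subset_insert _ _)
      · rw [← h] at hx
        exact (Submodule.mem_finsetInf.1 hx) a.unop (Finset.mem_insert_self _ _)
    let Φ : X →ₗ[R] (F → I) := LinearMap.pi fun a => φ' ∘ₗ act a
    have hΦ : Function.Injective Φ := (injective_iff_map_eq_zero Φ).2 fun x hx => by
      rw [← Submodule.mem_bot R, ← hF0]
      exact Submodule.mem_finsetInf.2 fun a ha => congrFun hx ⟨a, ha⟩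
    obtain ⟨ψ, hψ⟩ := Module.Injective.extension_property R I _ _ Φ hΦ χ'
    classical
    -- the elements of `I` killed by `m` are the multiples of `y`, so the components of `ψ` act on
    -- them as multiplications by elements of `R`
    have hscalar : ∀ a : F, ∃ r : R, ∀ x : X,
        ψ (Pi.single a (φ' (act a x))) = r • φ' (act a x) := fun a => by
      obtain ⟨r, hr⟩ := hy (ψ (Pi.single a y)) fun r hr => by
        rw [← map_smul, ← Pi.single_smul, hmy r hr, Pi.single_zero, map_zero]
      refine ⟨r, fun x => ?_⟩
      obtain ⟨s, hs⟩ := hy (φ' (act a x)) fun r hr => by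
        rw [← map_smul, hmX r hr, map_zero]
      rw [hs, Pi.single_smul, map_smul, hr, smul_comm]
    choose r hr using hscalar
    refine ⟨∑ a : F, r a • (a : A), LinearMap.ext (f := show X →ₗ[R] I from _) (g := χ') fun x => ?_⟩
    rw [LinearMap.toSpanSingleton_apply, Dual.smul_apply', ← hψ, LinearMap.comp_apply,
      ← Finset.univ_sum_single (Φ x), map_sum]
    have : ∀ a : F, ψ (Pi.single a (Φ x a)) = r a • φ' (act a x) := fun a => hr a x
    simp only [this, Finset.op_sum, MulOpposite.op_smul, Finset.sum_smul, smul_assoc]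
    exact (map_sum φ' _ _).trans (Finset.sum_congr rfl fun a _ => map_smul φ' _ _)

end DualSimple

/-! ### The Auslander-Reiten translate of a simple module -/

section TranslateSimple

variable {A : Type u} [Ring A]

/-- Every finitely generated module is the sum of the images of the indecomposable projectives. -/
theorem SimpleList.iSup_range_eq_top (L : SimpleList A) (X : Type u) [AddCommGroup X] [Module A X]
    [Module.Finite A X] :
    ⨆ τ : (Σ l : Fin L.n, L.P l →ₗ[A] X), LinearMap.range τ.2 = ⊤ := by
  by_contra hN
  set N := ⨆ τ : (Σ l : Fin L.n, L.P l →ₗ[A] X), LinearMap.range τ.2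
  have := Submodule.Quotient.nontrivial_iff.2 hN
  obtain ⟨l, f, hf⟩ := L.exists_top (X ⧸ N)
  obtain ⟨g, hg⟩ := L.cover l
  obtain ⟨k, hk⟩ := Module.projective_lifting_property (f ∘ₗ N.mkQ) g
    ((LinearMap.surjective_of_ne_zero hf).comp N.mkQ_surjective)
  refine hg (hk ▸ LinearMap.ext fun p => ?_)
  have : k p ∈ N := (le_iSup (fun τ : (Σ l : Fin L.n, L.P l →ₗ[A] X) => LinearMap.range τ.2)
    ⟨l, k⟩) ⟨p, rfl⟩
  rw [LinearMap.comp_apply, LinearMap.comp_apply, N.mkQ_apply,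
    (Submodule.Quotient.mk_eq_zero N).2 this, map_zero, LinearMap.zero_apply]

/-- A surjection between indecomposable projective modules is an isomorphism. -/
theorem injective_of_surjective_of_projective {P Q : Type u} [AddCommGroup P] [Module A P]
    [AddCommGroup Q] [Module A Q] [Module.Projective A Q] [Nontrivial Q] (hP : IsUniserial A P)
    {t : P →ₗ[A] Q} (ht : Function.Surjective t) : Function.Injective t := by
  obtain ⟨s, hs⟩ := Module.projective_lifting_property t LinearMap.id ht
  have hs' : ∀ q, t (s q) = q := LinearMap.congr_fun hs
  rw [← LinearMap.ker_eq_bot]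
  rcases hP (LinearMap.ker t) (LinearMap.range s) with h | h
  · refine (Submodule.eq_bot_iff _).2 fun p hp => ?_
    obtain ⟨q, rfl⟩ := h hp
    rw [LinearMap.mem_ker, hs'] at hp
    rw [hp, map_zero]
  · obtain ⟨q, hq⟩ := exists_ne (0 : Q)
    exact (hq (by rw [← hs' q]; exact h ⟨q, rfl⟩)).elim

/-- An indecomposable projective module is determined by its top. -/
theorem SimpleList.exists_linearEquiv (L : SimpleList A) {Q : Type u} [AddCommGroup Q]
    [Module A Q] [Module.Projective A Q] (hQ : IsUniserial A Q) {i : Fin L.n}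
    (hi : HasMap A Q (L.S i)) : Nonempty (L.P i ≃ₗ[A] Q) := by
  obtain ⟨f, hf⟩ := exists_surjective_of_top hQ hi
  have := hi.nontrivial_left
  exact ⟨LinearEquiv.ofBijective f
    ⟨injective_of_surjective_of_projective (L.uniserial i) hf, hf⟩⟩

/-- If `f : P j → P k` has image `rad (P k)`, then every map `h : P j → P l` that is not an
isomorphism factors through `f`. -/
theorem SimpleList.exists_factor_or_bijective (hA : IsLeftSerial Aᵐᵒᵖ) (L : SimpleList A)
    {j k l : Fin L.n} (hjk : L.Next k j) {f : L.P j →ₗ[A] L.P k}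
    (hf : LinearMap.range f = Module.jacobson A (L.P k)) (h : L.P j →ₗ[A] L.P l) :
    (∃ t, h = t ∘ₗ f) ∨ Function.Bijective h := by
  have hntl := (L.cover l).nontrivial_left
  have hntk := (L.cover k).nontrivial_left
  rcases exists_factorization hA (L.uniserial j) (L.uniserial l) (L.uniserial k) h f with
    ht | ⟨t, ht⟩
  · exact .inl ht
  by_cases hts : Function.Surjective t
  · left
    let e := LinearEquiv.ofBijective t
      ⟨injective_of_surjective_of_projective (L.uniserial l) hts, hts⟩
    refine ⟨e.symm.toLinearMap, LinearMap.ext fun p => ?_⟩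
    rw [ht]
    exact (e.symm_apply_apply (h p)).symm
  · right
    have hhs : Function.Surjective h := by
      by_contra hhs
      rw [← LinearMap.range_eq_top] at hts hhs
      have hr : ∀ x, t x ∈ Module.jacobson A (L.P k) := fun x =>
        (L.uniserial k).le_jacobson (L.cover k) hts ⟨x, rfl⟩
      let t' : L.P l →ₗ[A] Module.jacobson A (L.P k) := t.codRestrict _ hr
      obtain ⟨s, hs⟩ := hjk
      refine (hs (LinearMap.ext fun ⟨y, hy⟩ => ?_))
      have hy' := hy
      rw [← hf] at hy'
      obtain ⟨p, rfl⟩ := hy'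
      subst ht
      change (s ∘ₗ t') (h p) = 0
      by_cases h0 : s ∘ₗ t' = 0
      · rw [h0, LinearMap.zero_apply]
      · exact (L.uniserial l).le_ker h0 hhs ⟨p, rfl⟩
    exact ⟨injective_of_surjective_of_projective (L.uniserial j) hhs, hhs⟩

/-- The transpose of a nonprojective simple module is simple. -/
theorem SimpleList.isSimpleModule_transpose (hA : IsLeftSerial Aᵐᵒᵖ) (L : SimpleList A)
    {j k : Fin L.n} (hjk : L.Next k j) {f : L.P j →ₗ[A] L.P k}
    (hf : LinearMap.range f = Module.jacobson A (L.P k)) :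
    IsSimpleModule Aᵐᵒᵖ (Transpose f) := by
  obtain ⟨x, ψ, hx⟩ := (L.uniserial j).exists_dual
  have hntj := (L.cover j).nontrivial_left
  rw [isSimpleModule_iff_isCoatom]
  constructor
  · intro htop
    obtain ⟨ξ, hξ⟩ : ψ ∈ LinearMap.range (precomp f) := htop ▸ Submodule.mem_top
    have hinv : ∀ p, (LinearMap.toSpanSingleton A _ x ∘ₗ ξ) (f p) = p := fun p => by
      have : ξ (f p) = ψ p := LinearMap.congr_fun hξ p
      rw [LinearMap.comp_apply, LinearMap.toSpanSingleton_apply, this, hx]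
    have hinj := injective_of_surjective_of_projective (L.uniserial k)
      (t := LinearMap.toSpanSingleton A _ x ∘ₗ ξ) fun p => ⟨f p, hinv p⟩
    refine (L.uniserial k).jacobson_ne_top (L.cover k) (hf ▸ LinearMap.range_eq_top.2 fun q => ?_)
    exact ⟨_, hinj (hinv _)⟩
  · intro N hN
    obtain ⟨η, hηN, hη⟩ := SetLike.exists_of_lt hN
    -- write `1 ∈ A` as a sum of elements coming from the indecomposable projectives
    have h1 : (1 : A) ∈ ⨆ τ : (Σ l : Fin L.n, L.P l →ₗ[A] A), LinearMap.range τ.2 :=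
      L.iSup_range_eq_top A ▸ Submodule.mem_top
    obtain ⟨c, hc, hc1⟩ := (Submodule.mem_iSup_iff_exists_finsupp _ _).1 h1
    choose p hp using hc
    have hsum : η = ∑ τ ∈ c.support, (τ.2 ∘ₗ (LinearMap.toSpanSingleton A _ (p τ) ∘ₗ η)) := by
      ext q
      rw [LinearMap.sum_apply]
      simp only [LinearMap.comp_apply, LinearMap.toSpanSingleton_apply, map_smul, hp, smul_eq_mul]
      rw [← Finset.mul_sum]
      change _ = η q * c.sum fun _ x => x
      rw [hc1, mul_one]
    obtain ⟨τ, hτ, hτN⟩ : ∃ τ ∈ c.support,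
        τ.2 ∘ₗ (LinearMap.toSpanSingleton A _ (p τ) ∘ₗ η) ∉ LinearMap.range (precomp f) := by
      by_contra! hcon
      exact hη (hsum ▸ Submodule.sum_mem _ hcon)
    rcases L.exists_factor_or_bijective hA hjk hf (LinearMap.toSpanSingleton A _ (p τ) ∘ₗ η) with
      ⟨t, ht⟩ | hb
    · exact (hτN ⟨τ.2 ∘ₗ t, by rw [ht]; rfl⟩).elim
    · let e := LinearEquiv.ofBijective _ hb
      have hψN : ψ ∈ N := by
        have : ψ = MulOpposite.op (ψ (e.symm (p τ))) • η := by
          ext q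
          rw [LinearMap.smul_apply, MulOpposite.smul_eq_mul_unop, MulOpposite.unop_op,
            ← smul_eq_mul, ← map_smul, ← map_smul]
          congr 1
          exact (e.symm_apply_apply q).symm
        exact this ▸ N.smul_mem _ hηN
      exact eq_top_iff.2 fun ξ _ => op_smul_dual hx ξ ▸ N.smul_mem _ hψN

variable {R : Type u} [CommRing R] [Algebra R A]

/-- A minimal projective presentation `P₁ → P₀` determines a nonzero map from `P₁` to any simple
module isomorphic to `D Tr`. -/
theorem hasMap_of_dual_transpose {P₀ P₁ T I : Type u} [AddCommGroup P₀] [Module A P₀]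
    [AddCommGroup P₁] [Module A P₁] [AddCommGroup T] [Module A T] [AddCommGroup I] [Module R I]
    [Module.Finite A P₁] [Module.Projective A P₁] (h : IsUniserial A P₁) [Nontrivial T]
    {f : P₁ →ₗ[A] P₀} (e : T ≃ₗ[A] Dual R I (Transpose f)) : HasMap A P₁ T := by
  obtain ⟨x, ψ, hx⟩ := h.exists_dual
  rw [HasMap.congr_right e]
  have := e.symm.toEquiv.nontrivial
  obtain ⟨φ, hφ⟩ := exists_ne (0 : Dual R I (Transpose f))
  let φ' : Transpose f →ₗ[R] I := φ
  let q : (P₁ →ₗ[A] A) →ₗ[Aᵐᵒᵖ] Transpose f := (LinearMap.range (precomp f)).mkQ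
  obtain ⟨r, hr⟩ : ∃ r : A, φ' (q (MulOpposite.op r • ψ)) ≠ 0 := by
    by_contra! hcon
    refine hφ (LinearMap.ext fun z => ?_ : φ' = 0)
    obtain ⟨ξ, rfl⟩ := Submodule.mkQ_surjective _ z
    rw [← op_smul_dual hx ξ]
    exact hcon _
  let F : P₁ →ₗ[A] Dual R I (Transpose f) := LinearMap.toSpanSingleton A _ (r • φ) ∘ₗ ψ
  refine ⟨F, fun h0 => hr ?_⟩
  have h1 : φ' (MulOpposite.op r • MulOpposite.op (ψ x) • q ψ) = 0 :=
    LinearMap.congr_fun (show (show Transpose f →ₗ[R] I from F x) = 0 from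
      LinearMap.congr_fun h0 x) (q ψ)
  rwa [← map_smul q, op_smul_dual hx, ← map_smul q] at h1

/-- A projective cover of a nonzero finitely generated uniserial module is a projective cover of
its simple top. -/
theorem IsProjectiveCover.comp_top {P X : Type u} [AddCommGroup P] [Module A P] [AddCommGroup X]
    [Module A X] [Module.Finite A X] [Nontrivial X] (hX : IsUniserial A X) {π : P →ₗ[A] X}
    (h : IsProjectiveCover π) : IsProjectiveCover ((Module.jacobson A X).mkQ ∘ₗ π) := by
  have hs := hX.isSimpleModule_top
  have hsurj : Function.Surjective ((Module.jacobson A X).mkQ ∘ₗ π) :=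
    (Submodule.mkQ_surjective _).comp h.2.1
  refine ⟨h.1, hsurj, fun N hN => h.2.2 N ?_⟩
  have hmap : N.map π = ⊤ := by
    by_contra hne
    have hle : N.map π ≤ Module.jacobson A X := by
      refine hX.le_jacobson (S := X ⧸ Module.jacobson A X) (hasMap_mkQ fun ht => ?_) hne
      have := IsSimpleModule.nontrivial A (X ⧸ Module.jacobson A X)
      exact Submodule.Quotient.nontrivial_iff.1 this ht
    have hle' : N ≤ LinearMap.ker ((Module.jacobson A X).mkQ ∘ₗ π) := by
      rw [LinearMap.ker_comp, Submodule.ker_mkQ, ← Submodule.map_le_iff_le_comap]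
      exact hle
    rw [sup_eq_right.2 hle'] at hN
    exact (LinearMap.isCoatom_ker_of_surjective hsurj).1 hN
  rw [eq_top_iff]
  intro p _
  obtain ⟨n, hn, hnp⟩ : π p ∈ N.map π := hmap ▸ Submodule.mem_top
  rw [← add_sub_cancel n p]
  exact Submodule.add_mem_sup hn (by rw [LinearMap.mem_ker, map_sub, hnp, sub_self])

/-- The translate of a simple module, if it is simple, is the simple module that follows it: the
radical of its projective cover has the translate as its top. -/
theorem SimpleList.next_of_isTranslate [IsArtinianRing A] (hA : IsLeftSerial A)
    (L : SimpleList A) {U T : Type u} [AddCommGroup U] [Module A U] [AddCommGroup T] [Module A T]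
    [IsSimpleModule A U] [IsSimpleModule A T] {k j : Fin L.n} (hU : HasMap A U (L.S k))
    (hT : HasMap A T (L.S j)) (h : IsTranslate R A U T) : L.Next k j := by
  obtain ⟨P₀, P₁, π, f, I, _, _, i, hπ, hker, hf, -, ⟨e⟩⟩ := h
  have hP₀ := hπ.isUniserial hA
  have hP₀f := hπ.finite_of_simple
  have hntT := IsSimpleModule.nontrivial A T
  -- `P₁` is nonzero, since its transpose is
  have hntP₁ : Nontrivial P₁ := by
    by_contra hn
    rw [not_nontrivial_iff_subsingleton] at hn
    have h1 : Subsingleton (P₁ →ₗ[A] A) := inferInstance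
    have h2 : Subsingleton (Transpose f) :=
      (Submodule.mkQ_surjective (LinearMap.range (precomp f))).subsingleton
    have h3 : Subsingleton (Dual R I (Transpose f)) :=
      inferInstanceAs (Subsingleton (Transpose f →ₗ[R] I))
    exact not_subsingleton T e.injective.subsingleton
  have hnt : Nontrivial (LinearMap.range f) := by
    by_contra hn
    rw [not_nontrivial_iff_subsingleton] at hn
    refine bot_ne_top (α := Submodule A P₁) (hf.2.2 ⊥ ?_)
    rw [bot_sup_eq, LinearMap.ker_eq_top]
    exact LinearMap.ext fun _ => Subsingleton.elim _ _
  have hrange := hP₀.submodule (LinearMap.range f)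
  have hsimple := hrange.isSimpleModule_top
  have hcov := hf.comp_top hrange
  have hP₁ := hcov.isUniserial hA
  have := hcov.finite_of_simple
  have := hcov.1
  have hmap := hasMap_of_dual_transpose hP₁ e
  have hV : HasMap A (LinearMap.range f) (top A (LinearMap.range f)) := hasMap_mkQ fun ht =>
    Submodule.Quotient.nontrivial_iff.1 (IsSimpleModule.nontrivial A (top A (LinearMap.range f))) ht
  obtain ⟨e'⟩ := hP₁.top_unique (HasMap.comp_surjective f.surjective_rangeRestrict hV) hmap
  have hKj : HasMap A (LinearMap.ker π) (L.S j) :=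
    hker ▸ (HasMap.congr_right (e' ≪≫ₗ hT.linearEquiv.some)).1 hV
  have := IsSimpleModule.nontrivial A U
  refine SimpleList.next_of_quotient hP₀ hKj ((HasMap.congr_right
    (π.quotKerEquivOfSurjective hπ.2.1)).2 ?_)
  exact (HasMap.congr_left hU.linearEquiv.some).1 hasMap_self

variable [IsArtinianRing R] [Module.Finite R A]

/-- The translate of a nonprojective simple module `S k` is the simple module that follows it. -/
theorem SimpleList.isTranslate_of_next (hA : IsLeftSerial Aᵐᵒᵖ) (L : SimpleList A)
    {U T : Type u} [AddCommGroup U] [Module A U] [AddCommGroup T] [Module A T]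
    [IsSimpleModule A U] [IsSimpleModule A T]
    {j k : Fin L.n} (hU : HasMap A U (L.S k)) (hT : HasMap A T (L.S j)) (h : L.Next k j) :
    IsTranslate R A U T := by
  obtain ⟨g, hg⟩ := L.cover k
  obtain ⟨eU⟩ := hU.linearEquiv
  obtain ⟨eT⟩ := hT.linearEquiv
  obtain ⟨f₀, hf₀⟩ := SimpleList.exists_surjective_of_top ((L.uniserial k).submodule _) h
  let f : L.P j →ₗ[A] L.P k := Submodule.subtype _ ∘ₗ f₀
  have hf : LinearMap.range f = Module.jacobson A (L.P k) := by
    rw [LinearMap.range_comp, LinearMap.range_eq_top.2 hf₀, Submodule.map_top,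
      Submodule.range_subtype]
  have hsimple := L.isSimpleModule_transpose hA h hf
  obtain ⟨I, _, _, i, hi⟩ := exists_injectiveEnvelope R (R ⧸ Ring.jacobson R)
  obtain ⟨x, ψ, hx⟩ := (L.uniserial j).exists_dual
  have hfin : Module.Finite Aᵐᵒᵖ (L.P j →ₗ[A] A) :=
    .of_surjective (LinearMap.toSpanSingleton Aᵐᵒᵖ _ ψ) fun ξ =>
      ⟨MulOpposite.op (ξ x), op_smul_dual hx ξ⟩
  have hfinR : Module.Finite R (Transpose f) := Module.Finite.trans Aᵐᵒᵖ _
  have hD : IsSimpleModule A (Dual R I (Transpose f)) := Dual.isSimpleModule hi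
  have := IsSimpleModule.nontrivial A (Dual R I (Transpose f))
  have hmap := hasMap_of_dual_transpose (L.uniserial j)
    (LinearEquiv.refl A (Dual R I (Transpose f)))
  obtain ⟨e⟩ := (L.uniserial j).top_unique (L.cover j) hmap
  have hntU := IsSimpleModule.nontrivial A U
  have hntr : Nontrivial (LinearMap.range f) := by
    rw [hf]; exact h.nontrivial_left
  refine ⟨L.P k, L.P j, eU.symm.toLinearMap ∘ₗ g, f, I, _, _, i, ?_, ?_, ?_, hi, ⟨eT ≪≫ₗ e⟩⟩
  · exact (L.uniserial k).isProjectiveCover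
      (eU.symm.surjective.comp (LinearMap.surjective_of_ne_zero hg))
  · rw [hf, (L.uniserial k).jacobson_eq_ker hg, LinearMap.ker_comp_of_ker_eq_bot _
      (LinearMap.ker_eq_bot.2 eU.symm.injective)]
  · exact (L.uniserial j).isProjectiveCover f.surjective_rangeRestrict

end TranslateSimple

/-! ### The resolution quiver in terms of the list of simple modules -/

section Quiver

/-- An infinite walk along a functional relation on a finite set ends up on a cycle. -/
theorem exists_forall_ge_transGen {α : Type*} [Finite α] {r : α → α → Prop}
    (hr : ∀ {x y z}, r x y → r x z → y = z) (a : ℕ → α) (ha : ∀ n, r (a n) (a (n + 1))) :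
    ∃ N, ∀ k ≥ N, Relation.TransGen r (a k) (a k) := by
  have hgen : ∀ k m, Relation.TransGen r (a k) (a (k + (m + 1))) := fun k m => by
    induction m with
    | zero => exact .single (ha k)
    | succ m ih => exact ih.tail (ha _)
  obtain ⟨i, j, hij, h⟩ : ∃ i j, i < j ∧ a i = a j := by
    by_contra! hcon
    exact not_injective_infinite_finite a fun i j h => by
      rcases lt_trichotomy i j with hij | hij | hij
      · exact (hcon i j hij h).elim
      · exact hij
      · exact (hcon j i hij h.symm).elim
  obtain ⟨m, rfl⟩ := Nat.exists_eq_add_of_lt hij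
  have hper : ∀ k, a (i + k) = a (i + k + (m + 1)) := fun k => by
    induction k with
    | zero => exact h
    | succ k ih =>
      refine hr (ha (i + k)) ?_
      rw [ih]
      convert ha _ using 2
      omega
  refine ⟨i, fun k hk => ?_⟩
  obtain ⟨k, rfl⟩ := Nat.exists_eq_add_of_le hk
  have := hgen (i + k) m
  rwa [← hper k] at this

/-- In a functional relation, an element is the target of at most one arrow that starts on an
oriented cycle. -/
theorem eq_of_transGen_self {α : Type*} {r : α → α → Prop}
    (hr : ∀ {x y z}, r x y → r x z → y = z) {x y z : α} (hx : Relation.TransGen r x x)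
    (hy : Relation.TransGen r y y) (hxz : r x z) (hyz : r y z) : x = y := by
  classical
  let f : α → α := fun u => if h : ∃ v, r u v then h.choose else u
  have hf : ∀ {u v}, r u v → f u = v := fun {u v} h => by
    have hex : ∃ v, r u v := ⟨v, h⟩
    simp only [f, dif_pos hex]
    exact hr hex.choose_spec h
  have hper : ∀ {u v}, Relation.TransGen r u v → ∃ n, 0 < n ∧ f^[n] u = v := fun {u v} h => by
    induction h with
    | single h => exact ⟨1, one_pos, hf h⟩
    | tail _ h ih =>
      obtain ⟨n, -, rfl⟩ := ih
      exact ⟨n + 1, n.succ_pos, by rw [Function.iterate_succ_apply', hf h]⟩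
  obtain ⟨m, hm, hmx⟩ := hper hx
  obtain ⟨n, hn, hny⟩ := hper hy
  exact Function.IsPeriodicPt.eq_of_apply_eq hmx hny hm hn ((hf hxz).trans (hf hyz).symm)

variable {R : Type u} [CommRing R] {A : Type u} [Ring A] [Algebra R A]

theorem IsCyclicSimple.isSimpleModule {S : ModuleCat.{u} A} (h : IsCyclicSimple R A S) :
    IsSimpleModule A S := by
  obtain ⟨T, hT, -⟩ := Relation.TransGen.head'_iff.1 h
  exact hT.1

theorem SimpleList.Cyclic.arrow {L : SimpleList A} {i : Fin L.n} (h : L.Cyclic i) :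
    ∃ j, L.Arrow i j ∧ L.Cyclic j := by
  rcases Relation.TransGen.head'_iff.1 h with ⟨j, hij, hji⟩
  exact ⟨j, hij, Relation.TransGen.tail' hji hij⟩

theorem SimpleList.Cyclic.eq_of_arrow {L : SimpleList A} {i j k : Fin L.n} (hi : L.Cyclic i)
    (hj : L.Cyclic j) (hik : L.Arrow i k) (hjk : L.Arrow j k) : i = j :=
  eq_of_transGen_self SimpleList.Arrow.functional hi hj hik hjk

variable [IsArtinianRing R] [Module.Finite R A]

variable (R) in
/-- For a uniserial module, the condition on `τ soc X` in terms of the list of simple modules. -/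
theorem SimpleList.isTranslate_socle_iff (hA : IsNakayama A) (L : SimpleList A) {X T : Type u}
    [AddCommGroup X] [Module A X] [IsArtinian A X] [Nontrivial X] (hX : IsUniserial A X)
    [AddCommGroup T] [Module A T] [IsSimpleModule A T] {j : Fin L.n} (hT : HasMap A T (L.S j)) :
    IsTranslate R A (socle A X) T ↔ L.Ends X j := by
  have : IsArtinianRing A := isArtinian_of_tower R inferInstance
  have hs := hX.isSimpleModule_socle
  constructor
  · intro h
    obtain ⟨k, ⟨e⟩⟩ := L.complete (socle A X) hs
    have := IsSimpleModule.nontrivial A (socle A X)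
    exact ⟨k, HasMap.comp_injective (socle A X).injective_subtype ((HasMap.congr_left e).1 hasMap_self),
      L.next_of_isTranslate hA.1 e.hasMap hT h⟩
  · rintro ⟨k, ⟨f, hf⟩, hkj⟩
    refine L.isTranslate_of_next hA.2 (k := k) ?_ hT hkj
    rw [hX.socle_eq_range hf]
    exact (HasMap.congr_left (LinearEquiv.ofInjective f (LinearMap.injective_of_ne_zero hf))).1
      (have := (L.simple k).nontrivial; hasMap_self)

theorem SimpleList.resolutionArrow_iff (hA : IsNakayama A) (L : SimpleList A)
    {S T : ModuleCat.{u} A} [hS : IsSimpleModule A S] [hT : IsSimpleModule A T] {i j : Fin L.n}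
    (hi : HasMap A S (L.S i)) (hj : HasMap A T (L.S j)) :
    ResolutionArrow R A S T ↔ L.Arrow i j := by
  have : IsArtinianRing A := isArtinian_of_tower R inferInstance
  have hnt := IsSimpleModule.nontrivial A S
  constructor
  · rintro ⟨-, -, P, π, hπ, h⟩
    have hP := hπ.isUniserial hA.1
    have := hπ.finite_of_simple
    have := hπ.1
    have := hπ.2.1.nontrivial
    rw [L.isTranslate_socle_iff R hA hP hj] at h
    obtain ⟨e⟩ := L.exists_linearEquiv hP (HasMap.comp_surjective hπ.2.1 hi)
    exact (Ends.congr e).2 h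
  · intro h
    obtain ⟨g, hg⟩ := L.cover i
    obtain ⟨e⟩ := hi.linearEquiv
    have := (L.cover i).nontrivial_left
    exact ⟨hS, hT, L.P i, e.symm.toLinearMap ∘ₗ g, (L.uniserial i).isProjectiveCover
      (e.symm.surjective.comp (LinearMap.surjective_of_ne_zero hg)),
      (L.isTranslate_socle_iff R hA (L.uniserial i) hj).2 h⟩

theorem SimpleList.transGen_resolutionArrow_iff (hA : IsNakayama A) (L : SimpleList A)
    {S T : ModuleCat.{u} A} [hS : IsSimpleModule A S] [hT : IsSimpleModule A T] {i j : Fin L.n}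
    (hi : HasMap A S (L.S i)) (hj : HasMap A T (L.S j)) :
    Relation.TransGen (ResolutionArrow R A) S T ↔ Relation.TransGen L.Arrow i j := by
  constructor
  · intro h
    induction h using Relation.TransGen.head_induction_on generalizing i with
    | single h =>
      have := h.1
      exact .single ((L.resolutionArrow_iff hA hi hj).1 h)
    | @head a b h _ ih =>
      have := h.1
      have := h.2.1
      obtain ⟨k, ⟨e⟩⟩ := L.complete b this
      have := IsSimpleModule.nontrivial A b
      exact .head ((L.resolutionArrow_iff hA hi e.hasMap).1 h) (ih e.hasMap)
  · intro h
    induction h using Relation.TransGen.head_induction_on generalizing S with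
    | single h => exact .single ((L.resolutionArrow_iff hA hi hj).2 h)
    | @head a b h _ ih =>
      have := (L.simple b).nontrivial
      exact .head ((L.resolutionArrow_iff hA (T := L.S b) hi hasMap_self).2 h) (ih hasMap_self)

variable (R) in
theorem SimpleList.isCyclicSimple_iff (hA : IsNakayama A) (L : SimpleList A)
    {S : ModuleCat.{u} A} [IsSimpleModule A S] {i : Fin L.n} (hi : HasMap A S (L.S i)) :
    IsCyclicSimple R A S ↔ L.Cyclic i :=
  L.transGen_resolutionArrow_iff hA hi hi

end Quiver

/-! ### Projective dimension -/

section ProjectiveDimension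

variable {A : Type u} [Ring A]

theorem hasProjectiveDimensionLT_one (X : Type u) [AddCommGroup X] [Module A X]
    [h : Module.Projective A X] : HasProjectiveDimensionLT (ModuleCat.of A X) 1 :=
  projective_iff_hasProjectiveDimensionLT_one.1 ((IsProjective.iff_projective X).1 h)

theorem shortExact_dfinsupp {K : Type u} {X Y Z : K → Type u} [∀ k, AddCommGroup (X k)]
    [∀ k, Module A (X k)] [∀ k, AddCommGroup (Y k)] [∀ k, Module A (Y k)]
    [∀ k, AddCommGroup (Z k)] [∀ k, Module A (Z k)] (f : ∀ k, X k →ₗ[A] Y k)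
    (g : ∀ k, Y k →ₗ[A] Z k) (h : ∀ k, LinearMap.ker (g k) = LinearMap.range (f k))
    (hf : ∀ k, Function.Injective (f k)) (hg : ∀ k, Function.Surjective (g k)) :
    (ModuleCat.shortComplexOfCompEqZero (DFinsupp.mapRange.linearMap f)
      (DFinsupp.mapRange.linearMap g) (by
        rw [← LinearMap.range_le_ker_iff, DFinsupp.ker_mapRangeLinearMap,
          DFinsupp.range_mapRangeLinearMap]
        simp_rw [h]; rfl)).ShortExact := by
  refine ModuleCat.shortComplex_shortExact _ (LinearMap.exact_iff.2 ?_) ?_ ?_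
  · change LinearMap.ker (DFinsupp.mapRange.linearMap g) =
      LinearMap.range (DFinsupp.mapRange.linearMap f)
    rw [DFinsupp.ker_mapRangeLinearMap, DFinsupp.range_mapRangeLinearMap]
    simp_rw [h]
  · exact (DFinsupp.mapRange_injective _ fun _ => map_zero _).2 hf
  · exact (DFinsupp.mapRange_surjective _ fun _ => map_zero _).2 hg

/-- Projective dimension less than `n + 1` passes to arbitrary direct sums. -/
theorem hasProjectiveDimensionLT_dfinsupp {K : Type u} (X : K → Type u) [∀ k, AddCommGroup (X k)]
    [∀ k, Module A (X k)] (n : ℕ)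
    (h : ∀ k, HasProjectiveDimensionLT (ModuleCat.of A (X k)) (n + 1)) :
    HasProjectiveDimensionLT (ModuleCat.of A (Π₀ k, X k)) (n + 1) := by
  induction n generalizing X with
  | zero =>
    have : ∀ k, Module.Projective A (X k) := fun k =>
      (IsProjective.iff_projective (X k)).2 (projective_iff_hasProjectiveDimensionLT_one.2 (h k))
    exact hasProjectiveDimensionLT_one _
  | succ n ih =>
    let q : ∀ k, (X k →₀ A) →ₗ[A] X k := fun k => Finsupp.linearCombination A id
    have hq : ∀ k, Function.Surjective (q k) := fun k => Finsupp.linearCombination_id_surjective A _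
    have hker : ∀ k, HasProjectiveDimensionLT (ModuleCat.of A (LinearMap.ker (q k))) (n + 1) :=
      fun k => ((LinearMap.shortExact_shortComplexKer (hq k)).hasProjectiveDimensionLT_X₃_iff n
        ((IsProjective.iff_projective _).1 inferInstance)).1 (h k)
    exact ((shortExact_dfinsupp (fun k => (LinearMap.ker (q k)).subtype) q
      (fun k => (Submodule.range_subtype _).symm) (fun k => Subtype.val_injective)
      hq).hasProjectiveDimensionLT_X₃_iff n
        ((IsProjective.iff_projective (Π₀ k, (X k →₀ A))).1 inferInstance)).2 (ih _ hker)

/-- A bound for the projective dimensions of the simple modules is a bound for all modules. -/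
theorem hasProjectiveDimensionLT_of_simple [IsArtinianRing A] (n : ℕ)
    (h : ∀ (S : Type u) [AddCommGroup S] [Module A S], IsSimpleModule A S →
      HasProjectiveDimensionLT (ModuleCat.of A S) (n + 1))
    (X : Type u) [AddCommGroup X] [Module A X] :
    HasProjectiveDimensionLT (ModuleCat.of A X) (n + 1) := by
  refine IsSemiprimaryRing.induction A A X
    (P := fun M _ _ hM => @HasProjectiveDimensionLT _ _ _ (@ModuleCat.of A _ M _ hM) (n + 1))
    (fun M _ _ hM _ hs _ => ?_) (fun M _ _ hM _ h₁ h₂ => ?_)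
  · obtain ⟨s, e, -, hs⟩ := IsSemisimpleModule.exists_linearEquiv_dfinsupp A M
    have := hasProjectiveDimensionLT_dfinsupp (fun m : s => m.1) n fun m => h _ (hs m)
    exact hasProjectiveDimensionLT_of_iso e.toModuleIso.symm _
  · let N : Submodule A M := Ring.jacobson A • ⊤
    exact (ModuleCat.shortComplex_shortExact
      (ModuleCat.shortComplexOfCompEqZero N.subtype N.mkQ (by ext; simp))
      (LinearMap.exact_subtype_mkQ N) N.injective_subtype
        N.mkQ_surjective).hasProjectiveDimensionLT_X₂ _ h₁ h₂

/-- An endless projective resolution of a uniserial module: the syzygy of a module without finite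
projective dimension has none either, and taking the second syzygy moves both the top and the `τ` of
the socle along the arrows of the resolution quiver. So some syzygy has both of them cyclic. -/
theorem SimpleList.exists_submodule_of_not_hasProjectiveDimensionLT [IsArtinianRing A]
    (L : SimpleList A) {X : Type u} [AddCommGroup X] [Module A X] [Module.Finite A X]
    (hX : IsUniserial A X) (h : ∀ n, ¬ HasProjectiveDimensionLT (ModuleCat.of A X) n) :
    ∃ i, L.Cyclic i ∧ ∃ K : Submodule A (L.P i), K ≠ ⊥ ∧ K ≠ ⊤ ∧
      ∃ j, L.Cyclic j ∧ HasMap A K (L.S j) := by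
  -- the first syzygy of a uniserial module with top `a`
  have syzygy : ∀ (X : Type u) [AddCommGroup X] [Module A X] (a : Fin L.n), Module.Finite A X →
      IsUniserial A X → (∀ n, ¬ HasProjectiveDimensionLT (ModuleCat.of A X) n) →
      HasMap A X (L.S a) → ∃ K : Submodule A (L.P a), K ≠ ⊥ ∧ K ≠ ⊤ ∧
        (∀ n, ¬ HasProjectiveDimensionLT (ModuleCat.of A K) n) ∧
        ∀ j, L.Ends X j ↔ HasMap A K (L.S j) := by
    intro X _ _ a _ hX h ha
    obtain ⟨f, hf⟩ := SimpleList.exists_surjective_of_top hX ha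
    have hnt := ha.nontrivial_left
    have hK : ∀ n, ¬ HasProjectiveDimensionLT (ModuleCat.of A (LinearMap.ker f)) n := fun n hn =>
      h (n + 2) (((LinearMap.shortExact_shortComplexKer hf).hasProjectiveDimensionLT_X₃_iff n
        ((IsProjective.iff_projective _).1 (L.projective a))).2
          (@hasProjectiveDimensionLT_of_ge _ _ _ _ n (n + 1) n.le_succ hn))
    have hbot : LinearMap.ker f ≠ ⊥ := fun h0 => hK 1 (by
      have : Subsingleton (LinearMap.ker f) := by rw [h0]; infer_instance
      exact hasProjectiveDimensionLT_one _)
    have htop : LinearMap.ker f ≠ ⊤ := fun h0 => by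
      obtain ⟨x, hx⟩ := exists_ne (0 : X)
      obtain ⟨y, rfl⟩ := hf x
      exact hx (LinearMap.mem_ker.1 (h0 ▸ Submodule.mem_top))
    exact ⟨LinearMap.ker f, hbot, htop, hK, fun j =>
      (SimpleList.Ends.congr (f.quotKerEquivOfSurjective hf)).symm.trans
        (SimpleList.ends_quotient_iff (L.uniserial a) hbot htop)⟩
  let B : Fin L.n × Fin L.n → Prop := fun p => ∃ K : Submodule A (L.P p.1), K ≠ ⊥ ∧ K ≠ ⊤ ∧
    (∀ n, ¬ HasProjectiveDimensionLT (ModuleCat.of A K) n) ∧ HasMap A K (L.S p.2)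
  have hfin : ∀ {i} (K : Submodule A (L.P i)), Module.Finite A K := fun K => inferInstance
  have step : ∀ p, B p → ∃ q, B q ∧ L.Arrow p.1 q.1 ∧ L.Arrow p.2 q.2 := by
    rintro ⟨a, b⟩ ⟨K, hK0, hK1, hK, hb⟩
    obtain ⟨K₂, hK₂0, hK₂1, hK₂, hKK₂⟩ :=
      syzygy K b (hfin K) ((L.uniserial a).submodule K) hK hb
    have := Submodule.nontrivial_iff_ne_bot.2 hK₂0
    obtain ⟨c, hc⟩ := L.exists_top K₂
    obtain ⟨K₃, hK₃0, hK₃1, hK₃, hKK₃⟩ :=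
      syzygy K₂ c (hfin K₂) ((L.uniserial b).submodule K₂) hK₂ hc
    have := Submodule.nontrivial_iff_ne_bot.2 hK₃0
    obtain ⟨d, hd⟩ := L.exists_top K₃
    exact ⟨(c, d), ⟨K₃, hK₃0, hK₃1, hK₃, hd⟩,
      (SimpleList.ends_submodule_iff (L.uniserial a) hK0).1 ((hKK₂ c).2 hc),
      (SimpleList.ends_submodule_iff (L.uniserial b) hK₂0).1 ((hKK₃ d).2 hd)⟩
  have hnt : Nontrivial X := by
    by_contra hX0
    rw [not_nontrivial_iff_subsingleton] at hX0
    exact h 1 (hasProjectiveDimensionLT_one X)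
  obtain ⟨a, ha⟩ := L.exists_top X
  obtain ⟨K, hK0, hK1, hK, -⟩ := syzygy X a ‹_› hX h ha
  have := Submodule.nontrivial_iff_ne_bot.2 hK0
  obtain ⟨b, hb⟩ := L.exists_top K
  choose s hs using fun p : Subtype B => step p.1 p.2
  let c : ℕ → Subtype B := fun n =>
    (fun p => ⟨s p, (hs p).1⟩)^[n] ⟨(a, b), K, hK0, hK1, hK, hb⟩
  have hc : ∀ n, c (n + 1) = ⟨s (c n), (hs (c n)).1⟩ := fun n =>
    Function.iterate_succ_apply' _ _ _
  obtain ⟨N₁, h₁⟩ := exists_forall_ge_transGen (r := L.Arrow) SimpleList.Arrow.functional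
    (fun n => (c n).1.1) fun n => by rw [hc]; exact (hs (c n)).2.1
  obtain ⟨N₂, h₂⟩ := exists_forall_ge_transGen (r := L.Arrow) SimpleList.Arrow.functional
    (fun n => (c n).1.2) fun n => by rw [hc]; exact (hs (c n)).2.2
  obtain ⟨K, hK0, hK1, -, hK⟩ := (c (max N₁ N₂)).2
  exact ⟨_, h₁ _ (le_max_left _ _), K, hK0, hK1, _, h₂ _ (le_max_right _ _), hK⟩

/-- If the global dimension is infinite, the projective cover of some cyclic simple module has a
proper nonzero submodule whose top is cyclic. -/
theorem SimpleList.exists_submodule_of_globalDimension_eq_top [IsArtinianRing A]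
    (L : SimpleList A) (hA : globalDimension A = ⊤) :
    ∃ i, L.Cyclic i ∧ ∃ K : Submodule A (L.P i), K ≠ ⊥ ∧ K ≠ ⊤ ∧
      ∃ j, L.Cyclic j ∧ HasMap A K (L.S j) := by
  by_cases h : ∀ i, ∃ n, HasProjectiveDimensionLT (ModuleCat.of A (L.S i)) n
  · choose d hd using h
    let n := Finset.univ.sup d
    have hle : globalDimension A ≤ (n : ℕ) := iSup_le fun M => by
      refine (projectiveDimension_le_iff M n).2 ?_
      refine hasProjectiveDimensionLT_of_simple n (fun S _ _ hS => ?_) M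
      obtain ⟨i, ⟨e⟩⟩ := L.complete S hS
      have := hd i
      have : HasProjectiveDimensionLT (ModuleCat.of A (L.S i)) (n + 1) :=
        hasProjectiveDimensionLT_of_ge _ (d i) _ ((Finset.le_sup (Finset.mem_univ i)).trans n.le_succ)
      exact hasProjectiveDimensionLT_of_iso e.symm.toModuleIso _
    rw [hA, top_le_iff] at hle
    exact absurd hle (WithBot.coe_injective.ne (ENat.natCast_ne_top n))
  · push Not at h
    obtain ⟨i, hi⟩ := h
    exact L.exists_submodule_of_not_hasProjectiveDimensionLT (fun N₁ N₂ => by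
      rcases eq_bot_or_eq_top N₁ with h | h <;> simp [h]) hi

end ProjectiveDimension

/-! ### Rings with a decomposition of the unit into idempotents -/

section Idempotents

variable {B : Type u} [Ring B] {ι : Type*} [Fintype ι] {e : ι → B}

/-- If the left ideals `B e i`, where `∑ e i = 1`, are uniserial, then they are the only
indecomposable projectives. -/
theorem isLeftSerial_of_idempotents (hsum : ∑ i, e i = 1) (hid : ∀ i, e i * e i = e i)
    (h : ∀ i x y, (∃ b, x * e i = b * (y * e i)) ∨ ∃ b, y * e i = b * (x * e i)) :
    IsLeftSerial B := by
  intro M _ _ _ hproj hM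
  have := hM.1
  obtain ⟨N, hN⟩ := exists_simple_quotient B M
  obtain ⟨s, hs⟩ := @exists_ne _ (IsSimpleModule.nontrivial B (M ⧸ N)) (0 : M ⧸ N)
  obtain ⟨i, hi⟩ : ∃ i, e i • s ≠ 0 := by
    by_contra! hcon
    exact hs (by rw [← one_smul B s, ← hsum, Finset.sum_smul, Finset.sum_eq_zero fun i _ => hcon i])
  let J : Submodule B B := Submodule.span B {e i}
  have hJ : ∀ x ∈ J, x * e i = x := fun x hx => by
    obtain ⟨b, rfl⟩ := Submodule.mem_span_singleton.1 hx
    rw [smul_eq_mul, mul_assoc, hid]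
  have hmem : e i ∈ J := Submodule.mem_span_singleton_self _
  let r : B →ₗ[B] J := LinearMap.toSpanSingleton B J ⟨e i, hmem⟩
  have : Module.Projective B J := Module.Projective.of_split J.subtype r
    (LinearMap.ext fun x => Subtype.ext (by simpa [r] using hJ x x.2))
  have hJu : IsUniserial B J := fun N₁ N₂ => by
    refine or_iff_not_imp_left.2 fun hN => fun y hy => ?_
    obtain ⟨x, hx, hx'⟩ := SetLike.not_le_iff_exists.1 hN
    rcases h i x y with ⟨b, hb⟩ | ⟨b, hb⟩ <;> rw [hJ x x.2, hJ y y.2] at hb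
    · exact (hx' ((Subtype.ext hb : x = b • y) ▸ N₂.smul_mem b hy)).elim
    · exact (Subtype.ext hb : y = b • x) ▸ N₁.smul_mem b hx
  have hJs : HasMap B J (M ⧸ N) := by
    refine ⟨LinearMap.toSpanSingleton B (M ⧸ N) s ∘ₗ J.subtype, fun h0 => hi ?_⟩
    simpa using LinearMap.congr_fun h0 ⟨e i, hmem⟩
  obtain ⟨f, k, -, -, hk⟩ := hJu.exists_surjective hJs (P := M) (g := N.mkQ)
    (fun h0 => hs (by obtain ⟨m, rfl⟩ := N.mkQ_surjective s; rw [h0]; rfl))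
  obtain ⟨l, hl⟩ := Module.projective_lifting_property k LinearMap.id hk
  have hl' : ∀ x, k (l x) = x := LinearMap.congr_fun hl
  have hlinj : Function.Injective l := Function.LeftInverse.injective hl'
  have hc : IsCompl (LinearMap.range l) (LinearMap.ker k) := by
    rw [← LinearMap.ker_comp_of_ker_eq_bot k (g := l.rangeRestrict)
      (LinearMap.ker_eq_bot.2 ((Set.rangeFactorization_injective).2 hlinj))]
    exact LinearMap.isCompl_of_proj (by rintro ⟨_, x, rfl⟩; exact Subtype.ext (congrArg l (hl' x)))
  rcases hM.2 _ _ hc with h0 | h0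
  · have := hJs.nontrivial_left
    obtain ⟨x, hx⟩ := exists_ne (0 : J)
    exact (hx (by rw [← hl' x, LinearMap.range_eq_bot.1 h0, LinearMap.zero_apply, map_zero])).elim
  · exact hJu.of_injective (LinearMap.ker_eq_bot.1 h0)

/-- A version of Baer's criterion. Extending a map from a left ideal `I` to `I + B e i` for one `i`
after the other, one is reduced to principal left ideals inside the `B e i`. -/
theorem isSelfinjective_of_idempotents [IsNoetherianRing B] (hsum : ∑ i, e i = 1)
    (hid : ∀ i, e i * e i = e i)
    (h : ∀ i x y, (∃ b, x * e i = b * (y * e i)) ∨ ∃ b, y * e i = b * (x * e i))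
    (hext : ∀ i j m y w, e m * y * e i = y → e m * w * e j = w → (∀ b, b * y = 0 → b * w = 0) →
      ∃ c, w = y * c) :
    IsSelfinjective B := by
  have step : ∀ (f : B →ₗ.[B] B) (i : ι), ∃ f', f ≤ f' ∧ e i ∈ f'.domain := by
    intro f i
    let T : Set (Submodule B B) :=
      {J | ∃ (m : ι) (y : B), y ∈ f.domain ∧ e m * y * e i = y ∧ J = Submodule.span B {y}}
    obtain ⟨J, ⟨m, y, hyf, hy, rfl⟩, hmax⟩ := WellFounded.has_min
      (wellFounded_gt (α := Submodule B B)) T ⟨_, i, 0, f.domain.zero_mem, by simp, rfl⟩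
    have hyi : y * e i = y := by rw [← hy, mul_assoc, hid]
    have hym : e m * y = y := by rw [← hy, ← mul_assoc, ← mul_assoc, hid]
    have hspan : ∀ z ∈ f.domain, z * e i = z → ∃ b, z = b * y := by
      intro z hz hzi
      have : ∀ l, e l * z ∈ Submodule.span B {y} := fun l => by
        have hl : e l * z * e i = e l * z := by rw [mul_assoc, hzi]
        rcases h i (e l * z) y with ⟨b, hb⟩ | ⟨b, hb⟩ <;> rw [hl, hyi] at hb
        · exact Submodule.mem_span_singleton.2 ⟨b, hb.symm⟩
        · have hle : Submodule.span B {y} ≤ Submodule.span B {e l * z} :=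
            (Submodule.span_singleton_le_iff_mem _ _).2
              (Submodule.mem_span_singleton.2 ⟨b, hb.symm⟩)
          have := hmax (Submodule.span B {e l * z}) ⟨l, e l * z, f.domain.smul_mem _ hz, by
            rw [← mul_assoc, hid, hl], rfl⟩
          rw [lt_iff_le_not_ge, not_and_not_right] at this
          exact this hle (Submodule.mem_span_singleton_self _)
      have hz' : z = ∑ l, e l * z := by rw [← Finset.sum_mul, hsum, one_mul]
      obtain ⟨b, hb⟩ := Submodule.mem_span_singleton.1
        (hz' ▸ Submodule.sum_mem _ fun l _ => this l : z ∈ Submodule.span B {y})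
      exact ⟨b, hb.symm⟩
    let w := f ⟨y, hyf⟩
    have hsmul : ∀ b, f ⟨b * y, f.domain.smul_mem b hyf⟩ = b * w := fun b =>
      f.map_smul b ⟨y, hyf⟩
    have hwm : e m * w = w := by
      rw [← hsmul]
      simp only [hym, w]
    have hw : ∀ j, ∃ c, w * e j = y * c := fun j => by
      refine hext i j m y (w * e j) hy (by rw [← mul_assoc, hwm, mul_assoc, hid]) fun b hb => ?_
      have : b * w = 0 := by
        rw [← hsmul]
        simp only [hb]
        exact f.map_zero
      rw [← mul_assoc, this, zero_mul]
    choose c hc using hw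
    have hwc : w = y * ∑ j, c j := by
      rw [Finset.mul_sum, ← Finset.sum_congr rfl fun j _ => hc j, ← Finset.mul_sum, hsum, mul_one]
    let g : B →ₗ.[B] B := ⟨Submodule.span B {e i},
      LinearMap.toSpanSingleton B B (∑ j, c j) ∘ₗ (Submodule.span B {e i}).subtype⟩
    refine ⟨f.sup g fun ⟨x, hx⟩ ⟨x', hx'⟩ hxx => ?_, f.left_le_sup g _,
      (f.right_le_sup g _).1 (Submodule.mem_span_singleton_self _)⟩
    obtain rfl : x = x' := hxx
    obtain ⟨b, rfl⟩ : ∃ b, x = b * y := by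
      refine hspan x hx ?_
      obtain ⟨b, rfl⟩ := Submodule.mem_span_singleton.1 hx'
      rw [smul_eq_mul, mul_assoc, hid]
    rw [hsmul, hwc, ← mul_assoc]
    rfl
  have steps : ∀ (f : B →ₗ.[B] B) (s : Finset ι), ∃ f', f ≤ f' ∧ ∀ i ∈ s, e i ∈ f'.domain := by
    classical
    intro f s
    induction s using Finset.induction_on with
    | empty => exact ⟨f, le_rfl, by simp⟩
    | insert i s _ ih =>
      obtain ⟨f₁, h₁, h₁'⟩ := ih
      obtain ⟨f₂, h₂, h₂'⟩ := step f₁ i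
      refine ⟨f₂, h₁.trans h₂, fun j hj => ?_⟩
      rcases Finset.mem_insert.1 hj with rfl | hj
      · exact h₂'
      · exact h₂.1 (h₁' j hj)
  refine Module.Baer.injective fun I f => ?_
  obtain ⟨f', hle, hf'⟩ := steps ⟨I, f⟩ Finset.univ
  have htop : f'.domain = ⊤ := (Ideal.eq_top_iff_one _).2
    (hsum ▸ Submodule.sum_mem _ fun i hi => hf' i hi)
  refine ⟨f'.toFun ∘ₗ LinearMap.id.codRestrict f'.domain (fun x => htop ▸ Submodule.mem_top),
    fun x hx => (hle.2 (x := ⟨x, hx⟩) rfl).symm⟩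

end Idempotents

/-! ### The endomorphism ring of a direct sum of indecomposable projectives -/

section EndomorphismRing

theorem exists_comp_eq_of_range_le {A : Type u} [Ring A] {P X Y : Type u} [AddCommGroup P]
    [Module A P] [AddCommGroup X] [Module A X] [AddCommGroup Y] [Module A Y]
    [Module.Projective A P] {f : P →ₗ[A] Y} {g : X →ₗ[A] Y}
    (h : LinearMap.range f ≤ LinearMap.range g) : ∃ k : P →ₗ[A] X, f = g ∘ₗ k := by
  obtain ⟨k, hk⟩ := Module.projective_lifting_property g.rangeRestrict
    (f.codRestrict (LinearMap.range g) fun x => h ⟨x, rfl⟩) g.surjective_rangeRestrict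
  exact ⟨k, LinearMap.ext fun x => (congrArg Subtype.val (LinearMap.congr_fun hk x)).symm⟩

variable {A : Type u} [Ring A] {m : ℕ} (Q : Fin m → ModuleCat.{u} A)

/-- The projection onto the `i`-th summand, as an endomorphism of the direct sum. -/
def summandIdempotent (i : Fin m) : Module.End A (∀ i, Q i) :=
  LinearMap.single A (fun i => Q i) i ∘ₗ LinearMap.proj i

theorem sum_summandIdempotent : ∑ i, summandIdempotent Q i = 1 := by
  ext i x j
  simp [summandIdempotent, Finset.sum_apply]

theorem summandIdempotent_mul_self (i : Fin m) :
    summandIdempotent Q i * summandIdempotent Q i = summandIdempotent Q i :=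
  LinearMap.ext fun x => by simp [summandIdempotent, Module.End.mul_apply]

variable {Q}

theorem op_sum_summandIdempotent : ∑ i, MulOpposite.op (summandIdempotent Q i) = 1 := by
  rw [← Finset.op_sum, sum_summandIdempotent, MulOpposite.op_one]

theorem op_summandIdempotent_mul_self (i : Fin m) :
    MulOpposite.op (summandIdempotent Q i) * MulOpposite.op (summandIdempotent Q i) =
      MulOpposite.op (summandIdempotent Q i) := by
  rw [← MulOpposite.op_mul, summandIdempotent_mul_self]

theorem projective_pi [∀ i, Module.Projective A (Q i)] : Module.Projective A (∀ i, Q i) :=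
  Module.Projective.of_equiv (DFinsupp.linearEquivFunOnFintype (R := A) (M := fun i => Q i))

/-- Two elements of the left ideal that belongs to `Q i` are comparable under divisibility, because
their ranges are comparable submodules of `Q i` and the sum of the `Q j` is projective. -/
theorem mul_summandIdempotent_factor [∀ i, Module.Projective A (Q i)] (hQ : ∀ i, IsUniserial A (Q i)) :
    ∀ i (x y : (Module.End A (∀ i, Q i))ᵐᵒᵖ),
      (∃ b, x * MulOpposite.op (summandIdempotent Q i) =
        b * (y * MulOpposite.op (summandIdempotent Q i))) ∨
      ∃ b, y * MulOpposite.op (summandIdempotent Q i) =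
        b * (x * MulOpposite.op (summandIdempotent Q i)) := by
  intro i x y
  have := projective_pi (Q := Q)
  rcases hQ i (LinearMap.range (LinearMap.proj i ∘ₗ x.unop))
    (LinearMap.range (LinearMap.proj i ∘ₗ y.unop)) with h | h <;>
  obtain ⟨k, hk⟩ := exists_comp_eq_of_range_le h
  · refine .inl ⟨.op k, MulOpposite.unop_injective ?_⟩
    exact congrArg (fun f => LinearMap.single A (fun i => Q i) i ∘ₗ f) hk
  · refine .inr ⟨.op k, MulOpposite.unop_injective ?_⟩
    exact congrArg (fun f => LinearMap.single A (fun i => Q i) i ∘ₗ f) hk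

/-- A finite nonempty family of maps out of `P`, any two of which are comparable for divisibility,
has a member through which all of them factor. -/
theorem exists_forall_factor {P : Type u} [AddCommGroup P] [Module A P] [Nonempty (Fin m)]
    (hP : ∀ {j k} (g : P →ₗ[A] Q j) (g' : P →ₗ[A] Q k),
      (∃ t : Q k →ₗ[A] Q j, g = t ∘ₗ g') ∨ ∃ t : Q j →ₗ[A] Q k, g' = t ∘ₗ g)
    (g : ∀ j, P →ₗ[A] Q j) : ∃ k, ∀ j, ∃ t : Q k →ₗ[A] Q j, g j = t ∘ₗ g k := by
  let r : Fin m → Fin m → Prop := fun j k => ∃ t : Q k →ₗ[A] Q j, g j = t ∘ₗ g k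
  have : IsTrans (Fin m) r := ⟨fun a b c ⟨t, ht⟩ ⟨t', ht'⟩ => ⟨t ∘ₗ t', by
    rw [ht, ht', LinearMap.comp_assoc]⟩⟩
  have hrefl : ∀ j, r j j := fun j => ⟨LinearMap.id, rfl⟩
  have hD : Directed r id := fun j k => (hP (g j) (g k)).elim
    (fun h => ⟨k, h, hrefl k⟩) (fun h => ⟨j, hrefl j, h⟩)
  obtain ⟨k, hk⟩ := hD.finset_le Finset.univ
  exact ⟨k, fun j => hk j (Finset.mem_univ j)⟩

/-- The maps out of `P` into the direct sum are linearly ordered by divisibility if the maps into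
the summands are. -/
theorem factor_pi {P : Type u} [AddCommGroup P] [Module A P] [Nonempty (Fin m)]
    (hP : ∀ {j k} (g : P →ₗ[A] Q j) (g' : P →ₗ[A] Q k),
      (∃ t : Q k →ₗ[A] Q j, g = t ∘ₗ g') ∨ ∃ t : Q j →ₗ[A] Q k, g' = t ∘ₗ g)
    (x y : P →ₗ[A] ∀ j, Q j) :
    (∃ t : Module.End A (∀ j, Q j), x = t ∘ₗ y) ∨ ∃ t : Module.End A (∀ j, Q j), y = t ∘ₗ x := by
  have key : ∀ (x y : P →ₗ[A] ∀ j, Q j) (k l : Fin m),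
      (∀ j, ∃ t : Q k →ₗ[A] Q j, LinearMap.proj j ∘ₗ x = t ∘ₗ LinearMap.proj k ∘ₗ x) →
      (∃ t : Q l →ₗ[A] Q k, LinearMap.proj k ∘ₗ x = t ∘ₗ LinearMap.proj l ∘ₗ y) →
      ∃ t : Module.End A (∀ j, Q j), x = t ∘ₗ y := by
    rintro x y k l hx ⟨s, hs⟩
    choose t ht using hx
    refine ⟨LinearMap.pi t ∘ₗ s ∘ₗ LinearMap.proj l, LinearMap.ext fun p => funext fun j => ?_⟩
    have h₁ := LinearMap.congr_fun (ht j) p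
    have h₂ := LinearMap.congr_fun hs p
    simp only [LinearMap.comp_apply, LinearMap.proj_apply] at h₁ h₂
    simp [h₁, h₂]
  obtain ⟨k, hk⟩ := exists_forall_factor hP fun j => LinearMap.proj j ∘ₗ x
  obtain ⟨l, hl⟩ := exists_forall_factor hP fun j => LinearMap.proj j ∘ₗ y
  exact (hP (LinearMap.proj k ∘ₗ x) (LinearMap.proj l ∘ₗ y)).imp (key x y k l hk) (key y x l k hl)

theorem isNakayama_endOp [∀ i, Module.Projective A (Q i)] [∀ i, Module.Finite A (Q i)]
    (hA : IsLeftSerial Aᵐᵒᵖ) (hQ : ∀ i, IsUniserial A (Q i)) :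
    IsNakayama (Module.End A (∀ i, Q i))ᵐᵒᵖ := by
  refine ⟨isLeftSerial_of_idempotents op_sum_summandIdempotent op_summandIdempotent_mul_self
    (mul_summandIdempotent_factor hQ), isLeftSerial_of_idempotents
    (e := fun i => .op (.op (summandIdempotent Q i))) ?_ (fun i => ?_) fun i x y => ?_⟩
  · rw [← Finset.op_sum, op_sum_summandIdempotent, MulOpposite.op_one]
  · rw [← MulOpposite.op_mul, op_summandIdempotent_mul_self]
  · have : Nonempty (Fin m) := ⟨i⟩
    refine (factor_pi (P := Q i) (fun g g' => exists_factorization hA (hQ i) (hQ _) (hQ _) g g')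
      (x.unop.unop ∘ₗ LinearMap.single A (fun i => Q i) i)
      (y.unop.unop ∘ₗ LinearMap.single A (fun i => Q i) i)).imp ?_ ?_ <;>
    rintro ⟨t, ht⟩ <;>
    exact ⟨.op (.op t), MulOpposite.unop_injective (MulOpposite.unop_injective
      (LinearMap.ext fun z => LinearMap.congr_fun ht (z i)))⟩

/-- The endomorphisms of a finitely generated module over a module-finite algebra form a finitely
generated module. -/
theorem finite_endOp {R : Type u} [CommRing R] [IsNoetherianRing R] [Algebra R A]
    [Module.Finite R A] [∀ i, Module.Finite A (Q i)] :
    Module.Finite R (Module.End A (∀ i, Q i))ᵐᵒᵖ := by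
  have : ∀ i, Module.Finite R (Q i) := fun i => Module.Finite.trans A (Q i)
  obtain ⟨n, s, hs⟩ := Module.Finite.exists_fin (R := A) (M := ∀ i, Q i)
  let φ : Module.End A (∀ i, Q i) →ₗ[R] (Fin n → ∀ i, Q i) :=
    { toFun := fun f k => f (s k), map_add' := fun _ _ => rfl, map_smul' := fun _ _ => rfl }
  have : Module.Finite R (Module.End A (∀ i, Q i)) := Module.Finite.of_injective φ fun f g h =>
    LinearMap.ext_on_range hs fun k => congrFun h k
  exact Module.Finite.equiv (MulOpposite.opLinearEquiv R)

end EndomorphismRing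

/-! ### The projective covers of the cyclic simple modules -/

section CyclicFamily

variable {A : Type u} [Ring A]

/-- A list `Q 0, …, Q (m - 1)` of the indecomposable projective modules with cyclic top; the top of
`Q j` is the simple module with number `index j` of the list `L`. -/
structure CyclicFamily (L : SimpleList A) where
  m : ℕ
  Q : Fin m → ModuleCat.{u} A
  index : Fin m → Fin L.n
  finite : ∀ j, Module.Finite A (Q j)
  projective : ∀ j, Module.Projective A (Q j)
  uniserial : ∀ j, IsUniserial A (Q j)
  top : ∀ j, HasMap A (Q j) (L.S (index j))
  index_injective : Function.Injective index
  cyclic_iff : ∀ i, L.Cyclic i ↔ ∃ j, index j = i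

attribute [instance] CyclicFamily.finite CyclicFamily.projective

namespace CyclicFamily

variable {L : SimpleList A} (D : CyclicFamily L)
variable {X : Type u} [AddCommGroup X] [Module A X]

theorem cyclic (j : Fin D.m) : L.Cyclic (D.index j) :=
  (D.cyclic_iff _).2 ⟨j, rfl⟩

variable {D} in
/-- A module whose top contains that of `Q j` receives a nonzero map from `Q j`. -/
theorem hasMap_of_top {j : Fin D.m} (h : HasMap A X (L.S (D.index j))) : HasMap A (D.Q j) X := by
  obtain ⟨f, hf⟩ := h
  obtain ⟨g, hg⟩ := D.top j
  obtain ⟨k, hk⟩ := Module.projective_lifting_property f g (LinearMap.surjective_of_ne_zero hf)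
  exact ⟨k, fun h0 => hg (by rw [← hk, h0, LinearMap.comp_zero])⟩

theorem nontrivial (j : Fin D.m) : Nontrivial (D.Q j) :=
  (D.top j).nontrivial_left

variable {D}

/-- A map between the `Q j` whose kernel receives no nonzero maps from the `Q j` is an isomorphism:
the top of a nonzero kernel would be cyclic, and if the kernel is zero then source and target are
the starting points of arrows with the same target. -/
theorem bijective_of_ker [IsArtinianRing A] {i j : Fin D.m} {t : D.Q j →ₗ[A] D.Q i} (ht : t ≠ 0)
    (h : ∀ l (b : D.Q l →ₗ[A] D.Q j), t ∘ₗ b = 0 → b = 0) :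
    i = j ∧ Function.Bijective t := by
  obtain ⟨k, hik, hk⟩ := (D.cyclic i).arrow
  obtain ⟨l, rfl⟩ := (D.cyclic_iff k).1 hk
  have hi : L.Ends (D.Q i) (D.index l) := by
    obtain ⟨e⟩ := L.exists_linearEquiv (D.uniserial i) (D.top i)
    exact (SimpleList.Ends.congr e).1 hik
  have hr : L.Ends (LinearMap.range t) (D.index l) :=
    (SimpleList.ends_submodule_iff (D.uniserial i) (by rwa [Ne, LinearMap.range_eq_bot])).2 hi
  have hq := (SimpleList.Ends.congr t.quotKerEquivRange).2 hr
  have hker : LinearMap.ker t = ⊥ := by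
    by_contra hker
    obtain ⟨b, hb⟩ := hasMap_of_top ((SimpleList.ends_quotient_iff (D.uniserial j) hker
      (by rwa [Ne, LinearMap.ker_eq_top])).1 hq)
    have := h l ((LinearMap.ker t).subtype ∘ₗ b) (LinearMap.ext fun x => (b x).2)
    exact hb (LinearMap.ext fun x => Subtype.ext (LinearMap.congr_fun this x))
  have hinj := LinearMap.ker_eq_bot.1 hker
  have hj : L.Ends (D.Q j) (D.index l) :=
    (SimpleList.Ends.congr (LinearEquiv.ofInjective t hinj)).2 hr
  obtain rfl : i = j := D.index_injective ((D.cyclic i).eq_of_arrow (D.cyclic j) hik (by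
    obtain ⟨e⟩ := L.exists_linearEquiv (D.uniserial j) (D.top j)
    exact (SimpleList.Ends.congr e).2 hj))
  exact ⟨rfl, IsArtinian.bijective_of_injective_endomorphism t hinj⟩

/-- The annihilator condition that makes the endomorphism algebra selfinjective. -/
theorem exists_comp_eq [IsArtinianRing A] (hA : IsLeftSerial Aᵐᵒᵖ) {i j k : Fin D.m}
    {y : D.Q k →ₗ[A] D.Q i} {w : D.Q k →ₗ[A] D.Q j}
    (h : ∀ l (b : D.Q l →ₗ[A] D.Q k), y ∘ₗ b = 0 → w ∘ₗ b = 0) :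
    ∃ c : D.Q i →ₗ[A] D.Q j, w = c ∘ₗ y := by
  rcases exists_factorization hA (D.uniserial k) (D.uniserial j) (D.uniserial i) w y with
    hc | ⟨t, rfl⟩
  · exact hc
  by_cases ht : t ∘ₗ w = 0
  · exact ⟨0, h k LinearMap.id ht⟩
  have hker : ∀ l (b : D.Q l →ₗ[A] D.Q j), t ∘ₗ b = 0 → b = 0 := fun l b hb => by
    rcases D.uniserial j (LinearMap.range b) (LinearMap.range w) with hle | hle
    · obtain ⟨b', rfl⟩ := exists_comp_eq_of_range_le hle
      exact h l b' hb
    · obtain ⟨w', rfl⟩ := exists_comp_eq_of_range_le hle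
      exact (ht (by rw [← LinearMap.comp_assoc, hb, LinearMap.zero_comp])).elim
  obtain ⟨rfl, hbij⟩ := bijective_of_ker (t := t) (fun h0 => ht (by rw [h0, LinearMap.zero_comp])) hker
  refine ⟨(LinearEquiv.ofBijective t hbij).symm.toLinearMap, LinearMap.ext fun x => ?_⟩
  exact ((LinearEquiv.ofBijective t hbij).symm_apply_apply (w x)).symm

variable (D)

/-- The direct sum of the `Q j`. -/
abbrev Sum : Type u :=
  ∀ j, D.Q j

/-- The endomorphism algebra `End(⨁ Q j)ᵒᵖ`. -/
abbrev EndOp : Type u :=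
  (Module.End A D.Sum)ᵐᵒᵖ

theorem isSelfinjective_endOp [IsArtinianRing A] (hA : IsLeftSerial Aᵐᵒᵖ)
    [IsNoetherianRing D.EndOp] : IsSelfinjective D.EndOp := by
  refine isSelfinjective_of_idempotents op_sum_summandIdempotent op_summandIdempotent_mul_self
    (mul_summandIdempotent_factor D.uniserial) fun i j k y w hy hw h => ?_
  have hy' : ∀ x, summandIdempotent D.Q i (y.unop (summandIdempotent D.Q k x)) = y.unop x :=
    LinearMap.congr_fun (congrArg MulOpposite.unop hy)
  have hw' : ∀ x, summandIdempotent D.Q j (w.unop (summandIdempotent D.Q k x)) = w.unop x :=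
    LinearMap.congr_fun (congrArg MulOpposite.unop hw)
  obtain ⟨c, hc⟩ := exists_comp_eq hA (D := D)
    (y := LinearMap.proj i ∘ₗ y.unop ∘ₗ LinearMap.single A (fun i => D.Q i) k)
    (w := LinearMap.proj j ∘ₗ w.unop ∘ₗ LinearMap.single A (fun i => D.Q i) k) fun l b hb => by
      have := h (.op (LinearMap.single A (fun i => D.Q i) k ∘ₗ b ∘ₗ LinearMap.proj l))
        (MulOpposite.unop_injective (LinearMap.ext fun x => by
          have := LinearMap.congr_fun hb (x l)
          simp only [LinearMap.comp_apply, LinearMap.proj_apply, LinearMap.single_apply] at this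
          rw [MulOpposite.unop_mul, Module.End.mul_apply, ← hy']
          simp [summandIdempotent, this]))
      refine LinearMap.ext fun x => ?_
      have := congrFun (LinearMap.congr_fun (congrArg MulOpposite.unop this) (Pi.single l x)) j
      simpa [Module.End.mul_apply] using this
  refine ⟨.op (LinearMap.single A (fun i => D.Q i) j ∘ₗ c ∘ₗ LinearMap.proj i),
    MulOpposite.unop_injective (LinearMap.ext fun x => ?_)⟩
  have := LinearMap.congr_fun hc (x k)
  simp only [LinearMap.comp_apply, LinearMap.proj_apply, LinearMap.single_apply] at this
  rw [MulOpposite.unop_mul, Module.End.mul_apply, ← hw', ← hy' x]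
  simp [summandIdempotent, this]

end CyclicFamily

end CyclicFamily

/-! ### Connectedness -/

section Connected

variable {A : Type u} [Ring A]

/-- If there are no nonzero maps between the `P i` with `i ∈ O` and those with `i ∉ O`, then `O` is
empty or everything: the sum of the images in `A` of the `P i`, `i ∈ O`, is generated by a central
idempotent. -/
theorem SimpleList.eq_of_isConnected (hconn : IsConnected A) (L : SimpleList A) (O : Fin L.n → Prop)
    (hO : ∀ i j, HasMap A (L.P i) (L.P j) → (O i ↔ O j)) {i : Fin L.n} (hi : O i) (j : Fin L.n) :
    O j := by
  by_contra hj
  let I : (Fin L.n → Prop) → Submodule A A := fun U =>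
    ⨆ τ : (Σ l : {l // U l}, L.P l.1 →ₗ[A] A), LinearMap.range τ.2
  have hmul : ∀ U V : Fin L.n → Prop, (∀ i j, U i → V j → ¬ HasMap A (L.P i) (L.P j)) →
      ∀ x ∈ I U, ∀ y ∈ I V, x * y = 0 := by
    intro U V hUV x hx y hy
    refine Submodule.iSup_induction _ (motive := fun x => x * y = 0) hx (fun τ => ?_)
      (zero_mul y) fun x x' h h' => by rw [add_mul, h, h', add_zero]
    rintro _ ⟨p, rfl⟩
    refine Submodule.iSup_induction _ (motive := fun y => τ.2 p * y = 0) hy (fun σ => ?_)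
      (mul_zero _) fun x x' h h' => by rw [mul_add, h, h', add_zero]
    rintro _ ⟨q, rfl⟩
    have h0 : LinearMap.toSpanSingleton A (L.P σ.1) q ∘ₗ τ.2 = 0 := by
      by_contra h0
      exact hUV _ _ τ.1.2 σ.1.2 ⟨_, h0⟩
    have h1 : τ.2 p • q = 0 := LinearMap.congr_fun h0 p
    rw [← smul_eq_mul, ← map_smul, h1, map_zero]
  have h₁ := hmul O (fun l => ¬ O l) fun i j hi hj h => hj ((hO i j h).1 hi)
  have h₂ := hmul (fun l => ¬ O l) O fun i j hi hj h => hi ((hO i j h).2 hj)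
  have hsup : I O ⊔ I (fun l => ¬ O l) = ⊤ := by
    rw [eq_top_iff, ← L.iSup_range_eq_top A]
    refine iSup_le fun τ => ?_
    by_cases hτ : O τ.1
    · exact le_sup_of_le_left (le_iSup (fun τ : (Σ l : {l // O l}, L.P l.1 →ₗ[A] A) =>
        LinearMap.range τ.2) ⟨⟨τ.1, hτ⟩, τ.2⟩)
    · exact le_sup_of_le_right (le_iSup (fun τ : (Σ l : {l // ¬ O l}, L.P l.1 →ₗ[A] A) =>
        LinearMap.range τ.2) ⟨⟨τ.1, hτ⟩, τ.2⟩)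
  obtain ⟨e, he, e', he', hee⟩ := Submodule.mem_sup.1 (hsup ▸ Submodule.mem_top : (1 : A) ∈ _)
  have hr : ∀ x ∈ I O, x * e = x := fun x hx => by
    rw [← add_zero (x * e), ← h₁ x hx e' he', ← mul_add, hee, mul_one]
  have hl : ∀ x ∈ I O, e * x = x := fun x hx => by
    rw [← add_zero (e * x), ← h₂ e' he' x hx, ← add_mul, hee, one_mul]
  have hcomm : ∀ a, a * e = e * a := fun a => by
    have h₃ := h₁ e he (a * e') (Submodule.smul_mem _ a he')
    have h₄ := hl (a * e) (Submodule.smul_mem _ a he)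
    conv_rhs => rw [← mul_one a, ← hee, mul_add, mul_add, h₃, h₄, add_zero]
  have hne : ∀ (U : Fin L.n → Prop) l, U l → I U ≠ ⊥ := fun U l hl h0 => by
    obtain ⟨x, ψ, hx⟩ := (L.uniserial l).exists_dual
    obtain ⟨p, hp⟩ := @exists_ne _ (L.cover l).nontrivial_left (0 : L.P l)
    have : ψ p ∈ I U := le_iSup (fun τ : (Σ l : {l // U l}, L.P l.1 →ₗ[A] A) =>
      LinearMap.range τ.2) ⟨⟨l, hl⟩, ψ⟩ ⟨p, rfl⟩
    rw [h0, Submodule.mem_bot] at this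
    exact hp (by rw [← hx p, this, zero_smul])
  rcases hconn.2 e (Semigroup.mem_center_iff.2 hcomm) (hr e he) with rfl | rfl
  · exact hne O i hi ((Submodule.eq_bot_iff _).2 fun x hx => by rw [← hr x hx, mul_zero])
  · refine hne (fun l => ¬ O l) j hj ((Submodule.eq_bot_iff _).2 fun x hx => ?_)
    rw [← mul_one x, h₂ x hx 1 he]

/-- Over a connected Nakayama algebra every simple module is reached from a cyclic one by passing
from `S i` to the top of `rad (P i)`. -/
theorem SimpleList.reflTransGen_next [IsArtinianRing A] (hconn : IsConnected A) (hA : IsLeftSerial Aᵐᵒᵖ)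
    (L : SimpleList A) {i : Fin L.n} (hi : L.Cyclic i) (j : Fin L.n) :
    Relation.ReflTransGen L.Next i j := by
  have hcyc := SimpleList.transGen_next_of_arrow hi
  have hback : ∀ {k l}, Relation.ReflTransGen L.Next k l → Relation.ReflTransGen L.Next i l →
      Relation.ReflTransGen L.Next i k := by
    intro k l hkl hil
    induction hkl using Relation.ReflTransGen.head_induction_on with
    | refl => exact hil
    | @head a b hab _ ih =>
      have : Relation.TransGen L.Next i b := by
        rcases Relation.reflTransGen_iff_eq_or_transGen.1 ih with rfl | h
        · exact hcyc
        · exact h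
      obtain ⟨c, hic, hcb⟩ := Relation.TransGen.tail'_iff.1 this
      exact SimpleList.Next.injective hA hcb hab ▸ hic
  refine L.eq_of_isConnected hconn (Relation.ReflTransGen L.Next i) (fun k l h => ?_) .refl j
  have := SimpleList.reflTransGen_next_of_hasMap h
  exact ⟨fun hk => hback this hk, fun hl => hl.trans this⟩

end Connected

/-! ### The elementary modules as quotients of the indecomposable projectives -/

section Trace

variable {A : Type u} [Ring A]

variable (A) in
/-- `X` is a sum of images of maps from `P`. -/
def Generates (P X : Type u) [AddCommGroup P] [Module A P] [AddCommGroup X] [Module A X] : Prop :=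
  ⨆ g : P →ₗ[A] X, LinearMap.range g = ⊤

namespace CyclicFamily

variable {L : SimpleList A} (D : CyclicFamily L)

/-- The largest proper submodule of `Q i` that is generated by `⨁ Q j`. -/
def trace (i : Fin D.m) : Submodule A (D.Q i) :=
  ⨆ g : {g : D.Sum →ₗ[A] D.Q i // LinearMap.range g ≠ ⊤}, LinearMap.range g.1

/-- The quotient of `Q i` by its largest proper submodule generated by `⨁ Q j`. These turn out to
be the elementary modules. -/
abbrev Elem (i : Fin D.m) : Type u :=
  D.Q i ⧸ D.trace i

variable {D} {i : Fin D.m}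

theorem trace_ne_top : D.trace i ≠ ⊤ := by
  obtain ⟨f, hf⟩ := D.top i
  refine ne_top_of_le_ne_top (b := LinearMap.ker f) (by rwa [Ne, LinearMap.ker_eq_top])
    (iSup_le fun g => (D.uniserial i).le_ker hf g.2)

theorem range_le_trace {j : Fin D.m} {f : D.Q j →ₗ[A] D.Q i} (hf : LinearMap.range f ≠ ⊤) :
    LinearMap.range f ≤ D.trace i := by
  have h : LinearMap.range (f ∘ₗ (LinearMap.proj j : D.Sum →ₗ[A] D.Q j)) = LinearMap.range f :=
    LinearMap.range_comp_of_range_eq_top _ (LinearMap.range_eq_top.2 (Function.surjective_eval j))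
  rw [← h] at hf ⊢
  exact le_iSup (fun g : {g : D.Sum →ₗ[A] D.Q i // LinearMap.range g ≠ ⊤} => LinearMap.range g.1)
    ⟨_, hf⟩

theorem generates_trace : Generates A D.Sum (D.trace i) := by
  refine eq_top_iff.2 (Submodule.map_le_map_iff_of_injective (D.trace i).injective_subtype _ _ |>.1 ?_)
  rw [Submodule.map_top, Submodule.range_subtype, Submodule.map_iSup]
  refine iSup_le fun g => ?_
  have hg : ∀ x, g.1 x ∈ D.trace i := fun x =>
    le_iSup (fun g : {g : D.Sum →ₗ[A] D.Q i // LinearMap.range g ≠ ⊤} => LinearMap.range g.1) g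
      ⟨x, rfl⟩
  refine le_iSup_of_le (g.1.codRestrict _ hg) ?_
  rw [← LinearMap.range_comp, LinearMap.subtype_comp_codRestrict]

theorem le_trace {K : Submodule A (D.Q i)} (hK : K ≠ ⊤) (h : Generates A D.Sum K) :
    K ≤ D.trace i := by
  rw [← K.range_subtype, ← Submodule.map_top, ← h, Submodule.map_iSup]
  refine iSup_le fun g => ?_
  rw [← LinearMap.range_comp]
  refine le_iSup (fun g : {g : D.Sum →ₗ[A] D.Q i // LinearMap.range g ≠ ⊤} => LinearMap.range g.1)
    ⟨K.subtype ∘ₗ g, ne_top_of_le_ne_top hK ?_⟩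
  rintro _ ⟨x, rfl⟩
  exact (g x).2

variable {X : Type u} [AddCommGroup X] [Module A X]

theorem generates_of_surjective {j : Fin D.m} {f : D.Q j →ₗ[A] X} (hf : Function.Surjective f) :
    Generates A D.Sum X :=
  eq_top_iff.2 (le_iSup_of_le (f ∘ₗ (LinearMap.proj j : D.Sum →ₗ[A] D.Q j)) (by
    rw [LinearMap.range_eq_top.2]
    exact hf.comp (Function.surjective_eval j)))

/-- A uniserial module with cyclic top is an image of some `Q j`. -/
theorem exists_surjective_of_top {j : Fin D.m} (hX : IsUniserial A X)
    (h : HasMap A X (L.S (D.index j))) : ∃ f : D.Q j →ₗ[A] X, Function.Surjective f := by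
  obtain ⟨g, hg⟩ := D.top j
  obtain ⟨-, k, -, -, hk⟩ := hX.exists_surjective h hg
  exact ⟨k, hk⟩

/-- A simple quotient of a module generated by `⨁ Q j` is cyclic. -/
theorem exists_index_of_generates (h : Generates A D.Sum X) {k : Fin L.n}
    (hk : HasMap A X (L.S k)) : ∃ j, D.index j = k := by
  obtain ⟨f, hf⟩ := hk
  obtain ⟨g, hg⟩ : ∃ g : D.Sum →ₗ[A] X, f ∘ₗ g ≠ 0 := by
    by_contra! hcon
    refine hf (LinearMap.ker_eq_top.1 (top_le_iff.1 (h ▸ iSup_le fun g => ?_)))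
    rintro _ ⟨x, rfl⟩
    exact LinearMap.congr_fun (hcon g) x
  obtain ⟨j, hj⟩ : ∃ j, (f ∘ₗ g) ∘ₗ LinearMap.single A (fun i => D.Q i) j ≠ 0 := by
    by_contra! hcon
    exact hg (LinearMap.pi_ext' fun j => by rw [hcon j, LinearMap.zero_comp])
  exact ⟨j, SimpleList.top_unique (D.uniserial j) (D.top j) ⟨_, hj⟩⟩

/-- Every nonzero map from some `Q j` to `Elem i` is onto: the radical of `Elem i` receives no
nonzero map from `⨁ Q j`. -/
theorem surjective_of_ne_zero {j : Fin D.m} {f : D.Q j →ₗ[A] D.Elem i} (hf : f ≠ 0) :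
    Function.Surjective f := by
  obtain ⟨g, rfl⟩ := Module.projective_lifting_property (D.trace i).mkQ f
    (D.trace i).mkQ_surjective
  by_cases hg : LinearMap.range g = ⊤
  · exact (D.trace i).mkQ_surjective.comp (LinearMap.range_eq_top.1 hg)
  · refine (hf (LinearMap.ext fun x => ?_)).elim
    exact (Submodule.Quotient.mk_eq_zero _).2 (range_le_trace hg ⟨x, rfl⟩)

theorem top_elem : HasMap A (D.Elem i) (L.S (D.index i)) := by
  have := Submodule.Quotient.nontrivial_iff.2 (trace_ne_top (i := i))
  obtain ⟨k, hk⟩ := L.exists_top (D.Elem i)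
  obtain rfl := SimpleList.top_unique (D.uniserial i)
    (HasMap.comp_surjective (D.trace i).mkQ_surjective hk) (D.top i)
  exact hk

theorem uniserial_elem : IsUniserial A (D.Elem i) :=
  (D.uniserial i).quotient _

theorem eq_of_hasMap_elem {j : Fin D.m} (h : HasMap A (D.Q j) (D.Elem i)) : j = i := by
  obtain ⟨f, hf⟩ := h
  exact D.index_injective (SimpleList.top_unique (D.uniserial j) (D.top j)
    (HasMap.comp_surjective (surjective_of_ne_zero hf) top_elem))

theorem arrow_iff {k : Fin L.n} : L.Arrow (D.index i) k ↔ L.Ends (D.Q i) k := by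
  obtain ⟨e⟩ := L.exists_linearEquiv (D.uniserial i) (D.top i)
  exact SimpleList.Ends.congr e

variable [IsArtinianRing A]

/-- `τ` of the socle of an elementary module is cyclic. -/
theorem exists_ends_elem (i : Fin D.m) : ∃ j, L.Ends (D.Elem i) (D.index j) := by
  by_cases hK : D.trace i = ⊥
  · obtain ⟨k, hik, hk⟩ := (D.cyclic i).arrow
    obtain ⟨j, rfl⟩ := (D.cyclic_iff k).1 hk
    exact ⟨j, (SimpleList.Ends.congr (Submodule.quotEquivOfEqBot _ hK)).2 (arrow_iff.1 hik)⟩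
  · have := Submodule.nontrivial_iff_ne_bot.2 hK
    obtain ⟨k, hk⟩ := L.exists_top (D.trace i)
    obtain ⟨j, rfl⟩ := exists_index_of_generates generates_trace hk
    exact ⟨j, (SimpleList.ends_quotient_iff (D.uniserial i) hK trace_ne_top).2 hk⟩

/-- A nonempty set of cyclic simples that is closed under passing from the top of an elementary
module `E` to `τ (soc E)` contains all of them: the composition factors of the `E i`, for `i` in the
set, are closed under `SimpleList.Next`. -/
theorem forall_of_closed (hconn : IsConnected A) (hA : IsLeftSerial Aᵐᵒᵖ) (C : Fin D.m → Prop)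
    (hC : ∀ i j, C i → L.Ends (D.Elem i) (D.index j) → C j) (hi : C i) (j : Fin D.m) : C j := by
  have key : ∀ k, Relation.ReflTransGen L.Next (D.index i) k →
      ∃ i, C i ∧ HasMap A (L.P k) (D.Elem i) := by
    intro k hk
    induction hk with
    | refl =>
      obtain ⟨e⟩ := L.exists_linearEquiv (D.uniserial i) (D.top i)
      exact ⟨i, hi, (HasMap.congr_left e).2 (hasMap_of_top top_elem)⟩
    | @tail k l _ hkl ih =>
      obtain ⟨i, hi, f, hf⟩ := ih
      -- the image `U` of `P k` has top `S k`, and `S l` is the top of its radical, if that is nonzero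
      let U := LinearMap.range f
      have hU : IsUniserial A U := uniserial_elem.submodule U
      have := Submodule.nontrivial_iff_ne_bot.2 (LinearMap.range_eq_bot.not.2 hf)
      obtain ⟨k', g, hg⟩ := L.exists_top U
      obtain rfl : k = k' := SimpleList.top_unique (L.uniserial k) (L.cover k)
        (HasMap.comp_surjective f.surjective_rangeRestrict ⟨g, hg⟩)
      have e : (U ⧸ LinearMap.ker g) ≃ₗ[A] L.S k :=
        g.quotKerEquivOfSurjective (LinearMap.surjective_of_ne_zero hg)
      have hS : L.Ends (U ⧸ LinearMap.ker g) l :=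
        ⟨k, (HasMap.congr_right e).2 (have := (L.simple k).nontrivial; hasMap_self), hkl⟩
      by_cases hK : LinearMap.ker g = ⊥
      · have hUl : L.Ends U l := (SimpleList.Ends.congr (Submodule.quotEquivOfEqBot _ hK)).1 hS
        have hEl := (SimpleList.ends_submodule_iff uniserial_elem (LinearMap.range_eq_bot.not.2 hf)).1
          hUl
        obtain ⟨j', hj'⟩ := exists_ends_elem i
        obtain rfl := hEl.functional uniserial_elem hj'
        obtain ⟨e⟩ := L.exists_linearEquiv (D.uniserial j') (D.top j')
        exact ⟨j', hC i j' hi hj', (HasMap.congr_left e).2 (hasMap_of_top top_elem)⟩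
      · have hl := (SimpleList.ends_quotient_iff hU hK (by rwa [Ne, LinearMap.ker_eq_top])).1 hS
        obtain ⟨h, hh⟩ := SimpleList.exists_surjective_of_top (hU.submodule _) hl
        have := hl.nontrivial_left
        have hPl : HasMap A (L.P l) (LinearMap.ker g) := HasMap.comp_surjective hh hasMap_self
        exact ⟨i, hi, HasMap.comp_injective U.injective_subtype (HasMap.comp_injective
          (LinearMap.ker g).injective_subtype hPl)⟩
  obtain ⟨i', hi', h⟩ := key _ (L.reflTransGen_next hconn hA (D.cyclic i) (D.index j))
  obtain ⟨e⟩ := L.exists_linearEquiv (D.uniserial j) (D.top j)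
  obtain rfl := eq_of_hasMap_elem ((HasMap.congr_left e).1 h)
  exact hi'

/-- If the global dimension is infinite, no `Q i` is elementary. -/
theorem trace_ne_bot (hconn : IsConnected A) (hA : IsLeftSerial Aᵐᵒᵖ) (hgl : globalDimension A = ⊤)
    (i : Fin D.m) : D.trace i ≠ ⊥ := by
  obtain ⟨i₀, h₀⟩ : ∃ i₀ : Fin D.m, D.trace i₀ ≠ ⊥ := by
    obtain ⟨k, hk, K, hK, hK', l, hl, hKl⟩ := L.exists_submodule_of_globalDimension_eq_top hgl
    obtain ⟨i, rfl⟩ := (D.cyclic_iff k).1 hk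
    obtain ⟨j, rfl⟩ := (D.cyclic_iff l).1 hl
    obtain ⟨e⟩ := L.exists_linearEquiv (D.uniserial i) (D.top i)
    obtain ⟨f, hf⟩ := exists_surjective_of_top ((L.uniserial _).submodule K) hKl
    have hle := le_trace (D := D) (i := i) (K := K.map e.toLinearMap) (fun h => hK' ?_)
      (generates_of_surjective (f := (e.submoduleMap K).toLinearMap ∘ₗ f)
        ((e.submoduleMap K).surjective.comp hf))
    · refine ⟨i, fun h => hK ?_⟩
      rw [h, le_bot_iff, Submodule.map_eq_bot_iff] at hle
      exact hle
    · rwa [Submodule.map_eq_top_iff] at h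
  refine forall_of_closed hconn hA (fun i => D.trace i ≠ ⊥) (fun i j hi hij => ?_) h₀ i
  -- the kernel of the projective cover `f` of `trace i` is nonzero, and its top is cyclic
  have htop := (SimpleList.ends_quotient_iff (D.uniserial i) hi trace_ne_top).1 hij
  obtain ⟨f, hf⟩ := exists_surjective_of_top ((D.uniserial i).submodule _) htop
  have := Submodule.nontrivial_iff_ne_bot.2 hi
  obtain ⟨k, hik, hk⟩ := (D.cyclic i).arrow
  obtain ⟨l, rfl⟩ := (D.cyclic_iff k).1 hk
  have hl : L.Ends (D.Q j ⧸ LinearMap.ker f) (D.index l) :=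
    (SimpleList.Ends.congr (f.quotKerEquivOfSurjective hf)).2
      ((SimpleList.ends_submodule_iff (D.uniserial i) hi).2 (arrow_iff.1 hik))
  by_cases hK : LinearMap.ker f = ⊥
  · have hjl := arrow_iff.2 ((SimpleList.Ends.congr (Submodule.quotEquivOfEqBot _ hK)).1 hl)
    obtain rfl := D.index_injective ((D.cyclic i).eq_of_arrow (D.cyclic j) hik hjl)
    have hbij := IsArtinian.bijective_of_injective_endomorphism ((D.trace i).subtype ∘ₗ f)
      ((D.trace i).injective_subtype.comp (LinearMap.ker_eq_bot.1 hK))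
    refine (trace_ne_top (D := D) (i := i) ?_).elim
    rw [eq_top_iff, ← LinearMap.range_eq_top.2 hbij.2]
    rintro _ ⟨x, rfl⟩
    exact (f x).2
  · have hker : LinearMap.ker f ≠ ⊤ := by
      intro h
      obtain ⟨x, hx⟩ := exists_ne (0 : D.trace i)
      obtain ⟨y, rfl⟩ := hf x
      exact hx (LinearMap.mem_ker.1 (h ▸ Submodule.mem_top))
    obtain ⟨g, hg⟩ := exists_surjective_of_top ((D.uniserial j).submodule _)
      ((SimpleList.ends_quotient_iff (D.uniserial j) hK hker).1 hl)
    exact ne_bot_of_le_ne_bot hK (le_trace hker (generates_of_surjective hg))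

/-- A central idempotent of the endomorphism algebra is `0` or `1` on each `Q i`, and it has the
same value on `Q i` and on the projective cover of `trace i`. -/
theorem isConnected_endOp (hconn : IsConnected A) (hA : IsLeftSerial Aᵐᵒᵖ)
    (hgl : globalDimension A = ⊤) : IsConnected D.EndOp := by
  obtain ⟨i₀⟩ : Nonempty (Fin D.m) := by
    obtain ⟨L', k, hk, -⟩ := L.exists_submodule_of_globalDimension_eq_top hgl
    exact ⟨((D.cyclic_iff _).1 k).choose⟩
  have := D.nontrivial
  have : Nontrivial D.Sum := Pi.nontrivial_at i₀
  refine ⟨inferInstance, fun z hz hzz => ?_⟩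
  have hcomm : ∀ (f : Module.End A D.Sum) x, f (z.unop x) = z.unop (f x) := fun f x =>
    LinearMap.congr_fun (congrArg MulOpposite.unop (Semigroup.mem_center_iff.1 hz (.op f))).symm x
  have hidem : ∀ x, z.unop (z.unop x) = z.unop x :=
    LinearMap.congr_fun (congrArg MulOpposite.unop hzz)
  let ζ : ∀ i, D.Q i →ₗ[A] D.Q i := fun i =>
    LinearMap.proj i ∘ₗ z.unop ∘ₗ LinearMap.single A (fun i => D.Q i) i
  have hζ : ∀ i x, z.unop (Pi.single i x) = Pi.single i (ζ i x) := fun i x => by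
    have := hcomm (summandIdempotent D.Q i) (Pi.single i x)
    simpa [summandIdempotent, ζ] using this.symm
  have hζf : ∀ {i j} (f : D.Q j →ₗ[A] D.Q i) x, f (ζ j x) = ζ i (f x) := fun {i j} f x => by
    have := hcomm (LinearMap.single A (fun i => D.Q i) i ∘ₗ f ∘ₗ LinearMap.proj j) (Pi.single j x)
    simpa [ζ] using congrFun this i
  have h01 : ∀ i, ζ i = 0 ∨ ζ i = LinearMap.id := fun i => by
    have hi : ∀ x, ζ i (ζ i x) = ζ i x := fun x => by
      have := hidem (Pi.single i x)
      rw [hζ, hζ] at this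
      exact Pi.single_injective i this
    rcases D.uniserial i (LinearMap.range (ζ i)) (LinearMap.ker (ζ i)) with h | h
    · refine .inl (LinearMap.ext fun x => ?_)
      rw [← hi]
      exact h ⟨x, rfl⟩
    · refine .inr (LinearMap.ext fun x => ?_)
      obtain ⟨y, hy⟩ := h (show x - ζ i x ∈ LinearMap.ker (ζ i) by simp [hi])
      have h1 : ζ i (x - ζ i x) = x - ζ i x := by rw [← hy, hi]
      rw [map_sub, hi, sub_self] at h1
      exact (sub_eq_zero.1 h1.symm).symm
  have hz0 : ∀ {a : D.EndOp}, (∀ i x, z.unop (Pi.single i x) = a.unop (Pi.single i x)) → z = a :=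
    fun {a} h => MulOpposite.unop_injective (LinearMap.pi_ext h)
  have hlink : ∀ i j, L.Ends (D.Elem i) (D.index j) → HasMap A (D.Q j) (D.Q i) := fun i j hij =>
    HasMap.comp_injective (D.trace i).injective_subtype (hasMap_of_top
      ((SimpleList.ends_quotient_iff (D.uniserial i) (trace_ne_bot hconn hA hgl i) trace_ne_top).1
        hij))
  rcases h01 i₀ with h | h
  · have := forall_of_closed hconn hA (fun i => ζ i = 0) (fun i j hi hij => ?_) h
    · exact .inl (hz0 fun i x => by rw [hζ, this i]; simp)
    · obtain ⟨f, hf⟩ := hlink i j hij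
      refine (h01 j).resolve_right fun hj => hf (LinearMap.ext fun x => ?_)
      simpa [hi, hj] using hζf f x
  · have := forall_of_closed hconn hA (fun i => ζ i = LinearMap.id) (fun i j hi hij => ?_) h
    · exact .inr (hz0 fun i x => by rw [hζ, this i]; simp)
    · obtain ⟨f, hf⟩ := hlink i j hij
      refine (h01 j).resolve_left fun hj => hf (LinearMap.ext fun x => ?_)
      simpa [hi, hj] using (hζf f x).symm

end CyclicFamily
end Trace

/-! ### Modules presented by a projective module -/

section Presents

variable {A : Type u} [Ring A]
variable {P X Y Z M : Type u} [AddCommGroup P] [Module A P] [AddCommGroup X] [Module A X]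
  [AddCommGroup Y] [Module A Y] [AddCommGroup Z] [Module A Z] [AddCommGroup M] [Module A M]

theorem Generates.of_surjective (h : Generates A P X) {f : X →ₗ[A] Y}
    (hf : Function.Surjective f) : Generates A P Y := by
  refine eq_top_iff.2 ?_
  rw [← LinearMap.range_eq_top.2 hf, ← Submodule.map_top, ← h, Submodule.map_iSup]
  refine iSup_le fun g => ?_
  rw [← LinearMap.range_comp]
  exact le_iSup (fun g : P →ₗ[A] Y => LinearMap.range g) (f ∘ₗ g)

theorem Generates.of_subsingleton [Subsingleton X] : Generates A P X :=
  Subsingleton.elim _ _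

theorem generates_pi {n : ℕ} : Generates A P (Fin n → P) := by
  refine eq_top_iff.2 fun x _ => ?_
  rw [← Finset.univ_sum_single x]
  exact Submodule.sum_mem _ fun i _ =>
    le_iSup (fun g : P →ₗ[A] (Fin n → P) => LinearMap.range g)
      (LinearMap.single A (fun _ => P) i) ⟨x i, rfl⟩

/-- A finitely generated module that is generated by `P` is a quotient of some `Pⁿ`. -/
theorem Generates.exists_surjective [Module.Finite A X] (h : Generates A P X) :
    ∃ (n : ℕ) (p : (Fin n → P) →ₗ[A] X), Function.Surjective p := by
  obtain ⟨s, hs⟩ := (CompleteLattice.isCompactElement_iff_exists_le_iSup_of_le_iSup (⊤ : Submodule A X)).1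
    ((Submodule.fg_iff_compact _).1 Module.Finite.fg_top) _ (fun g : P →ₗ[A] X => LinearMap.range g)
    h.ge
  let p : (Fin s.card → P) →ₗ[A] X :=
    LinearMap.lsum A (fun _ => P) ℕ fun k => (s.equivFin.symm k : P →ₗ[A] X)
  refine ⟨s.card, p, LinearMap.range_eq_top.1 (top_le_iff.1 (hs.trans (Finset.sup_le fun g hg => ?_)))⟩
  rintro _ ⟨x, rfl⟩
  refine ⟨Pi.single (s.equivFin ⟨g, hg⟩) x, ?_⟩
  simp only [p, LinearMap.lsum_piSingle, Equiv.symm_apply_apply]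

theorem Generates.extension [Module.Projective A P] {f : X →ₗ[A] Y} (hf : Function.Surjective f)
    (hk : Generates A P (LinearMap.ker f)) (hY : Generates A P Y) : Generates A P X := by
  set T := ⨆ g : P →ₗ[A] X, LinearMap.range g with hT
  have h₁ : LinearMap.ker f ≤ T := by
    rw [← (LinearMap.ker f).range_subtype, ← Submodule.map_top, ← hk, Submodule.map_iSup]
    refine iSup_le fun g => ?_
    rw [← LinearMap.range_comp]
    exact le_iSup (fun g : P →ₗ[A] X => LinearMap.range g) _
  have h₂ : T.map f = ⊤ := by
    refine eq_top_iff.2 (hY ▸ iSup_le fun g => ?_)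
    obtain ⟨g', rfl⟩ := Module.projective_lifting_property f g hf
    rw [LinearMap.range_comp]
    exact Submodule.map_mono (le_iSup (fun g : P →ₗ[A] X => LinearMap.range g) _)
  rwa [LinearMap.map_eq_top_iff (LinearMap.range_eq_top.2 hf), sup_eq_left.2 h₁] at h₂

variable (A P M) in
/-- `M` has a presentation `Pᵐ → Pⁿ → M → 0`, except that the kernel of `Pⁿ → M` is not required to
be finitely generated. -/
def Presents : Prop :=
  ∃ (n : ℕ) (p : (Fin n → P) →ₗ[A] M), Function.Surjective p ∧ Generates A P (LinearMap.ker p)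

theorem Presents.generates (h : Presents A P M) : Generates A P M := by
  obtain ⟨n, p, hp, -⟩ := h
  exact generates_pi.of_surjective hp

theorem Presents.congr (e : X ≃ₗ[A] Y) (h : Presents A P X) : Presents A P Y := by
  obtain ⟨n, p, hp, hk⟩ := h
  refine ⟨n, e.toLinearMap ∘ₗ p, e.surjective.comp hp, ?_⟩
  rwa [LinearMap.ker_comp_of_ker_eq_bot _ e.ker]

theorem Presents.of_subsingleton [Subsingleton M] : Presents A P M :=
  ⟨0, 0, fun _ => ⟨0, Subsingleton.elim _ _⟩, .of_subsingleton⟩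

theorem presents_self : Presents A P P :=
  ⟨1, LinearMap.proj 0, Function.surjective_eval 0, by
    have : Subsingleton (LinearMap.ker (LinearMap.proj 0 : (Fin 1 → P) →ₗ[A] P)) :=
      ⟨fun x y => Subtype.ext (funext fun i => by
        rw [Subsingleton.elim i 0]; exact x.2.trans y.2.symm)⟩
    exact .of_subsingleton⟩

/-- If a projective module `Y` and a module `X` both map onto `M`, then `ker f × Y` maps onto `X`
with kernel `ker q`. -/
theorem exists_prod_surjective [Module.Projective A Y] {f : X →ₗ[A] M} {q : Y →ₗ[A] M}
    (hf : Function.Surjective f) (hq : Function.Surjective q) :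
    ∃ a : (LinearMap.ker f × Y) →ₗ[A] X, Function.Surjective a ∧
      Nonempty (LinearMap.ker q ≃ₗ[A] LinearMap.ker a) := by
  obtain ⟨s, rfl⟩ := Module.projective_lifting_property f q hf
  refine ⟨(LinearMap.ker f).subtype.coprod s, fun x => ?_, ⟨LinearEquiv.ofBijective
    (((-(s.restrict (p := LinearMap.ker (f ∘ₗ s)) (q := LinearMap.ker f) fun y hy => hy)).prod
      (LinearMap.ker (f ∘ₗ s)).subtype).codRestrict _ fun y => neg_add_cancel (s y)) ⟨?_, ?_⟩⟩⟩
  · obtain ⟨y, hy⟩ := hq (f x)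
    have hy : f (s y) = f x := hy
    exact ⟨(⟨x - s y, by simp [hy]⟩, y), by simp⟩
  · intro y y' h
    exact Subtype.ext (congrArg (fun z => z.1.2) h)
  · rintro ⟨⟨⟨x, hx⟩, y⟩, hxy⟩
    have hxy : x + s y = 0 := by simpa using hxy
    have hx' : x = -s y := eq_neg_of_add_eq_zero_left hxy
    refine ⟨⟨y, ?_⟩, Subtype.ext (Prod.ext (Subtype.ext hx'.symm) rfl)⟩
    rw [hx', LinearMap.mem_ker, map_neg, neg_eq_zero] at hx
    exact hx

variable [Module.Projective A P]

/-- Not only the kernel of the given presentation, but that of every surjection onto `M` from a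
module generated by `P` is generated by `P`. -/
theorem Presents.generates_ker (h : Presents A P M) {f : X →ₗ[A] M} (hf : Function.Surjective f)
    (hX : Generates A P X) : Generates A P (LinearMap.ker f) := by
  obtain ⟨n, p, hp, hk⟩ := h
  have : Module.Projective A (Fin n → P) := projective_pi (Q := fun _ : Fin n => ModuleCat.of A P)
  obtain ⟨a, ha, ⟨e⟩⟩ := exists_prod_surjective hf hp
  exact (Generates.extension ha (hk.of_surjective e.surjective) hX).of_surjective
    (f := LinearMap.fst A _ _) Prod.fst_surjective

/-- The kernel of a composition of surjections is an extension of the kernels. -/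
theorem exists_ker_comp (p : X →ₗ[A] Y) (hp : Function.Surjective p) (f : Y →ₗ[A] Z) :
    ∃ a : LinearMap.ker (f ∘ₗ p) →ₗ[A] LinearMap.ker f, Function.Surjective a ∧
      Nonempty (LinearMap.ker p ≃ₗ[A] LinearMap.ker a) := by
  refine ⟨p.restrict fun x hx => hx, fun y => ?_, ⟨LinearEquiv.ofBijective
    (((LinearMap.ker p).subtype.codRestrict (LinearMap.ker (f ∘ₗ p)) fun x => by
      simp).codRestrict _ fun x => LinearMap.mem_ker.2 (Subtype.ext (LinearMap.mem_ker.1 x.2))) ⟨?_, ?_⟩⟩⟩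
  · obtain ⟨x, hx⟩ := hp y
    exact ⟨⟨x, by simp [hx]⟩, Subtype.ext hx⟩
  · intro x y h
    exact Subtype.ext (congrArg (fun z => z.1.1) h)
  · rintro ⟨⟨x, hx⟩, hx'⟩
    exact ⟨⟨x, congrArg Subtype.val hx'⟩, rfl⟩

theorem Presents.of_surjective (h : Presents A P X) {f : X →ₗ[A] Y} (hf : Function.Surjective f)
    (hk : Generates A P (LinearMap.ker f)) : Presents A P Y := by
  obtain ⟨n, p, hp, hpk⟩ := h
  obtain ⟨a, ha, ⟨e⟩⟩ := exists_ker_comp p hp f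
  exact ⟨n, f ∘ₗ p, hf.comp hp, .extension ha (hpk.of_surjective e.surjective) hk⟩

theorem Presents.extension [Module.Finite A X] {f : X →ₗ[A] Y} (hf : Function.Surjective f)
    (hk : Presents A P (LinearMap.ker f)) (hY : Presents A P Y) : Presents A P X := by
  obtain ⟨n, p, hp⟩ := (Generates.extension hf hk.generates hY.generates).exists_surjective
  obtain ⟨a, ha, ⟨e⟩⟩ := exists_ker_comp p hp f
  exact ⟨n, p, hp, (hk.generates_ker ha (hY.generates_ker (hf.comp hp) generates_pi)).of_surjective
    e.symm.surjective⟩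

/-- The kernel of a surjection `X → M` of modules presented by `P` is presented by `P` provided that
some projective module `Y` generated by `P` maps onto `M` with a kernel presented by `P`. -/
theorem Presents.ker [IsNoetherianRing A] [Module.Finite A X] [Module.Finite A Y]
    [Module.Projective A Y] (h : Presents A P X) {f : X →ₗ[A] M} (hf : Function.Surjective f)
    {q : Y →ₗ[A] M} (hq : Function.Surjective q) (hY : Generates A P Y)
    (hk : Presents A P (LinearMap.ker q)) : Presents A P (LinearMap.ker f) := by
  obtain ⟨a, ha, ⟨e⟩⟩ := exists_prod_surjective hf hq
  refine Presents.of_surjective (Presents.extension ha (hk.congr e) h)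
    (f := LinearMap.fst A _ _) Prod.fst_surjective ?_
  exact hY.of_surjective (f := (LinearMap.inr A (LinearMap.ker f) Y).codRestrict _ fun y => by simp)
    fun ⟨⟨x, y⟩, hx⟩ => ⟨y, Subtype.ext (Prod.ext (LinearMap.mem_ker.1 hx).symm rfl)⟩

end Presents

/-! ### Elementary modules and the modules they filter -/

section Filtration

variable {A : Type u} [Ring A]

namespace CyclicFamily

variable {L : SimpleList A} {D : CyclicFamily L}
variable {X Y M : Type u} [AddCommGroup X] [Module A X] [AddCommGroup Y] [Module A Y]
  [AddCommGroup M] [Module A M]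

instance (D : CyclicFamily L) : Module.Projective A D.Sum :=
  projective_pi

theorem presents_Q (i : Fin D.m) : Presents A D.Sum (D.Q i) := by
  refine presents_self.of_surjective (f := (LinearMap.proj i : D.Sum →ₗ[A] D.Q i))
    (Function.surjective_eval i) ?_
  let f : D.Sum →ₗ[A] LinearMap.ker (LinearMap.proj i : D.Sum →ₗ[A] D.Q i) :=
    (LinearMap.id - summandIdempotent D.Q i).codRestrict _ fun x => by
      simp [summandIdempotent]
  refine eq_top_iff.2 (le_iSup_of_le f fun x _ => ⟨x, Subtype.ext ?_⟩)
  have hx : x.1 i = 0 := x.2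
  simp [f, summandIdempotent, hx]

theorem presents_elem (i : Fin D.m) : Presents A D.Sum (D.Elem i) :=
  (presents_Q i).of_surjective (D.trace i).mkQ_surjective (by
    rw [Submodule.ker_mkQ]
    exact generates_trace)

/-- A nonzero module presented by `⨁ Q j` maps onto an elementary module: a map from `⨁ Q j` to an
elementary module that is not onto is zero. -/
theorem exists_surjective_elem [Nontrivial M] [Module.Finite A M] (h : Presents A D.Sum M) :
    ∃ (i : Fin D.m) (f : M →ₗ[A] D.Elem i), Function.Surjective f := by
  obtain ⟨k, φ, hφ⟩ := L.exists_top M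
  obtain ⟨i, rfl⟩ := exists_index_of_generates h.generates ⟨φ, hφ⟩
  obtain ⟨n, p, hp, hk⟩ := h
  obtain ⟨χ, hχ⟩ := top_elem (D := D) (i := i)
  have : Module.Projective A (Fin n → D.Sum) :=
    projective_pi (Q := fun _ : Fin n => ModuleCat.of A D.Sum)
  obtain ⟨g, hg⟩ := Module.projective_lifting_property χ (φ ∘ₗ p) (LinearMap.surjective_of_ne_zero hχ)
  have hφp : φ ∘ₗ p ≠ 0 := fun h0 => hφ (LinearMap.ext fun x => by
    obtain ⟨y, rfl⟩ := hp x
    exact LinearMap.congr_fun h0 y)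
  have hgs : Function.Surjective g :=
    uniserial_elem.surjective_of_comp_ne_zero (f := χ) (by rwa [hg])
  have hle : LinearMap.ker p ≤ LinearMap.ker g := by
    rw [← (LinearMap.ker p).range_subtype, ← Submodule.map_top, ← hk, Submodule.map_iSup]
    refine iSup_le fun a => ?_
    rw [← LinearMap.range_comp, LinearMap.range_le_ker_iff]
    by_contra ha
    obtain ⟨j, hj⟩ : ∃ j, (g ∘ₗ (LinearMap.ker p).subtype ∘ₗ a) ∘ₗ
        LinearMap.single A (fun i => D.Q i) j ≠ 0 := by
      by_contra! hcon
      exact ha (LinearMap.pi_ext' fun j => by rw [hcon j, LinearMap.zero_comp])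
    refine hχ (LinearMap.ext fun x => ?_)
    obtain ⟨y, rfl⟩ := surjective_of_ne_zero hj x
    have h₁ := LinearMap.congr_fun hg (a (Pi.single j y))
    have h₂ : p (a (Pi.single j y)) = 0 := (a (Pi.single j y)).2
    simp only [LinearMap.comp_apply, h₂, map_zero] at h₁
    simpa using h₁
  have hlift : Function.Surjective ((LinearMap.ker p).liftQ g hle) := fun x => by
    obtain ⟨y, rfl⟩ := hgs x
    exact ⟨Submodule.Quotient.mk y, rfl⟩
  exact ⟨i, (LinearMap.ker p).liftQ g hle ∘ₗ (p.quotKerEquivOfSurjective hp).symm.toLinearMap,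
    hlift.comp (p.quotKerEquivOfSurjective hp).symm.surjective⟩

variable [IsArtinianRing A]

/-- The module `trace i` is presented by `⨁ Q j`: it is zero or has a cyclic top, and in the latter
case the kernel of its projective cover is zero or has the cyclic top `τ (soc (Q i))`. -/
theorem presents_trace (i : Fin D.m) : Presents A D.Sum (D.trace i) := by
  by_cases hi : D.trace i = ⊥
  · have : Subsingleton (D.trace i) := by rw [hi]; infer_instance
    exact .of_subsingleton
  obtain ⟨j, hij⟩ := exists_ends_elem i
  have htop := (SimpleList.ends_quotient_iff (D.uniserial i) hi trace_ne_top).1 hij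
  obtain ⟨f, hf⟩ := exists_surjective_of_top ((D.uniserial i).submodule _) htop
  refine (presents_Q j).of_surjective hf ?_
  obtain ⟨k, hik, hk⟩ := (D.cyclic i).arrow
  obtain ⟨l, rfl⟩ := (D.cyclic_iff k).1 hk
  have hl : L.Ends (D.Q j ⧸ LinearMap.ker f) (D.index l) :=
    (SimpleList.Ends.congr (f.quotKerEquivOfSurjective hf)).2
      ((SimpleList.ends_submodule_iff (D.uniserial i) hi).2 (arrow_iff.1 hik))
  by_cases hK : LinearMap.ker f = ⊥
  · have : Subsingleton (LinearMap.ker f) := by rw [hK]; infer_instance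
    exact .of_subsingleton
  · have := Submodule.nontrivial_iff_ne_bot.2 hi
    have hker : LinearMap.ker f ≠ ⊤ := by
      intro h
      obtain ⟨x, hx⟩ := exists_ne (0 : D.trace i)
      obtain ⟨y, rfl⟩ := hf x
      exact hx (LinearMap.mem_ker.1 (h ▸ Submodule.mem_top))
    obtain ⟨g, hg⟩ := exists_surjective_of_top ((D.uniserial j).submodule _)
      ((SimpleList.ends_quotient_iff (D.uniserial j) hK hker).1 hl)
    exact generates_of_surjective hg

/-- A filtration with elementary factors of a submodule `N` of `M`. -/
def IsFiltered (D : CyclicFamily L) (N : Submodule A M) : Prop :=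
  ∃ (m : ℕ) (C : ℕ → Submodule A M), C 0 = ⊥ ∧ C m = N ∧ ∀ t < m, C t ≤ C (t + 1) ∧
    ∃ i, Nonempty ((C (t + 1) ⧸ (C t).submoduleOf (C (t + 1))) ≃ₗ[A] D.Elem i)

theorem isFiltered_of_presents [Module.Finite A M] (N : Submodule A M)
    (h : Presents A D.Sum N) : D.IsFiltered N := by
  induction hl : Module.length A N using WellFoundedLT.induction generalizing N with
  | ind l ih =>
  subst hl
  rcases subsingleton_or_nontrivial N with hN | hN
  · exact ⟨0, fun _ => ⊥, rfl, (Submodule.subsingleton_iff_eq_bot.1 hN).symm, by simp⟩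
  obtain ⟨i, f, hf⟩ := exists_surjective_elem h
  have hker : Presents A D.Sum (LinearMap.ker f) := h.ker hf (D.trace i).mkQ_surjective
    (presents_Q i).generates (by rw [Submodule.ker_mkQ]; exact presents_trace i)
  let N' := (LinearMap.ker f).map N.subtype
  let e : LinearMap.ker f ≃ₗ[A] N' := Submodule.equivMapOfInjective _ N.injective_subtype _
  have hkne : LinearMap.ker f ≠ ⊤ := by
    have := (top_elem (D := D) (i := i)).nontrivial_left
    obtain ⟨x, hx⟩ := exists_ne (0 : D.Elem i)
    intro h
    obtain ⟨y, rfl⟩ := hf x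
    exact hx (LinearMap.mem_ker.1 (h ▸ Submodule.mem_top))
  obtain ⟨m, C, h0, hm, hC⟩ := ih _ (by rw [← e.length_eq]; exact Submodule.length_lt hkne) N'
    (hker.congr e) rfl
  obtain ⟨C', hC', hC'N⟩ : ∃ C' : ℕ → Submodule A M, (∀ t ≤ m, C' t = C t) ∧ C' (m + 1) = N :=
    ⟨fun t => if t ≤ m then C t else N, fun t ht => if_pos ht, if_neg (by omega)⟩
  refine ⟨m + 1, C', by rw [hC' 0 (Nat.zero_le _), h0], hC'N, fun t ht => ?_⟩
  rcases Nat.lt_succ_iff_lt_or_eq.1 ht with ht | rfl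
  · rw [hC' t ht.le, hC' (t + 1) ht]
    exact hC t ht
  · rw [hC' t le_rfl, hm, hC'N]
    refine ⟨Submodule.map_subtype_le _ _, i, ⟨Submodule.quotEquivOfEq _ _ ?_ ≪≫ₗ
      f.quotKerEquivOfSurjective hf⟩⟩
    exact Submodule.comap_map_eq_of_injective N.injective_subtype _

theorem IsFiltered.presents [Module.Finite A M] {N : Submodule A M} (h : D.IsFiltered N) :
    Presents A D.Sum N := by
  obtain ⟨m, C, h0, rfl, hC⟩ := h
  induction m with
  | zero =>
    rw [h0]
    exact .of_subsingleton
  | succ m ih =>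
    obtain ⟨hle, i, ⟨e⟩⟩ := hC m m.lt_succ_self
    refine Presents.extension (Submodule.mkQ_surjective ((C m).submoduleOf (C (m + 1)))) ?_
      ((presents_elem i).congr e.symm)
    rw [Submodule.ker_mkQ]
    exact (ih fun t ht => hC t (ht.trans m.lt_succ_self)).congr
      (Submodule.submoduleOfEquivOfLe hle).symm

end CyclicFamily

end Filtration

/-! ### The elementary modules -/

section Elementary

namespace CyclicFamily

theorem surjective_of_mkQ_jacobson {A : Type u} [Ring A] {X Y : Type u} [AddCommGroup X]
    [Module A X] [AddCommGroup Y] [Module A Y] [Module.Finite A X] {f : Y →ₗ[A] X}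
    (hf : Function.Surjective ((Module.jacobson A X).mkQ ∘ₗ f)) : Function.Surjective f := by
  rw [← LinearMap.range_eq_top] at hf ⊢
  by_contra h
  obtain ⟨N, hN, hle⟩ := (eq_top_or_exists_le_coatom (LinearMap.range f)).resolve_left h
  refine hN.1 (top_le_iff.1 ?_)
  rw [LinearMap.range_comp, LinearMap.map_eq_top_iff (Submodule.range_mkQ _), Submodule.ker_mkQ] at hf
  exact hf ▸ sup_le hle (sInf_le hN)

theorem nonempty_top_linearEquiv {A : Type u} [Ring A] {L : SimpleList A} {D : CyclicFamily L}
    {X : Type u} [AddCommGroup X] [Module A X] [Nontrivial X] {i : Fin D.m} {π : D.Q i →ₗ[A] X}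
    (hπ : Function.Surjective π) : Nonempty (NakayamaAlgebra.top A X ≃ₗ[A] L.S (D.index i)) := by
  have : Module.Finite A X := Module.Finite.of_surjective π hπ
  obtain ⟨k, f, hf⟩ := L.exists_top X
  obtain rfl := SimpleList.top_unique (D.uniserial i) (HasMap.comp_surjective hπ ⟨f, hf⟩) (D.top i)
  exact ⟨Submodule.quotEquivOfEq _ _ (((D.uniserial i).of_surjective hπ).jacobson_eq_ker hf)
    ≪≫ₗ f.quotKerEquivOfSurjective (LinearMap.surjective_of_ne_zero hf)⟩

variable (R : Type u) [CommRing R] [IsArtinianRing R] {A : Type u} [Ring A] [Algebra R A]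
  [Module.Finite R A] {L : SimpleList A} (D : CyclicFamily L)

/-- The indecomposable modules in the class `𝒳_c`, described by the list of simple modules: their
top and the simple module that follows their socle are cyclic. -/
theorem inXc_iff (hA : IsNakayama A) (X : ModuleCat.{u} A) :
    InXc R A X ↔ ∃ i j, (∃ π : D.Q i →ₗ[A] X, Function.Surjective π) ∧ Nontrivial X ∧
      L.Ends X (D.index j) := by
  have : IsArtinianRing A := isArtinian_of_tower R inferInstance
  constructor
  · rintro ⟨_, hind, hc, T, hT, hTc⟩
    have := hind.1
    have := hc.isSimpleModule
    have := hTc.isSimpleModule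
    have := IsSimpleModule.nontrivial A (NakayamaAlgebra.top A X)
    have := IsSimpleModule.nontrivial A T
    obtain ⟨k, ⟨e⟩⟩ := L.complete (NakayamaAlgebra.top A X) inferInstance
    obtain ⟨l, ⟨e'⟩⟩ := L.complete T inferInstance
    obtain ⟨i, rfl⟩ := (D.cyclic_iff k).1
      ((L.isCyclicSimple_iff R hA (S := ModuleCat.of A (NakayamaAlgebra.top A X)) e.hasMap).1 hc)
    obtain ⟨j, rfl⟩ := (D.cyclic_iff l).1 ((L.isCyclicSimple_iff R hA e'.hasMap).1 hTc)
    obtain ⟨f, hf⟩ := hasMap_of_top e.hasMap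
    obtain ⟨π, rfl⟩ := Module.projective_lifting_property (Module.jacobson A X).mkQ f
      (Submodule.mkQ_surjective _)
    have hπ := surjective_of_mkQ_jacobson (LinearMap.surjective_of_ne_zero hf)
    exact ⟨i, j, ⟨π, hπ⟩, inferInstance,
      (L.isTranslate_socle_iff R hA ((D.uniserial i).of_surjective hπ) e'.hasMap).1 hT⟩
  · rintro ⟨i, j, ⟨π, hπ⟩, _, hj⟩
    have hX := (D.uniserial i).of_surjective hπ
    have : Module.Finite A X := Module.Finite.of_surjective π hπ
    have := hX.isSimpleModule_top
    have := IsSimpleModule.nontrivial A (NakayamaAlgebra.top A X)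
    obtain ⟨e⟩ := nonempty_top_linearEquiv hπ
    have := (L.simple (D.index j)).nontrivial
    exact ⟨inferInstance, hX.isIndecomposable,
      (L.isCyclicSimple_iff R hA (S := ModuleCat.of A (NakayamaAlgebra.top A X)) e.hasMap).2 (D.cyclic i),
      L.S (D.index j), (L.isTranslate_socle_iff R hA hX hasMap_self).2 hj,
      (L.isCyclicSimple_iff R hA hasMap_self).2 (D.cyclic j)⟩

variable {D} in
/-- The kernel of a projective cover of a module in `𝒳_c` is generated by `⨁ Q j`, since its top is
cyclic. -/
theorem ker_le_trace [IsArtinianRing A] {i j : Fin D.m} {X : Type u} [AddCommGroup X] [Module A X]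
    [Nontrivial X] {π : D.Q i →ₗ[A] X} (hπ : Function.Surjective π)
    (hj : L.Ends X (D.index j)) : LinearMap.ker π ≤ D.trace i := by
  by_cases hK : LinearMap.ker π = ⊥
  · rw [hK]
    exact bot_le
  have hker : LinearMap.ker π ≠ ⊤ := by
    intro h
    obtain ⟨x, hx⟩ := exists_ne (0 : X)
    obtain ⟨y, rfl⟩ := hπ x
    exact hx (LinearMap.mem_ker.1 (h ▸ Submodule.mem_top))
  obtain ⟨g, hg⟩ := exists_surjective_of_top ((D.uniserial i).submodule _)
    ((SimpleList.ends_quotient_iff (D.uniserial i) hK hker).1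
      ((SimpleList.Ends.congr (π.quotKerEquivOfSurjective hπ)).2 hj))
  exact le_trace hker (generates_of_surjective hg)

theorem isElementary_iff (hA : IsNakayama A) (E : ModuleCat.{u} A) :
    IsElementary R A E ↔ ∃ i, Nonempty (E ≃ₗ[A] D.Elem i) := by
  have : IsArtinianRing A := isArtinian_of_tower R inferInstance
  have hE : ∀ i, InXc R A (ModuleCat.of A (D.Elem i)) := fun i => by
    obtain ⟨j, hj⟩ := exists_ends_elem i
    exact (inXc_iff R D hA _).2 ⟨i, j, ⟨_, (D.trace i).mkQ_surjective⟩, top_elem.nontrivial_left, hj⟩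
  have hsurj : ∀ {X : Type u} [AddCommGroup X] [Module A X] [Nontrivial X] {i j : Fin D.m}
      {π : D.Q i →ₗ[A] X}, Function.Surjective π → L.Ends X (D.index j) →
        ∃ s : X →ₗ[A] D.Elem i, Function.Surjective s := by
    intro X _ _ _ i j π hπ hj
    exact ⟨Submodule.factor (ker_le_trace hπ hj) ∘ₗ (π.quotKerEquivOfSurjective hπ).symm.toLinearMap,
      (Submodule.factor_surjective (ker_le_trace hπ hj)).comp (π.quotKerEquivOfSurjective hπ).symm.surjective⟩
  constructor
  · rintro ⟨hX, hmin⟩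
    obtain ⟨i, j, ⟨π, hπ⟩, _, hj⟩ := (inXc_iff R D hA E).1 hX
    have : Module.Finite A E := hX.1
    obtain ⟨s, hs⟩ := hsurj hπ hj
    obtain ⟨e⟩ := nonempty_top_linearEquiv hπ
    have := (top_elem (D := D) (i := i)).nontrivial_left
    obtain ⟨e'⟩ := nonempty_top_linearEquiv (D.trace i).mkQ_surjective
    have hle := hmin _ (hE i) ⟨e' ≪≫ₗ e.symm⟩
    refine ⟨i, ⟨LinearEquiv.ofBijective s ⟨LinearMap.ker_eq_bot.1 ?_, hs⟩⟩⟩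
    by_contra hker
    have hlt := Submodule.length_quotient_lt _ hker
    rw [(s.quotKerEquivOfSurjective hs).length_eq] at hlt
    exact hlt.not_ge hle
  · rintro ⟨i, ⟨e⟩⟩
    obtain ⟨j, hj⟩ := exists_ends_elem i
    have := (top_elem (D := D) (i := i)).nontrivial_left
    have := e.toEquiv.nontrivial
    refine ⟨(inXc_iff R D hA E).2 ⟨i, j, ⟨e.symm.toLinearMap ∘ₗ (D.trace i).mkQ,
      e.symm.surjective.comp (D.trace i).mkQ_surjective⟩, inferInstance,
      (SimpleList.Ends.congr e).2 hj⟩, fun X hX ⟨e'⟩ => ?_⟩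
    obtain ⟨k, l, ⟨π, hπ⟩, _, hl⟩ := (inXc_iff R D hA X).1 hX
    obtain ⟨s, hs⟩ := hsurj hπ hl
    obtain ⟨e₁⟩ := nonempty_top_linearEquiv hπ
    obtain ⟨e₂⟩ := nonempty_top_linearEquiv (X := E) (π := e.symm.toLinearMap ∘ₗ (D.trace i).mkQ)
      (e.symm.surjective.comp (D.trace i).mkQ_surjective)
    obtain rfl := D.index_injective (L.nonIso _ _ ⟨e₁.symm ≪≫ₗ e' ≪≫ₗ e₂⟩)
    rw [e.length_eq]
    exact Module.length_le_of_surjective s hs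

theorem filteredByElementary_iff (hA : IsNakayama A) (M : ModuleCat.{u} A) :
    filteredByElementary R A M ↔ Module.Finite A M ∧ Presents A D.Sum M := by
  have : IsArtinianRing A := isArtinian_of_tower R inferInstance
  have h : filteredByElementary R A M ↔ Module.Finite A M ∧ D.IsFiltered (⊤ : Submodule A M) := by
    simp only [filteredByElementary, IsFiltered, isElementary_iff R D hA]
  rw [h]
  refine and_congr_right fun _ => ⟨fun h => h.presents.congr Submodule.topEquiv, fun h =>
    isFiltered_of_presents _ (h.congr Submodule.topEquiv.symm)⟩

end CyclicFamily

end Elementary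

/-! ### The equivalence given by `Hom(P, -)` -/

section Equivalence

variable {A : Type u} [Ring A]
variable {P M N : Type u} [AddCommGroup P] [Module A P] [AddCommGroup M] [Module A M]
  [AddCommGroup N] [Module A N]

/-- `Hom(P, M)` is a left module over `End(P)ᵒᵖ` by precomposition. -/
instance homModule : Module (Module.End A P)ᵐᵒᵖ (P →ₗ[A] M) where
  smul b g := g ∘ₗ b.unop
  one_smul _ := rfl
  mul_smul _ _ _ := rfl
  smul_zero _ := rfl
  smul_add _ _ _ := rfl
  add_smul _ _ g := LinearMap.comp_add _ _ g
  zero_smul g := LinearMap.comp_zero g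

variable (P) in
/-- `Hom(P, φ)`, as a map of `End(P)ᵒᵖ`-modules. -/
def homMap (φ : M →ₗ[A] N) : (P →ₗ[A] M) →ₗ[(Module.End A P)ᵐᵒᵖ] (P →ₗ[A] N) where
  toFun g := φ ∘ₗ g
  map_add' g g' := LinearMap.comp_add g g' φ
  map_smul' _ _ := rfl

/-- `Hom(P, Pⁿ)` is a free module over `End(P)ᵒᵖ`. -/
def homPi (n : ℕ) :
    (Fin n → (Module.End A P)ᵐᵒᵖ) ≃ₗ[(Module.End A P)ᵐᵒᵖ] (P →ₗ[A] (Fin n → P)) where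
  toFun b := LinearMap.pi fun k => (b k).unop
  invFun g k := .op (LinearMap.proj k ∘ₗ g)
  map_add' _ _ := rfl
  map_smul' _ _ := rfl
  left_inv _ := rfl
  right_inv _ := rfl

theorem homMap_surjective [Module.Projective A P] {φ : M →ₗ[A] N} (hφ : Function.Surjective φ) :
    Function.Surjective (homMap P φ) := fun g =>
  Module.projective_lifting_property φ g hφ

theorem finite_hom [Module.Projective A P] [Module.Finite A M] (h : Generates A P M) :
    Module.Finite (Module.End A P)ᵐᵒᵖ (P →ₗ[A] M) := by
  obtain ⟨n, p, hp⟩ := h.exists_surjective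
  exact Module.Finite.of_surjective (homMap P p ∘ₗ (homPi n).toLinearMap)
    ((homMap_surjective hp).comp (homPi n).surjective)

theorem homMap_injective (h : Generates A P M) :
    Function.Injective (homMap P : (M →ₗ[A] N) → _) := by
  intro φ ψ hφψ
  have hle : ⊤ ≤ LinearMap.eqLocus φ ψ := h ▸ iSup_le fun g => by
    rintro _ ⟨x, rfl⟩
    exact LinearMap.congr_fun (LinearMap.congr_fun hφψ g) x
  exact LinearMap.ext fun x => hle (Submodule.mem_top : x ∈ ⊤)

theorem exists_homMap_eq [Module.Projective A P] (h : Presents A P M)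
    (θ : (P →ₗ[A] M) →ₗ[(Module.End A P)ᵐᵒᵖ] (P →ₗ[A] N)) : ∃ φ : M →ₗ[A] N, homMap P φ = θ := by
  obtain ⟨n, p, hp, hk⟩ := h
  let p' : Fin n → P →ₗ[A] M := fun k => p ∘ₗ LinearMap.single A (fun _ => P) k
  let ψ : (Fin n → P) →ₗ[A] N := ∑ k, θ (p' k) ∘ₗ LinearMap.proj k
  have hψ : ∀ g : P →ₗ[A] (Fin n → P), ψ ∘ₗ g = θ (p ∘ₗ g) := by
    intro g
    have hg : p ∘ₗ g = ∑ k, MulOpposite.op (LinearMap.proj k ∘ₗ g : Module.End A P) • p' k := by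
      refine LinearMap.ext fun x => ?_
      rw [LinearMap.comp_apply, ← Finset.univ_sum_single (g x), map_sum, LinearMap.sum_apply]
      rfl
    rw [hg, map_sum]
    refine LinearMap.ext fun x => ?_
    simp only [ψ, map_smul, LinearMap.comp_apply, LinearMap.sum_apply]
    rfl
  have hle : LinearMap.ker p ≤ LinearMap.ker ψ := by
    rw [← (LinearMap.ker p).range_subtype, ← Submodule.map_top, ← hk, Submodule.map_iSup]
    refine iSup_le fun g => ?_
    rw [← LinearMap.range_comp, LinearMap.range_le_ker_iff, hψ]
    have : p ∘ₗ (LinearMap.ker p).subtype ∘ₗ g = 0 := LinearMap.ext fun x => (g x).2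
    rw [this, map_zero]
  let φ : M →ₗ[A] N := (LinearMap.ker p).liftQ ψ hle ∘ₗ
    (p.quotKerEquivOfSurjective hp).symm.toLinearMap
  have hφ : φ ∘ₗ p = ψ := LinearMap.ext fun x => by
    have : (p.quotKerEquivOfSurjective hp).symm (p x) = Submodule.Quotient.mk x := by
      rw [LinearEquiv.symm_apply_eq]
      rfl
    simp [φ, this]
  refine ⟨φ, LinearMap.ext fun g => ?_⟩
  obtain ⟨g', rfl⟩ := homMap_surjective hp g
  change φ ∘ₗ p ∘ₗ g' = θ (p ∘ₗ g')
  rw [← LinearMap.comp_assoc, hφ, hψ]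

/-- Every finitely generated `End(P)ᵒᵖ`-module is of the form `Hom(P, M)`: a presentation of the
module by free modules is the image under `Hom(P, -)` of a presentation of `M`. -/
theorem exists_presents_hom [Module.Projective A P] [Module.Finite A P] (V : Type u)
    [AddCommGroup V] [Module (Module.End A P)ᵐᵒᵖ V] [Module.Finite (Module.End A P)ᵐᵒᵖ V] :
    ∃ M : ModuleCat.{u} A, Module.Finite A M ∧ Presents A P M ∧
      Nonempty ((P →ₗ[A] M) ≃ₗ[(Module.End A P)ᵐᵒᵖ] V) := by
  obtain ⟨n, q, hq⟩ := Module.Finite.exists_fin' (Module.End A P)ᵐᵒᵖ V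
  let q' : (P →ₗ[A] (Fin n → P)) →ₗ[(Module.End A P)ᵐᵒᵖ] V := q ∘ₗ (homPi n).symm.toLinearMap
  have hq' : Function.Surjective q' := hq.comp (homPi n).symm.surjective
  let T : Submodule A (Fin n → P) := ⨆ g : LinearMap.ker q', LinearMap.range g.1
  have hle : ∀ g : LinearMap.ker q', LinearMap.range g.1 ≤ T := fun g =>
    le_iSup (fun g : LinearMap.ker q' => LinearMap.range g.1) g
  have hT : Generates A P T := by
    refine eq_top_iff.2 ((Submodule.map_le_map_iff_of_injective T.injective_subtype _ _).1 ?_)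
    rw [Submodule.map_top, Submodule.range_subtype, Submodule.map_iSup]
    refine iSup_le fun g => le_iSup_of_le (g.1.codRestrict T fun x => hle g ⟨x, rfl⟩) ?_
    rw [← LinearMap.range_comp, LinearMap.subtype_comp_codRestrict]
  have hker : LinearMap.ker (homMap P T.mkQ) = LinearMap.ker q' := by
    ext g
    constructor
    · intro hg
      have hgT : LinearMap.range g ≤ T := by
        rintro _ ⟨x, rfl⟩
        exact (Submodule.Quotient.mk_eq_zero T).1 (LinearMap.congr_fun (LinearMap.mem_ker.1 hg) x)
      -- `g` factors through finitely many elements of the kernel of `q'`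
      obtain ⟨s, hs⟩ := (CompleteLattice.isCompactElement_iff_exists_le_iSup_of_le_iSup
        (LinearMap.range g)).1 ((Submodule.fg_iff_compact _).1 (Module.Finite.iff_fg.1 (Module.Finite.range g))) _
        (fun g : LinearMap.ker q' => LinearMap.range g.1) hgT
      let r : (s → P) →ₗ[A] (Fin n → P) := ∑ a : s, a.1.1 ∘ₗ LinearMap.proj a
      have hr : LinearMap.range g ≤ LinearMap.range r := hs.trans (Finset.sup_le fun a ha => by
        classical
        rintro _ ⟨x, rfl⟩
        refine ⟨Pi.single ⟨a, ha⟩ x, ?_⟩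
        rw [LinearMap.sum_apply, Finset.sum_eq_single (⟨a, ha⟩ : s)]
        · simp
        · intro b _ hb
          simp [Pi.single_eq_of_ne hb]
        · simp)
      obtain ⟨k, rfl⟩ := exists_comp_eq_of_range_le hr
      have : r ∘ₗ k = ∑ a : s, MulOpposite.op (LinearMap.proj a ∘ₗ k : Module.End A P) • a.1.1 := by
        refine LinearMap.ext fun x => ?_
        simp only [r, LinearMap.comp_apply, LinearMap.sum_apply]
        rfl
      rw [this]
      exact Submodule.sum_mem _ fun a _ => Submodule.smul_mem _ _ a.1.2
    · intro hg
      exact LinearMap.mem_ker.2 (LinearMap.ext fun x =>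
        (Submodule.Quotient.mk_eq_zero T).2 (hle ⟨g, hg⟩ ⟨x, rfl⟩))
  refine ⟨ModuleCat.of A ((Fin n → P) ⧸ T), inferInstance, ⟨n, T.mkQ, T.mkQ_surjective, ?_⟩, ⟨?_⟩⟩
  · rwa [Submodule.ker_mkQ]
  · exact ((homMap P T.mkQ).quotKerEquivOfSurjective (homMap_surjective T.mkQ_surjective)).symm ≪≫ₗ
      Submodule.quotEquivOfEq _ _ hker ≪≫ₗ q'.quotKerEquivOfSurjective hq'

variable (P) in
/-- The functor `Hom(P, -)` on a full subcategory of modules presented by `P`. -/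
def homFunctor [Module.Projective A P] (W : ObjectProperty (ModuleCat.{u} A))
    (hW : ∀ M, W M ↔ Module.Finite A M ∧ Presents A P M) :
    W.FullSubcategory ⥤ FGModuleCat.{u} (Module.End A P)ᵐᵒᵖ where
  obj M := ⟨ModuleCat.of _ (P →ₗ[A] M.obj), by
    obtain ⟨_, h⟩ := (hW M.obj).1 M.property
    exact finite_hom h.generates⟩
  map f := ObjectProperty.homMk (ModuleCat.ofHom (homMap P f.hom.hom))
  map_id _ := rfl
  map_comp _ _ := rfl

theorem exists_equivalence {R : Type u} [CommRing R] [Algebra R A] [Module R P] [IsScalarTower R A P]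
    [Module.Projective A P] [Module.Finite A P] (W : ObjectProperty (ModuleCat.{u} A))
    (hW : ∀ M, W M ↔ Module.Finite A M ∧ Presents A P M) :
    ∃ e : W.FullSubcategory ≌ FGModuleCat.{u} (Module.End A P)ᵐᵒᵖ,
      e.functor.Additive ∧ e.functor.Linear R := by
  let F := homFunctor P W hW
  have hfaith : F.Faithful := ⟨fun {M N f g} h => by
    refine ObjectProperty.hom_ext _ (ModuleCat.hom_ext
      (homMap_injective ((hW M.obj).1 M.property).2.generates ?_))
    exact congrArg (fun f => f.hom.hom) h⟩
  have hfull : F.Full := ⟨fun {M N} θ => by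
    obtain ⟨φ, hφ⟩ := exists_homMap_eq ((hW M.obj).1 M.property).2 θ.hom.hom
    exact ⟨ObjectProperty.homMk (ModuleCat.ofHom φ), ObjectProperty.hom_ext _ (ModuleCat.hom_ext hφ)⟩⟩
  have hess : F.EssSurj := ⟨fun V => by
    have : Module.Finite (Module.End A P)ᵐᵒᵖ V.obj := V.property
    obtain ⟨M, hfin, hpres, ⟨e⟩⟩ := exists_presents_hom (A := A) (P := P) V.obj
    exact ⟨⟨M, (hW M).2 ⟨hfin, hpres⟩⟩, ⟨ObjectProperty.isoMk _ e.toModuleIso⟩⟩⟩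
  have : F.IsEquivalence := ⟨hfaith, hfull, hess⟩
  refine ⟨F.asEquivalence, ⟨fun {M N f g} => ?_⟩, ⟨fun {M N} f r => ?_⟩⟩
  · exact ObjectProperty.hom_ext _ (ModuleCat.hom_ext (LinearMap.ext fun a =>
      LinearMap.ext fun x => rfl))
  · refine ObjectProperty.hom_ext _ (ModuleCat.hom_ext (LinearMap.ext fun (a : P →ₗ[A] M.obj) =>
      LinearMap.ext fun x => ?_))
    change algebraMap R A r • f.hom.hom (a x) = f.hom.hom (a (r • x))
    rw [← algebraMap_smul A r x, map_smul, map_smul]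

end Equivalence

/-! ### The projective covers of a complete list of cyclic simple modules -/

section Covers

variable {R : Type u} [CommRing R] {A : Type u} [Ring A] [Algebra R A]

theorem CyclicCovers.exists_hasMap (L : SimpleList A) (𝒞 : CyclicCovers R A) (j : Fin 𝒞.n) :
    ∃ i, HasMap A (𝒞.S j) (L.S i) := by
  have := (𝒞.cyclic j).isSimpleModule
  have := IsSimpleModule.nontrivial A (𝒞.S j)
  obtain ⟨i, ⟨e⟩⟩ := L.complete (𝒞.S j) inferInstance
  exact ⟨i, e.hasMap⟩

variable [IsArtinianRing R] [Module.Finite R A]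

variable (R) in
theorem nonempty_cyclicCovers (hA : IsNakayama A) (L : SimpleList A) :
    Nonempty (CyclicCovers R A) := by
  classical
  let c := (Fintype.equivFin {i // L.Cyclic i}).symm
  have hcyc : ∀ i, IsCyclicSimple R A (L.S i) ↔ L.Cyclic i := fun i =>
    have := (L.simple i).nontrivial
    L.isCyclicSimple_iff R hA hasMap_self
  refine ⟨⟨_, fun k => L.S (c k).1, fun k => L.P (c k).1, fun k => (hcyc _).2 (c k).2,
    fun i j h => c.injective (Subtype.ext (L.nonIso _ _ h)), fun T hT => ?_, fun k => ?_⟩⟩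
  · obtain ⟨i, ⟨e⟩⟩ := L.complete T hT.isSimpleModule
    have := hT.isSimpleModule
    have := IsSimpleModule.nontrivial A T
    exact ⟨c.symm ⟨i, (L.isCyclicSimple_iff R hA e.hasMap).1 hT⟩, ⟨by
      rw [c.apply_symm_apply]
      exact e⟩⟩
  · obtain ⟨f, hf⟩ := L.cover (c k).1
    have := (L.cover (c k).1).nontrivial_right
    exact ⟨f, (L.uniserial _).isProjectiveCover (LinearMap.surjective_of_ne_zero hf)⟩

/-- The projective covers of a complete list of cyclic simple modules, as a `CyclicFamily`. -/
noncomputable def CyclicCovers.cyclicFamily (hA : IsNakayama A) (L : SimpleList A)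
    (𝒞 : CyclicCovers R A) : CyclicFamily L where
  m := 𝒞.n
  Q := 𝒞.P
  index j := (𝒞.exists_hasMap L j).choose
  finite j := by
    have := (𝒞.cyclic j).isSimpleModule
    exact (𝒞.cover j).choose_spec.finite_of_simple
  projective j := (𝒞.cover j).choose_spec.1
  uniserial j := by
    have := (𝒞.cyclic j).isSimpleModule
    exact (𝒞.cover j).choose_spec.isUniserial hA.1
  top j := HasMap.comp_surjective (𝒞.cover j).choose_spec.2.1 (𝒞.exists_hasMap L j).choose_spec
  index_injective i j hij := by
    have := (𝒞.cyclic i).isSimpleModule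
    have := (𝒞.cyclic j).isSimpleModule
    obtain ⟨e⟩ := (𝒞.exists_hasMap L i).choose_spec.linearEquiv
    obtain ⟨e'⟩ := (𝒞.exists_hasMap L j).choose_spec.linearEquiv
    have hij : (𝒞.exists_hasMap L i).choose = (𝒞.exists_hasMap L j).choose := hij
    rw [hij] at e
    exact 𝒞.nonIso i j ⟨e ≪≫ₗ e'.symm⟩
  cyclic_iff i := by
    constructor
    · intro hi
      have := (L.simple i).nontrivial
      obtain ⟨j, ⟨e⟩⟩ := 𝒞.complete (L.S i) ((L.isCyclicSimple_iff R hA hasMap_self).2 hi)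
      exact ⟨j, SimpleList.eq_of_hasMap
        (HasMap.comp_surjective e.surjective (𝒞.exists_hasMap L j).choose_spec) |>.symm⟩
    · rintro ⟨j, rfl⟩
      have := (𝒞.cyclic j).isSimpleModule
      exact (L.isCyclicSimple_iff R hA (𝒞.exists_hasMap L j).choose_spec).1 (𝒞.cyclic j)

/-- The statements on the endomorphism algebra, for any list of the indecomposable projective
modules with cyclic top. -/
theorem CyclicFamily.endOp_properties (hconn : IsConnected A) (hA : IsNakayama A)
    (hgl : globalDimension A = ⊤) {L : SimpleList A} (D : CyclicFamily L) :
    Module.Finite R D.EndOp ∧ IsConnected D.EndOp ∧ IsSelfinjective D.EndOp ∧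
      IsNakayama D.EndOp ∧
      ∃ e : (filteredByElementary R A).FullSubcategory ≌ FGModuleCat.{u} D.EndOp,
        e.functor.Additive ∧ e.functor.Linear R := by
  have : IsArtinianRing A := isArtinian_of_tower R inferInstance
  have hfin : Module.Finite R D.EndOp := finite_endOp
  have : IsNoetherianRing D.EndOp := isNoetherian_of_tower R inferInstance
  have : IsScalarTower R A D.Sum := Pi.isScalarTower
  exact ⟨hfin, D.isConnected_endOp hconn hA.2 hgl, D.isSelfinjective_endOp hA.2,
    isNakayama_endOp hA.2 D.uniserial,
    exists_equivalence (P := D.Sum) _ (D.filteredByElementary_iff R hA)⟩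

end Covers

end NakayamaAlgebra

theorem proposition3p7 (R : Type u) [CommRing R] [IsArtinianRing R]
    (A : Type u) [Ring A] [Algebra R A] [Module.Finite R A]
    (hconn : NakayamaAlgebra.IsConnected A) (hnak : NakayamaAlgebra.IsNakayama A)
    (hgl : NakayamaAlgebra.globalDimension A = ⊤) :
    Nonempty (NakayamaAlgebra.CyclicCovers R A) ∧
    ∀ 𝒞 : NakayamaAlgebra.CyclicCovers R A,
      Module.Finite R 𝒞.endOp ∧
      NakayamaAlgebra.IsConnected 𝒞.endOp ∧
      NakayamaAlgebra.IsSelfinjective 𝒞.endOp ∧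
      NakayamaAlgebra.IsNakayama 𝒞.endOp ∧
      ∃ e : (NakayamaAlgebra.filteredByElementary R A).FullSubcategory ≌
          FGModuleCat.{u} 𝒞.endOp,
        e.functor.Additive ∧ e.functor.Linear R := by
  have : IsArtinianRing A := isArtinian_of_tower R inferInstance
  obtain ⟨L⟩ := NakayamaAlgebra.exists_simpleList A hnak.1
  refine ⟨NakayamaAlgebra.nonempty_cyclicCovers R hnak L, fun 𝒞 =>
    (𝒞.cyclicFamily hnak L).endOp_properties hconn hnak hgl⟩
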